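/- **Setting.** *Atoms* are a relational structure $\mathbb A=(U,R_1,\dots,R_\ell)$ with countably infinite universe $U$ and finitely many relation symbols, one of which is interpreted as equality on $U$. Let $\Sigma$ be a finite alphabet. A *data word* is a finite (possibly empty) word over $\Sigma\times U$; a subset of $(\Sigma\times U)^*$ is a language. **Register automata.** A nondeterministic register automaton with guessing (NRA$^{\rm g}$) over $\Sigma\times\mathbb A$ has finite sets of states $Q$ (with initial states $Q_{\rm ini}$ and accepting states $Q_{\rm fin}$) and of registers $\mathcal R$, and a finite set of rules $(p,\sigma,\Phi,q)$ with $p,q\in Q$, $\sigma\in\Sigma$ and $\Phi$ a quantifier-free formula (Boolean combination of atomic formulas) over $R_1,\dots,R_\ell$ and a unary predicate $\mathrm{nil}$, whose variables are $\grave r,\acute r$ ($r\in\mathcal R$) and $y$. A configuration is a pair $(q,\mu)$ with $q\in Q$, $\mu:\mathcal R\to U\cup\{\mathrm{nil}\}$; here the predicate $\mathrm{nil}$ holds exactly at $\mathrm{nil}$, and the $R_i$ hold only of tuples of elements of $U$. There is a transition $(p,\mu)\xrightarrow{\sigma,\alpha}(q,\mu')$ if some rule $(p,\sigma,\Phi,q)$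 has $\Phi$ true for $\grave r=\mu(r)$, $\acute r=\mu'(r)$, $y=\alpha$. A run is accepting if it starts in an initial state with all registers $\mathrm{nil}$ and ends in an accepting state; the language of the automaton is the set of data words labelling accepting runs. In a run $(q_0,\mu_0)\xrightarrow{\sigma_1,\alpha_1}\cdots\xrightarrow{\sigma_n,\alpha_n}(q_n,\mu_n)$, a value $\xi\in U$ is *guessed* at $a\ge 1$ if $\xi\in\mu_a(\mathcal R)$, $\xi\notin\mu_{a-1}(\mathcal R)$ and $\xi\ne\alpha_a$. The guess is *strong* if $\alpha_m\neq\xi$ for all $m\in\{a,\dots,b\}$, where $\{a,\dots,b\}$ is the live interval of $\xi$ starting at $a$: $\xi\in\mu_m(\mathcal R)$ for $a\le m\le b$, and $b=n$ or $\xi\notin\mu_{b+1}(\mathcal R)$. An automaton is *weakly guessing* if no accepting run contains a strong guess. $\mathbb A$ has *elimination of strong guessing* if for every finite $\Sigma$, every NRA$^{\rm g}$ over $\Sigma\times\mathbb A$ has the same language as some weakly guessing one. **Scoped MSO.** Formulas are $$\varphi,\psi ::= \exists x\,\varphi\mid\exists X\,\varphi\mid\S_X\varphi\mid\varphi\wedge\psi\mid\varphi\vee\psi\mid\neg\varphi\mid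 x<y\mid X(x)\mid a(x)\mid R_i(x_1,\dots,x_r)$$ with first-order variables $x,y,\dots$, second-order variables $X,Y,\dots$, $a\in\Sigma$, and $r$ the arity of $R_i$. A first-order variable is *nested* if its binding quantifier lies in the scope of a negation. A formula is *well-formed* if every atomic formula $R_i(x_1,\dots,x_r)$ in it contains at most one nested variable. $\mathrm{MSO_S}[\Sigma,\mathbb A]$ is the set of well-formed formulas. Formulas are evaluated in a data word with a valuation $\nu$ and a scope $I=\{a,\dots,b\}$ (a possibly empty range of positions): atomic formulas and Boolean connectives are standard and ignore $I$, where $R_i(x_1,\dots,x_r)$ means that $R_i$ holds of the data values at positions $\nu(x_1),\dots,\nu(x_r)$; $\exists x$ ranges over $I$ and $\exists X$ over subsets of $I$; and $\S_X\varphi$ holds iff $\varphi$ holds in every scope $\{a',\dots,b'\}$ such that $a'$ and $b'+1$ are consecutive elements of $(\nu(X)\cap I)\cup\{a,b+1\}$. A sentence (a formula without free variables) is evaluated with the set of all positions as scope, and its language is the set of data words in which it holds. *Satisfiability of $\mathrm{MSO_S}[\Sigma,\mathbb A]$* is the problem: given a sentence $\varphi\in\mathrm{MSO_S}[\Sigma,\mathbb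 A]$, is its language nonempty? *Emptiness of NRA$^{\rm g}[\Sigma,\mathbb A]$* is the problem: given an NRA$^{\rm g}$ over $\Sigma\times\mathbb A$, is its language empty? In both, $\Sigma$ and $\mathbb A$ are fixed. Decidable means that a total computable function answers correctly on (standard codes of) all instances. **Corollary.** If $\mathbb A$ has elimination of strong guessing, then for every finite alphabet $\Sigma$, satisfiability of $\mathrm{MSO_S}[\Sigma,\mathbb A]$ is decidable if and only if emptiness of NRA$^{\rm g}[\Sigma,\mathbb A]$ is decidable. Moreover, for every finite alphabet $\Sigma$, satisfiability of $\mathrm{MSO_S}[\Sigma,\mathbb A]$ is decidable for the equality atoms $\mathbb A=(\mathbb N,=)$ and for the dense order atoms $\mathbb A=(\mathbb Q,<,=)$. -/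

import Mathlib

universe u

namespace DataWords

/-- Atoms: a relational structure with a countably infinite universe and finitely many relation
symbols, one of which is interpreted as equality. -/
structure Atoms where
  /-- The universe of data values. -/
  U : Type u
  countable : Countable U
  infinite : Infinite U
  /-- Number of relation symbols. -/
  numRel : ℕ
  /-- Arity of each relation symbol. -/
  arity : Fin numRel → ℕ
  /-- Interpretation of each relation symbol. -/
  rel : (R : Fin numRel) → (Fin (arity R) → U) → Prop
  hasEq : ∃ (R : Fin numRel) (h : arity R = 2), ∀ v : Fin (arity R) → U,
    rel R v ↔ v (Fin.cast h.symm 0) = v (Fin.cast h.symm 1)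

/-- Equality atoms `(ℕ, =)`. -/
def equalityAtoms : Atoms.{0} where
  U := ℕ
  countable := inferInstance
  infinite := inferInstance
  numRel := 1
  arity := fun _ => 2
  rel := fun _ v => v 0 = v 1
  hasEq := ⟨0, rfl, fun _ => Iff.rfl⟩

/-- Dense order atoms `(ℚ, <, =)`; symbol `0` is `<` and symbol `1` is `=`. -/
def denseOrderAtoms : Atoms.{0} where
  U := ℚ
  countable := inferInstance
  infinite := inferInstance
  numRel := 2
  arity := fun _ => 2
  rel := fun R v => if R = 0 then v 0 < v 1 else v 0 = v 1
  hasEq := ⟨1, rfl, fun _ => by simp⟩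

/-- A data word over `S × 𝔸`; position `i`, counted from `1`, is list index
`i - 1`. -/
abbrev DataWord (S : Type) (𝔸 : Atoms.{u}) : Type u := List (S × 𝔸.U)

/-- The data value at list index `p`, if there is such an index. -/
def DataWord.data? {S : Type} {𝔸 : Atoms.{u}} (w : DataWord S 𝔸) (p : ℕ) : Option 𝔸.U :=
  (w[p]?).map Prod.snd

/-! ### Decision problems -/

/-- The decision problem "given `a : α`, presented by its code `code a : ℕ`, does `P a` hold?" is
decidable: some total computable function answers it correctly on every code of an instance. -/
def DecidableProblem {α : Type*} (code : α → ℕ) (P : α → Prop) : Prop :=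
  ∃ f : ℕ → Bool, Computable f ∧ ∀ a, f (code a) = true ↔ P a

/-! ### Register automata with guessing -/

/-- Variables of a register constraint for `k` registers: register values before the transition,
register values after it, and the current input data value. -/
inductive RegVar (k : ℕ) : Type
  | pre (r : Fin k)
  | post (r : Fin k)
  | cur

/-- Quantifier-free formulas with variables `V` over `𝔸` with an added element `nil` and
a unary predicate recognising it. -/
inductive Constraint (𝔸 : Atoms.{u}) (V : Type) : Type
  | top
  | neg (Φ : Constraint 𝔸 V)
  | and (Φ Ψ : Constraint 𝔸 V)
  | rel (R : Fin 𝔸.numRel) (x : Fin (𝔸.arity R) → V)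
  | isNil (x : V)

/-- Truth of a quantifier-free formula over `𝔸` extended with `nil`, where `nil` is
`none : Option 𝔸.U`. The relations of `𝔸` keep their interpretation, so that they contain no tuple
in which `nil` occurs. -/
def Constraint.Holds {𝔸 : Atoms.{u}} {V : Type} (ν : V → Option 𝔸.U) : Constraint 𝔸 V → Prop
  | .top => True
  | .neg Φ => ¬ Φ.Holds ν
  | .and Φ Ψ => Φ.Holds ν ∧ Ψ.Holds ν
  | .rel R x => ∃ d : Fin (𝔸.arity R) → 𝔸.U, (∀ j, ν (x j) = some (d j)) ∧ 𝔸.rel R d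
  | .isNil x => ν x = none

/-- A transition rule `p ⇒ q` reading the label `letter` under a register constraint. -/
structure Rule (S : Type) (𝔸 : Atoms.{u}) (n k : ℕ) where
  source : Fin n
  letter : S
  guard : Constraint 𝔸 (RegVar k)
  target : Fin n

/-- Nondeterministic register automata with guessing over `S × 𝔸`. States and registers are
numbered, and the finite sets of initial states, accepting states and rules are given by lists, so
that an automaton is a finite object. -/
structure NRA (S : Type) (𝔸 : Atoms.{u}) where
  numStates : ℕ
  numRegs : ℕ
  init : List (Fin numStates)
  final : List (Fin numStates)
  rules : List (Rule S 𝔸 numStates numRegs)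

namespace NRA

variable {S : Type} {𝔸 : Atoms.{u}}

/-- A state together with a register valuation (`none` is the empty register). -/
abbrev Config (A : NRA S 𝔸) : Type u := Fin A.numStates × (Fin A.numRegs → Option 𝔸.U)

/-- The combined valuation of the variables of a constraint. -/
def combine {k : ℕ} (μ : Fin k → Option 𝔸.U) (α : 𝔸.U) (μ' : Fin k → Option 𝔸.U) :
    RegVar k → Option 𝔸.U
  | .pre r => μ r
  | .post r => μ' r
  | .cur => some α

/-- The transition relation on configurations. -/
def Step (A : NRA S 𝔸) (c : A.Config) (l : S × 𝔸.U) (c' : A.Config) : Prop :=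
  ∃ t ∈ A.rules, t.source = c.1 ∧ t.letter = l.1 ∧ t.target = c'.1 ∧
    t.guard.Holds (combine c.2 l.2 c'.2)

/-- `c 0, …, c n` is an accepting run over the word `w` of length `n`; later values of `c` are
irrelevant. -/
def AcceptingRun (A : NRA S 𝔸) (w : DataWord S 𝔸) (c : ℕ → A.Config) : Prop :=
  ((c 0).1 ∈ A.init ∧ ∀ r, (c 0).2 r = none) ∧
  (∀ i (hi : i < w.length), A.Step (c i) w[i] (c (i + 1))) ∧
  (c w.length).1 ∈ A.final

/-- The language recognised by an automaton. -/
def language (A : NRA S 𝔸) : Set (DataWord S 𝔸) := {w | ∃ c, A.AcceptingRun w c}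

/-- The data value `ξ` is stored in some register of the `m`-th configuration. -/
def Stored (A : NRA S 𝔸) (c : ℕ → A.Config) (m : ℕ) (ξ : 𝔸.U) : Prop :=
  ∃ r, (c m).2 r = some ξ

/-- In the `a`-th configuration, `1 ≤ a ≤ |w|`, the value `ξ` of some register is guessed: it
was in no register just before and it is not the `a`-th data value of the word. -/
def Guesses (A : NRA S 𝔸) (w : DataWord S 𝔸) (c : ℕ → A.Config) (a : ℕ) (ξ : 𝔸.U) : Prop :=
  1 ≤ a ∧ a ≤ w.length ∧ A.Stored c a ξ ∧ ¬ A.Stored c (a - 1) ξ ∧ w.data? (a - 1) ≠ some ξ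

/-- `{a, …, b}` is the live interval of `ξ` that begins at `a`. -/
def LiveInterval (A : NRA S 𝔸) (w : DataWord S 𝔸) (c : ℕ → A.Config) (a b : ℕ) (ξ : 𝔸.U) :
    Prop :=
  a ≤ b ∧ b ≤ w.length ∧ (∀ m, a ≤ m → m ≤ b → A.Stored c m ξ) ∧
    (b = w.length ∨ ¬ A.Stored c (b + 1) ξ)

/-- The guess of `ξ` in the `a`-th configuration is strong: `ξ` is not among the data values of the
word in its live interval. -/
def GuessesStrongly (A : NRA S 𝔸) (w : DataWord S 𝔸) (c : ℕ → A.Config) (a : ℕ) (ξ : 𝔸.U) :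
    Prop :=
  A.Guesses w c a ξ ∧
    ∃ b, A.LiveInterval w c a b ξ ∧ ∀ m, a ≤ m → m ≤ b → w.data? (m - 1) ≠ some ξ

/-- No strong guess occurs in an accepting run. -/
def WeaklyGuessing (A : NRA S 𝔸) : Prop :=
  ∀ w c, A.AcceptingRun w c → ∀ a ξ, ¬ A.GuessesStrongly w c a ξ

end NRA

/-- Elimination of strong guessing: over every finite alphabet, every automaton has an equivalent
weakly guessing one. -/
def Atoms.ElimStrongGuessing (𝔸 : Atoms.{u}) : Prop :=
  ∀ (S : Type) [Finite S] (A : NRA S 𝔸),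
    ∃ B : NRA S 𝔸, B.WeaklyGuessing ∧ B.language = A.language

/-! ### Codes of automata -/

/-- Code of a variable of a register constraint. -/
def RegVar.code {k : ℕ} : RegVar k → ℕ
  | .pre r => Nat.pair 0 r
  | .post r => Nat.pair 1 r
  | .cur => Nat.pair 2 0

/-- Code of a register constraint. -/
def Constraint.code {𝔸 : Atoms.{u}} {k : ℕ} : Constraint 𝔸 (RegVar k) → ℕ
  | .top => Nat.pair 0 0
  | .neg Φ => Nat.pair 1 Φ.code
  | .and Φ Ψ => Nat.pair 2 (Nat.pair Φ.code Ψ.code)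
  | .rel R x => Nat.pair 3 (Nat.pair R (Encodable.encode (List.ofFn fun j => (x j).code)))
  | .isNil x => Nat.pair 4 x.code

/-- Code of a transition rule. -/
def Rule.code {S : Type} [Encodable S] {𝔸 : Atoms.{u}} {n k : ℕ} (t : Rule S 𝔸 n k) : ℕ :=
  Nat.pair t.source (Nat.pair (Encodable.encode t.letter) (Nat.pair t.guard.code t.target))

/-- Code of an automaton. -/
def NRA.code {S : Type} [Encodable S] {𝔸 : Atoms.{u}} (A : NRA S 𝔸) : ℕ :=
  Nat.pair A.numStates (Nat.pair A.numRegs (Nat.pair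
    (Encodable.encode (A.init.map fun q => (q : ℕ))) (Nat.pair
      (Encodable.encode (A.final.map fun q => (q : ℕ)))
      (Encodable.encode (A.rules.map Rule.code)))))

/-! ### Scoped MSO -/

/-- Formulas of Scoped MSO before the well-formedness condition. First-order and second-order
variables are both named by natural numbers, independently of each other. -/
inductive Formula (S : Type) (𝔸 : Atoms.{u}) : Type
  /-- `∃ x φ` -/
  | exFO (x : ℕ) (φ : Formula S 𝔸)
  /-- `∃ X φ` -/
  | exSO (X : ℕ) (φ : Formula S 𝔸)
  /-- the segment modality on `φ` with split points `X` -/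
  | segment (X : ℕ) (φ : Formula S 𝔸)
  | and (φ ψ : Formula S 𝔸)
  | or (φ ψ : Formula S 𝔸)
  | neg (φ : Formula S 𝔸)
  /-- `x < y` -/
  | lt (x y : ℕ)
  /-- `X(x)` -/
  | mem (X x : ℕ)
  /-- `a(x)` -/
  | letter (a : S) (x : ℕ)
  /-- the data atomic formula `R(x₁, …, xᵣ)` -/
  | rel (R : Fin 𝔸.numRel) (x : Fin (𝔸.arity R) → ℕ)

/-- The set of contiguous sub-ranges of the range `{a, …, b - 1}` obtained by cutting it at every
position of `X`. A range `{a', …, b' - 1}` is given by the pair `(a', b')`; here `a'` and `b'` are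
consecutive elements of `(X ∩ {a, …, b - 1}) ∪ {a, b}`. -/
def subs (a b : ℕ) (X : Set ℕ) : Set (ℕ × ℕ) :=
  {I | I.1 ∈ X ∩ Set.Ico a b ∪ {a, b} ∧ I.2 ∈ X ∩ Set.Ico a b ∪ {a, b} ∧ I.1 < I.2 ∧
    ∀ p ∈ X ∩ Set.Ico a b ∪ {a, b}, ¬ (I.1 < p ∧ p < I.2)}

namespace Formula

variable {S : Type} {𝔸 : Atoms.{u}}

/-- Free first-order variables. -/
def freeFO : Formula S 𝔸 → Finset ℕ
  | .exFO x φ => φ.freeFO.erase x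
  | .exSO _ φ => φ.freeFO
  | .segment _ φ => φ.freeFO
  | .and φ ψ => φ.freeFO ∪ ψ.freeFO
  | .or φ ψ => φ.freeFO ∪ ψ.freeFO
  | .neg φ => φ.freeFO
  | .lt x y => {x, y}
  | .mem _ x => {x}
  | .letter _ x => {x}
  | .rel _ x => Finset.univ.image x

/-- Free second-order variables. -/
def freeSO : Formula S 𝔸 → Finset ℕ
  | .exFO _ φ => φ.freeSO
  | .exSO X φ => φ.freeSO.erase X
  | .segment X φ => insert X φ.freeSO
  | .and φ ψ => φ.freeSO ∪ ψ.freeSO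
  | .or φ ψ => φ.freeSO ∪ ψ.freeSO
  | .neg φ => φ.freeSO
  | .lt _ _ => ∅
  | .mem X _ => {X}
  | .letter _ _ => ∅
  | .rel _ _ => ∅

/-- A sentence has no free variables. -/
def IsSentence (φ : Formula S 𝔸) : Prop := φ.freeFO = ∅ ∧ φ.freeSO = ∅

/-- Well-formedness of a subformula that lies in the scope of a negation (`underNeg = true`) or not
(`underNeg = false`), where `N` is the set of those first-order variables whose current binder lies
in the scope of a negation (the nested ones): every data atomic formula contains at most one nested
variable. -/
def WFAux : Bool → Finset ℕ → Formula S 𝔸 → Prop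
  | true, N, .exFO x φ => WFAux true (insert x N) φ
  | false, N, .exFO x φ => WFAux false (N.erase x) φ
  | n, N, .exSO _ φ => WFAux n N φ
  | n, N, .segment _ φ => WFAux n N φ
  | n, N, .and φ ψ => WFAux n N φ ∧ WFAux n N ψ
  | n, N, .or φ ψ => WFAux n N φ ∧ WFAux n N ψ
  | _, N, .neg φ => WFAux true N φ
  | _, _, .lt _ _ => True
  | _, _, .mem _ _ => True
  | _, _, .letter _ _ => True
  | _, N, .rel _ x => ∀ i j, x i ∈ N → x j ∈ N → x i = x j

/-- Well-formed formulas: every data atomic formula contains at most one nested variable. -/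
def WellFormed (φ : Formula S 𝔸) : Prop := WFAux false ∅ φ

/-- Satisfaction in the structure of the data word `w`, with valuation `ν` of the first-order and
`η` of the second-order variables, and with the scope `{a, …, b - 1}`. Positions are list indices.
-/
def Sat (w : DataWord S 𝔸) : (ℕ → ℕ) → (ℕ → Set ℕ) → ℕ → ℕ → Formula S 𝔸 → Prop
  | ν, η, a, b, .exFO x φ => ∃ p ∈ Set.Ico a b, Sat w (Function.update ν x p) η a b φ
  | ν, η, a, b, .exSO X φ => ∃ P ⊆ Set.Ico a b, Sat w ν (Function.update η X P) a b φ
  | ν, η, a, b, .segment X φ => ∀ I ∈ subs a b (η X), Sat w ν η I.1 I.2 φ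
  | ν, η, a, b, .and φ ψ => Sat w ν η a b φ ∧ Sat w ν η a b ψ
  | ν, η, a, b, .or φ ψ => Sat w ν η a b φ ∨ Sat w ν η a b ψ
  | ν, η, a, b, .neg φ => ¬ Sat w ν η a b φ
  | ν, _, _, _, .lt x y => ν x < ν y
  | ν, η, _, _, .mem X x => ν x ∈ η X
  | ν, _, _, _, .letter s x => (w[ν x]?).map Prod.fst = some s
  | ν, _, _, _, .rel R x => ∃ d : Fin (𝔸.arity R) → 𝔸.U,
      (∀ j, w.data? (ν (x j)) = some (d j)) ∧ 𝔸.rel R d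

/-- Code of a formula. -/
def code [Encodable S] : Formula S 𝔸 → ℕ
  | .exFO x φ => Nat.pair 0 (Nat.pair x φ.code)
  | .exSO X φ => Nat.pair 1 (Nat.pair X φ.code)
  | .segment X φ => Nat.pair 2 (Nat.pair X φ.code)
  | .and φ ψ => Nat.pair 3 (Nat.pair φ.code ψ.code)
  | .or φ ψ => Nat.pair 4 (Nat.pair φ.code ψ.code)
  | .neg φ => Nat.pair 5 φ.code
  | .lt x y => Nat.pair 6 (Nat.pair x y)
  | .mem X x => Nat.pair 7 (Nat.pair X x)
  | .letter a x => Nat.pair 8 (Nat.pair (Encodable.encode a) x)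
  | .rel R x => Nat.pair 9 (Nat.pair R (Encodable.encode (List.ofFn x)))

end Formula

/-- Sentences of Scoped MSO over `S × 𝔸`. -/
def SMSO (S : Type) (𝔸 : Atoms.{u}) : Type :=
  {φ : Formula S 𝔸 // φ.WellFormed ∧ φ.IsSentence}

namespace SMSO

variable {S : Type} {𝔸 : Atoms.{u}}

/-- The language of a sentence: the scope is the set of all positions, and the initial valuation
is irrelevant. -/
def language (φ : SMSO S 𝔸) : Set (DataWord S 𝔸) :=
  {w | φ.1.Sat w (fun _ => 0) (fun _ => ∅) 0 w.length}

/-- Code of a sentence. -/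
def code [Encodable S] (φ : SMSO S 𝔸) : ℕ := φ.1.code

end SMSO

/-- Satisfiability of Scoped MSO over `S × 𝔸` is decidable. -/
def SatisfiabilityDecidable (S : Type) [Encodable S] (𝔸 : Atoms.{u}) : Prop :=
  DecidableProblem (SMSO.code (S := S) (𝔸 := 𝔸)) fun φ => φ.language.Nonempty

/-- Emptiness of register automata with guessing over `S × 𝔸` is decidable. -/
def EmptinessDecidable (S : Type) [Encodable S] (𝔸 : Atoms.{u}) : Prop :=
  DecidableProblem (NRA.code (S := S) (𝔸 := 𝔸)) fun A => A.language = ∅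

end DataWords

namespace DataWords

/-! ### Primitive recursion -/

section PrimrecCalculus

open Encodable

attribute [fun_prop] Primrec
attribute [fun_prop] Primrec.const Primrec.comp

variable {α β γ σ : Type*} [Primcodable α] [Primcodable β] [Primcodable γ] [Primcodable σ]

/-! The equivalence comes from two primitive recursive translations on codes, one in each direction,
that preserve nonemptiness of languages.

From sentences to automata (`SMSO.language_toNRA`, which even preserves the language itself): the
data value at a first-order variable bound outside all negations is kept in a register of its own,
guessed at the start of the scope and constant along it. A data atom has at most one nested
variable, so a register constraint can test it at the position of that variable; if it has none, any
position of the scope will do. The segments of a scope are disjoint, so one register can hold a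
different value in each of them, and the segment modality needs no further registers. This reading
of a formula is `RegSat`, and `sat_iff_exists_regSat` compares it with satisfaction. Once the
positions where each of the finitely many constraints holds are given as tracks, what remains is
monadic second-order logic over finite words (`holds_toTrack`), for which the classical construction
of finite automata applies (`TrackFormula.holds_iff_acc`). The register automaton runs that finite
automaton, guesses at each step which constraints hold and verifies the guess in its guard
(`mem_language_toNRA`).

From automata to sentences (`NRA.language_toSMSO`): only nonemptiness has to survive, so a run may
be written out in a longer word. With `N` registers, some of which encode the state, each step
becomes a window of `2 * N + 1` positions: register contents before the step, the input value,
register contents after it. One segmentation isolates the windows; there, quantifiers outside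
negations name all positions, so that a guard may relate any of them. A second segmentation cuts at
the input values. Its pieces straddle the borders between windows, and in them the contents after
one step are compared with the contents before the next.

For the two concrete structures, the relations depend only on the order type of their arguments,
once the universe is identified with `ℚ`. Emptiness then becomes reachability in a finite graph
whose nodes are a state together with an order type of register contents
(`NRA.language_nonempty_iff_graphAccepts`). Every abstract step can be realised from every concrete
configuration of the given type, because finite partial order embeddings into `ℚ` extend
(`exists_strictMonoOn_extension`, `Pattern.exists_extension`). Satisfiability follows by the first
translation. -/

@[fun_prop] theorem primrec_id : Primrec fun x : α => x := Primrec.id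

@[fun_prop] theorem primrec_mk {f : α → β} {g : α → γ} (hf : Primrec f) (hg : Primrec g) :
    Primrec fun x => (f x, g x) := hf.pair hg

@[fun_prop] theorem primrec_fst {f : α → β × γ} (hf : Primrec f) : Primrec fun x => (f x).1 :=
  Primrec.fst.comp hf

@[fun_prop] theorem primrec_snd {f : α → β × γ} (hf : Primrec f) : Primrec fun x => (f x).2 :=
  Primrec.snd.comp hf

@[fun_prop] theorem primrec_natPair {f g : α → ℕ} (hf : Primrec f) (hg : Primrec g) :
    Primrec fun x => Nat.pair (f x) (g x) := Primrec₂.natPair.comp hf hg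

@[fun_prop] theorem primrec_unpair {f : α → ℕ} (hf : Primrec f) :
    Primrec fun x => Nat.unpair (f x) := Primrec.unpair.comp hf

@[fun_prop] theorem primrec_add {f g : α → ℕ} (hf : Primrec f) (hg : Primrec g) :
    Primrec fun x => f x + g x := Primrec.nat_add.comp hf hg

@[fun_prop] theorem primrec_sub {f g : α → ℕ} (hf : Primrec f) (hg : Primrec g) :
    Primrec fun x => f x - g x := Primrec.nat_sub.comp hf hg

@[fun_prop] theorem primrec_mul {f g : α → ℕ} (hf : Primrec f) (hg : Primrec g) :
    Primrec fun x => f x * g x := Primrec.nat_mul.comp hf hg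

@[fun_prop] theorem primrec_mod {f g : α → ℕ} (hf : Primrec f) (hg : Primrec g) :
    Primrec fun x => f x % g x := Primrec.nat_mod.comp hf hg

@[fun_prop] theorem primrec_decode {f : α → ℕ} (hf : Primrec f) :
    Primrec fun x => (decode (f x) : Option β) := Primrec.decode.comp hf

@[fun_prop] theorem primrec_getD {f : α → Option β} {g : α → β} (hf : Primrec f)
    (hg : Primrec g) : Primrec fun x => (f x).getD (g x) := Primrec.option_getD.comp hf hg

@[fun_prop] theorem primrec_map {f : α → List β} {g : α → β → σ} (hf : Primrec f)
    (hg : Primrec fun p : α × β => g p.1 p.2) : Primrec fun x => (f x).map (g x) :=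
  Primrec.list_map hf hg

@[fun_prop] theorem primrec_flatMap {f : α → List β} {g : α → β → List σ} (hf : Primrec f)
    (hg : Primrec fun p : α × β => g p.1 p.2) : Primrec fun x => (f x).flatMap (g x) :=
  Primrec.list_flatMap hf hg

@[fun_prop] theorem primrec_cons {f : α → β} {g : α → List β} (hf : Primrec f)
    (hg : Primrec g) : Primrec fun x => f x :: g x := Primrec.list_cons.comp hf hg

@[fun_prop] theorem primrec_append {f g : α → List β} (hf : Primrec f)
    (hg : Primrec g) : Primrec fun x => f x ++ g x := Primrec.list_append.comp hf hg

@[fun_prop] theorem primrec_length {f : α → List β} (hf : Primrec f) :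
    Primrec fun x => (f x).length := Primrec.list_length.comp hf

@[fun_prop] theorem primrec_range {f : α → ℕ} (hf : Primrec f) :
    Primrec fun x => List.range (f x) := Primrec.list_range.comp hf

@[fun_prop] theorem primrec_idxOf [DecidableEq β] {f : α → β} {g : α → List β} (hf : Primrec f)
    (hg : Primrec g) : Primrec fun x => (g x).idxOf (f x) := Primrec.list_idxOf.comp hf hg

@[fun_prop] theorem primrec_listGetD {f : α → List β} {g : α → ℕ} {h : α → β} (hf : Primrec f)
    (hg : Primrec g) (hh : Primrec h) : Primrec fun x => (f x).getD (g x) (h x) := by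
  simpa only [List.getD_eq_getElem?_getD] using
    Primrec.option_getD.comp (Primrec.list_getElem?.comp hf hg) hh

@[fun_prop] theorem primrec_foldr {f : α → List β} {g : α → σ} {h : α → β → σ → σ}
    (hf : Primrec f) (hg : Primrec g) (hh : Primrec fun p : α × β × σ => h p.1 p.2.1 p.2.2) :
    Primrec fun x => (f x).foldr (h x) (g x) :=
  Primrec.list_foldr (h := fun x p => h x p.1 p.2) hf hg hh

@[fun_prop] theorem primrec_cond {c : α → Bool} {f g : α → σ} (hc : Primrec c) (hf : Primrec f)
    (hg : Primrec g) : Primrec fun x => bif c x then f x else g x := Primrec.cond hc hf hg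

@[fun_prop] theorem primrec_beq [DecidableEq β] {f g : α → β} (hf : Primrec f)
    (hg : Primrec g) : Primrec fun x => (f x == g x) := Primrec.beq.comp hf hg

@[fun_prop] theorem primrec_decide_eq [DecidableEq β] {f g : α → β} (hf : Primrec f)
    (hg : Primrec g) : Primrec fun x => decide (f x = g x) := Primrec.eq.decide.comp hf hg

@[fun_prop] theorem primrec_decide_lt {f g : α → ℕ} (hf : Primrec f)
    (hg : Primrec g) : Primrec fun x => decide (f x < g x) := Primrec.nat_lt.decide.comp hf hg

@[fun_prop] theorem primrec_ite {c : α → Prop} [DecidablePred c] {f g : α → σ}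
    (hc : Primrec fun x => decide (c x)) (hf : Primrec f) (hg : Primrec g) :
    Primrec fun x => if c x then f x else g x := Primrec.ite hc.primrecPred hf hg

@[fun_prop] theorem primrec_and {f g : α → Bool} (hf : Primrec f) (hg : Primrec g) :
    Primrec fun x => f x && g x := Primrec.and.comp hf hg

@[fun_prop] theorem primrec_or {f g : α → Bool} (hf : Primrec f) (hg : Primrec g) :
    Primrec fun x => f x || g x := Primrec.or.comp hf hg

@[fun_prop] theorem primrec_not {f : α → Bool} (hf : Primrec f) :
    Primrec fun x => !f x := Primrec.not.comp hf

@[fun_prop] theorem primrec_any {f : α → List β} {g : α → β → Bool} (hf : Primrec f)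
    (hg : Primrec fun p : α × β => g p.1 p.2) : Primrec fun x => (f x).any (g x) := by
  have h : Primrec fun x => (f x).foldr (fun b r => g x b || r) false := by
    -- The step function of the fold also receives the accumulator, so `hg` is restated for triples.
    have hg' : Primrec fun p : α × β × Bool => g p.1 p.2.1 :=
      hg.comp (g := fun p : α × β × Bool => (p.1, p.2.1)) (by fun_prop)
    fun_prop
  refine h.of_eq fun x => ?_
  induction f x <;> simp_all

@[fun_prop] theorem primrec_all {f : α → List β} {g : α → β → Bool} (hf : Primrec f)
    (hg : Primrec fun p : α × β => g p.1 p.2) : Primrec fun x => (f x).all (g x) := by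
  have h : Primrec fun x => (f x).foldr (fun b r => g x b && r) true := by
    have hg' : Primrec fun p : α × β × Bool => g p.1 p.2.1 :=
      hg.comp (g := fun p : α × β × Bool => (p.1, p.2.1)) (by fun_prop)
    fun_prop
  refine h.of_eq fun x => ?_
  induction f x <;> simp_all

@[fun_prop] theorem primrec_contains [DecidableEq β] {f : α → List β} {g : α → β}
    (hf : Primrec f) (hg : Primrec g) : Primrec fun x => (f x).contains (g x) := by
  have h : Primrec fun x => (f x).any (fun b => g x == b) :=
    primrec_any hf (Primrec.beq.comp (hg.comp Primrec.fst) Primrec.snd)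
  refine h.of_eq fun x => ?_
  rw [Bool.eq_iff_iff]
  simp

@[fun_prop] theorem primrec_filter {f : α → List β} {g : α → β → Bool} (hf : Primrec f)
    (hg : Primrec fun p : α × β => g p.1 p.2) : Primrec fun x => (f x).filter (g x) := by
  have h : Primrec fun x => (f x).foldr (fun b r => bif g x b then b :: r else r) [] := by
    have hg' : Primrec fun p : α × β × List β => g p.1 p.2.1 :=
      hg.comp (g := fun p : α × β × List β => (p.1, p.2.1)) (by fun_prop)
    fun_prop
  refine h.of_eq fun x => ?_
  induction f x with
  | nil => rfl
  | cons b l ih => cases hb : g x b <;> simp_all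

@[fun_prop] theorem primrec_sublists' {f : α → List β} (hf : Primrec f) :
    Primrec fun x => (f x).sublists' := by
  have h : Primrec fun x => (f x).foldr (fun b r => r ++ r.map fun l => b :: l) [[]] := by
    fun_prop
  refine h.of_eq fun x => ?_
  induction f x <;> simp_all

/-- Iteration of a primitive recursive function. -/
@[fun_prop] theorem primrec_iterate {f : α → ℕ} {g : α → σ} {h : α → σ → σ} (hf : Primrec f)
    (hg : Primrec g) (hh : Primrec fun p : α × σ => h p.1 p.2) :
    Primrec fun x => (h x)^[f x] (g x) := Primrec.nat_iterate hf hg hh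

/-- Recursion along primitive recursive calls that decrease a primitive recursive measure; calls
that do not decrease the measure are dropped. -/
theorem exists_primrec_rec {m : β → ℕ} {l : β → List β} {g : β → List σ → σ} (hm : Primrec m)
    (hl : Primrec l) (hg : Primrec fun p : β × List σ => g p.1 p.2) :
    ∃ f : β → σ, Primrec f ∧
      ∀ b, (∀ b' ∈ l b, m b' < m b) → f b = g b ((l b).map f) := by
  classical
  let l' : β → List β := fun b => (l b).filter fun b' => decide (m b' < m b)
  have hl' : Primrec l' := by fun_prop
  have hlt : ∀ b, ∀ b' ∈ l' b, m b' < m b := fun b b' h => by simpa using (List.mem_filter.1 h).2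
  have hwf : WellFounded fun b' b => m b' < m b := (measure m).wf
  let f : β → σ := hwf.fix fun b ih => g b ((l' b).attach.map fun c => ih c.1 (hlt b c.1 c.2))
  have hf : ∀ b, f b = g b ((l' b).map f) := fun b => by
    rw [show f b = g b ((l' b).attach.map fun c => f c.1) from hwf.fix_eq _ _,
      List.attach_map_val (f := f)]
  refine ⟨f, Primrec.nat_omega_rec' (g := fun b r => some (g b r)) f hm hl'
    (Primrec.option_some.comp hg) hlt fun b => by rw [hf b], fun b hb => ?_⟩
  rw [hf b, show l' b = l b from List.filter_eq_self.2 fun c hc => by simpa using hb c hc]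

/-- The list of numbers with code `n`, or `[]` if there is none. -/
def decodeList (n : ℕ) : List ℕ := (decode n).getD []

/-- The code of a list of numbers. -/
def encodeList (l : List ℕ) : ℕ := encode l

@[simp] theorem decodeList_encodeList (l : List ℕ) : decodeList (encodeList l) = l := by
  simp [decodeList, encodeList]

@[fun_prop] theorem primrec_encodeList {f : α → List ℕ} (hf : Primrec f) :
    Primrec fun x => encodeList (f x) := Primrec.encode.comp hf

@[fun_prop] theorem primrec_decodeList {f : α → ℕ} (hf : Primrec f) :
    Primrec fun x => decodeList (f x) := by
  unfold decodeList
  fun_prop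

/-- Makes codes of immediate subterms smaller, so that recursion on codes terminates. The tag has to
be positive: `Nat.pair 0 m = m` for `m ≤ 1`. -/
theorem lt_natPair_succ (t m : ℕ) : m < Nat.pair (t + 1) m :=
  lt_of_lt_of_le (by omega) (Nat.add_le_pair (t + 1) m)

end PrimrecCalculus

end DataWords

namespace DataWords

/-! ### Monadic second-order logic over tracks -/

/-- Monadic second-order formulas over finite words whose letters are sets of tracks. All variables
are second-order and are named by the track that holds them. -/
inductive TrackFormula : Type
  | ex (i : ℕ) (φ : TrackFormula)
  | and (φ ψ : TrackFormula)
  | neg (φ : TrackFormula)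
  | atom (κ : Fin 5) (i j l : ℕ)

namespace TrackFormula

/-- `C` is, on `{0, …, n - 1}`, a range obtained by cutting the ranges of `A` at the elements of
`B`. -/
def IsSegment (n : ℕ) (A B C : Set ℕ) : Prop :=
  ∃ a b, a < b ∧ b ≤ n ∧ (∀ p < n, p ∈ C ↔ a ≤ p ∧ p < b) ∧ (∀ p, a ≤ p → p < b → p ∈ A) ∧
    (∀ p, a < p → p < b → p ∉ B) ∧ (a ∈ B ∨ a = 0 ∨ a - 1 ∉ A) ∧ (b = n ∨ b ∉ A ∨ b ∈ B)

/-- Truth of the five atomic formulas. -/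
def AtomHolds (n : ℕ) (A B C : Set ℕ) : Fin 5 → Prop
  | 0 => ∃ p < n, p ∈ A ∧ p ∈ B
  | 1 => ∀ p < n, p ∈ A → p ∈ B
  | 2 => ∃ p q, p < q ∧ q < n ∧ p ∈ A ∧ q ∈ B
  | 3 => ∀ p, p + 1 < n → p ∈ A → p + 1 ∈ A → p + 1 ∈ B
  | 4 => IsSegment n A B C

/-- Truth in the word of length `n` with tracks `V`. -/
def Holds (n : ℕ) : (ℕ → Set ℕ) → TrackFormula → Prop
  | V, .ex i φ => ∃ P : Set ℕ, Holds n (Function.update V i P) φ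
  | V, .and φ ψ => Holds n V φ ∧ Holds n V ψ
  | V, .neg φ => ¬ Holds n V φ
  | V, .atom κ i j l => AtomHolds n (V i) (V j) (V l) κ

/-! #### Automata -/

/-- Transitions of the automata of the atomic formulas. -/
def atomStep (κ : Fin 5) (a b c : Bool) (s : Fin 5) : Fin 5 :=
  match κ with
  | 0 => bif a && b then 1 else s
  | 1 => bif a && !b then 1 else s
  | 2 => if s = 0 then (bif a then 1 else 0) else if s = 1 then (bif b then 2 else 1) else s
  | 3 => if s = 0 then (bif a then 1 else 0) else
      if s = 1 then (bif a then (bif b then 1 else 2) else 0) else s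
  | 4 => if s = 0 then (bif c then (bif a then 2 else 4) else (bif a then 1 else 0)) else
      if s = 1 then (bif c then (bif a && b then 2 else 4) else (bif a then 1 else 0)) else
      if s = 2 then (bif c then (bif a && !b then 2 else 4) else (bif !a || b then 3 else 4)) else
      if s = 3 then (bif c then 4 else 3) else 4

/-- Accepting states of the automata of the atomic formulas. -/
def atomAcc : Fin 5 → Fin 5 → Bool
  | 0, s => s == 1
  | 1, s => s == 0
  | 2, s => s == 2
  | 3, s => s == 0 || s == 1
  | 4, s => s == 2 || s == 3

/-- Runs of the automata of the atomic formulas. -/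
def atomRun (κ : Fin 5) (A B C : ℕ → Bool) : ℕ → Fin 5
  | 0 => 0
  | n + 1 => atomStep κ (A n) (B n) (C n) (atomRun κ A B C n)

theorem exists_lt_succ_iff (n : ℕ) (P : ℕ → Prop) :
    (∃ p < n + 1, P p) ↔ (∃ p < n, P p) ∨ P n := by
  simp only [Nat.lt_succ_iff_lt_or_eq]
  grind

theorem forall_lt_succ_iff (n : ℕ) (P : ℕ → Prop) :
    (∀ p < n + 1, P p) ↔ (∀ p < n, P p) ∧ P n := by
  simp only [Nat.lt_succ_iff_lt_or_eq]
  grind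

theorem atomHolds_zero_iff (A B C : ℕ → Bool) (n : ℕ) :
    (∃ p < n, A p ∧ B p) ↔ atomAcc 0 (atomRun 0 A B C n) = true := by
  have h : (atomRun 0 A B C n = 0 ∧ ¬ ∃ p < n, A p ∧ B p) ∨
      (atomRun 0 A B C n = 1 ∧ ∃ p < n, A p ∧ B p) := by
    induction n with
    | zero => simp [atomRun]
    | succ n ih =>
      rw [exists_lt_succ_iff, atomRun]
      generalize (∃ p < n, A p ∧ B p) = P at *
      rcases ih with ⟨h, hP⟩ | ⟨h, hP⟩ <;> rw [h] <;> cases A n <;> cases B n <;>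
        simp [atomStep, hP]
  generalize (∃ p < n, A p ∧ B p) = P at *
  rcases h with ⟨h, hP⟩ | ⟨h, hP⟩ <;> rw [h] <;> simp [atomAcc, hP]

theorem atomHolds_one_iff (A B C : ℕ → Bool) (n : ℕ) :
    (∀ p < n, A p → B p) ↔ atomAcc 1 (atomRun 1 A B C n) = true := by
  have h : (atomRun 1 A B C n = 0 ∧ ∀ p < n, A p → B p) ∨
      (atomRun 1 A B C n = 1 ∧ ¬ ∀ p < n, A p → B p) := by
    induction n with
    | zero => simp [atomRun]
    | succ n ih =>
      rw [forall_lt_succ_iff, atomRun]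
      generalize (∀ p < n, A p → B p) = P at *
      rcases ih with ⟨h, hP⟩ | ⟨h, hP⟩ <;> rw [h] <;> cases A n <;> cases B n <;>
        simp [atomStep, hP]
  generalize (∀ p < n, A p → B p) = P at *
  rcases h with ⟨h, hP⟩ | ⟨h, hP⟩ <;> rw [h] <;> simp [atomAcc, hP]

/-- State `1` records that an element of `A` has been read, and state `2` that a later element of
`B` followed it. -/
theorem atomHolds_two_iff (A B C : ℕ → Bool) (n : ℕ) :
    (∃ p q, p < q ∧ q < n ∧ A p ∧ B q) ↔ atomAcc 2 (atomRun 2 A B C n) = true := by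
  have h : (atomRun 2 A B C n = 0 ∧ (¬ ∃ p < n, A p) ∧ ¬ ∃ p q, p < q ∧ q < n ∧ A p ∧ B q) ∨
      (atomRun 2 A B C n = 1 ∧ (∃ p < n, A p) ∧ ¬ ∃ p q, p < q ∧ q < n ∧ A p ∧ B q) ∨
      (atomRun 2 A B C n = 2 ∧ ∃ p q, p < q ∧ q < n ∧ A p ∧ B q) := by
    induction n with
    | zero => simp [atomRun]
    | succ n ih =>
      have : (∃ p q, p < q ∧ q < n + 1 ∧ A p ∧ B q) ↔
          (∃ p q, p < q ∧ q < n ∧ A p ∧ B q) ∨ ((∃ p < n, A p) ∧ B n) := by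
        constructor
        · rintro ⟨p, q, h1, h2, h3, h4⟩
          rcases Nat.lt_succ_iff_lt_or_eq.1 h2 with h2 | rfl
          · exact Or.inl ⟨p, q, h1, h2, h3, h4⟩
          · exact Or.inr ⟨⟨p, h1, h3⟩, h4⟩
        · rintro (⟨p, q, h1, h2, h3, h4⟩ | ⟨⟨p, h1, h2⟩, h3⟩)
          · exact ⟨p, q, h1, h2.trans (Nat.lt_succ_self n), h3, h4⟩
          · exact ⟨p, n, h1, Nat.lt_succ_self n, h2, h3⟩
      rw [exists_lt_succ_iff, this, atomRun]
      clear this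
      generalize (∃ p < n, A p) = P at *
      generalize (∃ p q, p < q ∧ q < n ∧ A p ∧ B q) = Q at *
      rcases ih with ⟨h, hP, hQ⟩ | ⟨h, hP, hQ⟩ | ⟨h, hQ⟩ <;> rw [h] <;> cases A n <;>
        cases B n <;> simp [atomStep, *]
  generalize (∃ p q, p < q ∧ q < n ∧ A p ∧ B q) = Q at *
  rcases h with ⟨h, hP, hQ⟩ | ⟨h, hP, hQ⟩ | ⟨h, hQ⟩ <;> rw [h] <;> simp [atomAcc, hQ]

/-- State `1` records that the previous position is in `A`; state `2` is reached at a violation and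
never left. -/
theorem atomHolds_three_iff (A B C : ℕ → Bool) (n : ℕ) :
    (∀ p, p + 1 < n → A p → A (p + 1) → B (p + 1)) ↔
      atomAcc 3 (atomRun 3 A B C n) = true := by
  have h : (atomRun 3 A B C n = 0 ∧ (¬ (0 < n ∧ A (n - 1))) ∧
        ∀ p, p + 1 < n → A p → A (p + 1) → B (p + 1)) ∨
      (atomRun 3 A B C n = 1 ∧ (0 < n ∧ A (n - 1)) ∧
        ∀ p, p + 1 < n → A p → A (p + 1) → B (p + 1)) ∨
      (atomRun 3 A B C n = 2 ∧ ¬ ∀ p, p + 1 < n → A p → A (p + 1) → B (p + 1)) := by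
    induction n with
    | zero => simp [atomRun]
    | succ n ih =>
      have : (∀ p, p + 1 < n + 1 → A p → A (p + 1) → B (p + 1)) ↔
          (∀ p, p + 1 < n → A p → A (p + 1) → B (p + 1)) ∧
            ((0 < n ∧ A (n - 1)) → A n → B n) := by
        constructor
        · refine fun h => ⟨fun p hp => h p (by omega), fun hn h1 => ?_⟩
          have := h (n - 1) (by omega)
          rw [Nat.sub_add_cancel hn.1] at this
          exact this hn.2 h1
        · intro h p hp h1 h2
          rcases Nat.lt_succ_iff_lt_or_eq.1 hp with hp | rfl
          · exact h.1 p hp h1 h2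
          · exact h.2 ⟨Nat.succ_pos p, h1⟩ h2
      have h0 : (0 < n + 1 ∧ A (n + 1 - 1) = true) ↔ A n = true := by simp
      rw [this, atomRun, h0]
      clear this h0
      generalize (0 < n ∧ A (n - 1) = true) = P at *
      generalize (∀ p, p + 1 < n → A p = true → A (p + 1) = true → B (p + 1) = true) = Q at *
      rcases ih with ⟨h, hP, hQ⟩ | ⟨h, hP, hQ⟩ | ⟨h, hQ⟩ <;> rw [h] <;> cases A n <;>
        cases B n <;> simp [atomStep, *]
  generalize (∀ p, p + 1 < n → A p = true → A (p + 1) = true → B (p + 1) = true) = Q at *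
  rcases h with ⟨h, hP, hQ⟩ | ⟨h, hP, hQ⟩ | ⟨h, hQ⟩ <;> rw [h] <;> simp [atomAcc, hQ]

/-- The range `{a, …, n - 1}` is the initial part of a segment. -/
def OpenSegment (n : ℕ) (A B C : ℕ → Bool) (a : ℕ) : Prop :=
  a < n ∧ (∀ p < n, C p ↔ a ≤ p) ∧ (∀ p, a ≤ p → p < n → A p) ∧
    (∀ p, a < p → p < n → ¬ B p) ∧ (B a ∨ a = 0 ∨ ¬ A (a - 1))

/-- The range `{a, …, b - 1}` is a segment that ends before `n`. -/
def ClosedSegment (n : ℕ) (A B C : ℕ → Bool) (a b : ℕ) : Prop :=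
  a < b ∧ b < n ∧ (∀ p < n, C p ↔ a ≤ p ∧ p < b) ∧ (∀ p, a ≤ p → p < b → A p) ∧
    (∀ p, a < p → p < b → ¬ B p) ∧ (B a ∨ a = 0 ∨ ¬ A (a - 1)) ∧ (¬ A b ∨ B b)

/-- A segment that is still open at `n + 1` either was open before and is not cut at `n`, or begins
at `n`, which needs a cut there or a preceding position outside `A`. -/
theorem openSegment_succ (n : ℕ) (A B C : ℕ → Bool) (a : ℕ) :
    OpenSegment (n + 1) A B C a ↔ C n ∧ A n ∧ ((OpenSegment n A B C a ∧ ¬ B n) ∨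
      (a = n ∧ (∀ p < n, ¬ C p) ∧ (B n ∨ n = 0 ∨ ¬ A (n - 1)))) := by
  unfold OpenSegment
  constructor
  · rintro ⟨h1, h2, h3, h4, h5⟩
    grind
  · rintro ⟨h1, h2, ⟨⟨h3, h4, h5, h6, h7⟩, h8⟩ | ⟨rfl, h3, h4⟩⟩
    · grind
    · grind

theorem closedSegment_succ (n : ℕ) (A B C : ℕ → Bool) (a b : ℕ) :
    ClosedSegment (n + 1) A B C a b ↔ ¬ C n ∧ (ClosedSegment n A B C a b ∨
      (b = n ∧ OpenSegment n A B C a ∧ (¬ A n ∨ B n))) := by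
  unfold OpenSegment ClosedSegment
  constructor
  · rintro ⟨h1, h2, h3, h4, h5, h6, h7⟩
    grind
  · rintro ⟨h1, ⟨h2, h3, h4, h5, h6, h7, h8⟩ | ⟨rfl, ⟨h3, h4, h5, h6, h7⟩, h8⟩⟩
    · grind
    · grind

/-- States of the automaton recognising segments, in terms of the part of the word read so far. -/
def SegmentInv (Z Y O D : Prop) : Fin 5 → Prop
  | 0 => Z ∧ Y
  | 1 => Z ∧ ¬ Y
  | 2 => O
  | 3 => D
  | 4 => ¬ O ∧ ¬ D ∧ ¬ Z

/-- States `0` and `1` mean that nothing of `C` has been read; they differ in whether a range of `A`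
could begin at the next position without a cut. State `2` is an open segment, state `3` a closed
one, state `4` failure. The two recurrences for open and closed segments turn the inductive step
into a propositional check. -/
theorem segmentInv_atomRun (A B C : ℕ → Bool) (n : ℕ) :
    SegmentInv (∀ p < n, ¬ C p) (n = 0 ∨ ¬ A (n - 1)) (∃ a, OpenSegment n A B C a)
      (∃ a b, ClosedSegment n A B C a b) (atomRun 4 A B C n) := by
  induction n with
  | zero => simp [atomRun, SegmentInv]
  | succ n ih =>
    have h1 : (∀ p < n, ¬ C p) → (¬ ∃ a, OpenSegment n A B C a) ∧
        ¬ ∃ a b, ClosedSegment n A B C a b := fun h => by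
      refine ⟨?_, ?_⟩
      · rintro ⟨a, ha, hC, -⟩
        exact h a ha ((hC a ha).2 le_rfl)
      · rintro ⟨a, b, ha, hb, hC, -⟩
        exact h a (ha.trans hb) ((hC a (ha.trans hb)).2 ⟨le_rfl, ha⟩)
    have h2 : (∃ a, OpenSegment n A B C a) → ∃ p < n, C p := fun ⟨a, ha, hC, _⟩ =>
      ⟨a, ha, (hC a ha).2 le_rfl⟩
    have h3 : (∃ a b, ClosedSegment n A B C a b) → ∃ p < n, C p := fun ⟨a, b, ha, hb, hC, _⟩ =>
      ⟨a, ha.trans hb, (hC a (ha.trans hb)).2 ⟨le_rfl, ha⟩⟩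
    -- The last position read belongs to `C` in the open case and not in the closed one.
    have h4 : (∃ a, OpenSegment n A B C a) → ¬ ∃ a b, ClosedSegment n A B C a b := by
      rintro ⟨a, ha, hC, -⟩ ⟨a', b, ha', hb, hC', -⟩
      have := hC (n - 1) (by omega)
      have := hC' (n - 1) (by omega)
      have := (this.1 (by grind)).2
      grind
    have ho : (∃ a, OpenSegment (n + 1) A B C a) ↔ C n ∧ A n ∧
        (((∃ a, OpenSegment n A B C a) ∧ ¬ B n) ∨
          ((∀ p < n, ¬ C p) ∧ (B n ∨ n = 0 ∨ ¬ A (n - 1)))) := by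
      simp only [openSegment_succ]
      grind
    have hc : (∃ a b, ClosedSegment (n + 1) A B C a b) ↔ ¬ C n ∧
        ((∃ a b, ClosedSegment n A B C a b) ∨
          ((∃ a, OpenSegment n A B C a) ∧ (¬ A n ∨ B n))) := by
      simp only [closedSegment_succ]
      grind
    rw [ho, hc]
    generalize (∃ a, OpenSegment n A B C a) = O at *
    generalize (∃ a b, ClosedSegment n A B C a b) = D at *
    have hn : (∀ p < n + 1, ¬ C p) ↔ (∀ p < n, ¬ C p) ∧ ¬ C n := by
      simp only [Nat.lt_succ_iff_lt_or_eq]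
      grind
    have hY : (n + 1 = 0 ∨ ¬ A (n + 1 - 1)) ↔ ¬ A n := by simp
    rw [hn, hY]
    have h2 := fun h h' => (h1 h).1 h'
    have h3 := fun h h' => (h1 h).2 h'
    clear h1 hn hY ho hc
    generalize (∀ p < n, ¬ C p) = Z at *
    generalize (n = 0 ∨ ¬ A (n - 1)) = Y at *
    rw [atomRun]
    generalize atomRun 4 A B C n = s at *
    fin_cases s <;> cases ha : A n <;> cases hb : B n <;> cases hc : C n <;>
      simp [atomStep, SegmentInv] at ih ⊢ <;> tauto

/-- A segment ending at `b < n` is certified by the letter at `b`; one that reaches the end of the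
word needs no certificate. Hence both kinds are accepted. -/
theorem isSegment_iff (n : ℕ) (A B C : ℕ → Bool) :
    IsSegment n {p | A p} {p | B p} {p | C p} ↔
      (∃ a, OpenSegment n A B C a) ∨ ∃ a b, ClosedSegment n A B C a b := by
  unfold IsSegment OpenSegment ClosedSegment
  simp only [Set.mem_ofPred_eq]
  constructor
  · rintro ⟨a, b, h1, h2, h3, h4, h5, h6, h7⟩
    rcases eq_or_lt_of_le h2 with rfl | hlt
    · exact Or.inl ⟨a, h1, fun p hp => by grind, h4, h5, by grind⟩
    · exact Or.inr ⟨a, b, h1, hlt, h3, h4, h5, by grind, by grind⟩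
  · rintro (⟨a, h1, h2, h3, h4, h5⟩ | ⟨a, b, h1, h2, h3, h4, h5, h6, h7⟩)
    · exact ⟨a, n, h1, le_rfl, fun p hp => by grind, h3, h4, by grind, by grind⟩
    · exact ⟨a, b, h1, h2.le, h3, h4, h5, by grind, by grind⟩

theorem atomHolds_four_iff (A B C : ℕ → Bool) (n : ℕ) :
    IsSegment n {p | A p} {p | B p} {p | C p} ↔ atomAcc 4 (atomRun 4 A B C n) = true := by
  rw [isSegment_iff]
  have hO : (∃ a, OpenSegment n A B C a) → ¬ ∀ p < n, ¬ C p := fun ⟨a, ha, hC, _⟩ h =>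
    h a ha ((hC a ha).2 le_rfl)
  have hD : (∃ a b, ClosedSegment n A B C a b) → ¬ ∀ p < n, ¬ C p :=
    fun ⟨a, b, ha, hb, hC, _⟩ h => h a (ha.trans hb) ((hC a (ha.trans hb)).2 ⟨le_rfl, ha⟩)
  have h := segmentInv_atomRun A B C n
  generalize atomRun 4 A B C n = s at *
  fin_cases s <;> simp only [SegmentInv, atomAcc] at h ⊢ <;> simp <;> grind

theorem atomHolds_iff (κ : Fin 5) (A B C : ℕ → Bool) (n : ℕ) :
    AtomHolds n {p | A p} {p | B p} {p | C p} κ ↔ atomAcc κ (atomRun κ A B C n) = true := by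
  fin_cases κ
  · exact atomHolds_zero_iff A B C n
  · exact atomHolds_one_iff A B C n
  · exact atomHolds_two_iff A B C n
  · exact atomHolds_three_iff A B C n
  · exact atomHolds_four_iff A B C n

end TrackFormula
end DataWords

/-! ### Compilation of track formulas to finite automata -/

namespace DataWords
namespace TrackFormula

/-- The initial state. -/
def init : TrackFormula → ℕ
  | .ex _ φ => encodeList [init φ]
  | .and φ ψ => Nat.pair (init φ) (init ψ)
  | .neg φ => init φ
  | .atom _ _ _ _ => 0

/-- A finite list containing all reachable states. -/
def states : TrackFormula → List ℕ
  | .ex _ φ => (states φ).sublists'.map encodeList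
  | .and φ ψ => (states φ).flatMap fun s => (states ψ).map fun t => Nat.pair s t
  | .neg φ => states φ
  | .atom _ _ _ _ => List.range 5

/-- Accepting states. -/
def acc : TrackFormula → ℕ → Bool
  | .ex _ φ, s => (decodeList s).any fun t => acc φ t
  | .and φ ψ, s => acc φ s.unpair.1 && acc ψ s.unpair.2
  | .neg φ, s => !acc φ s
  | .atom κ _ _ _, s => atomAcc κ (Fin.ofNat 5 s)

/-- Transition function; a letter is a list of tracks. -/
def step : TrackFormula → List ℕ → ℕ → ℕ
  | .ex i φ, a, s => encodeList ((states φ).filter fun t =>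
      ((decodeList s).flatMap fun t' =>
        [step φ (i :: a) t', step φ (a.filter fun j => !(j == i)) t']).contains t)
  | .and φ ψ, a, s => Nat.pair (step φ a s.unpair.1) (step ψ a s.unpair.2)
  | .neg φ, a, s => step φ a s
  | .atom κ i j l, a, s =>
      (atomStep κ (a.contains i) (a.contains j) (a.contains l) (Fin.ofNat 5 s) : Fin 5)

/-- The state reached after reading the first `n` letters of `a`. -/
def run (φ : TrackFormula) (a : ℕ → List ℕ) : ℕ → ℕ
  | 0 => init φ
  | n + 1 => step φ (a n) (run φ a n)

theorem init_mem_states (φ : TrackFormula) : init φ ∈ states φ := by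
  induction φ with
  | ex i φ ih =>
    exact List.mem_map.2 ⟨_, List.mem_sublists'.2 (List.singleton_sublist.2 ih), rfl⟩
  | and φ ψ ih1 ih2 =>
    simp only [init, states, List.mem_flatMap, List.mem_map]
    exact ⟨_, ih1, _, ih2, rfl⟩
  | neg φ ih => exact ih
  | atom κ i j l => simp [init, states]

/-- For `ex` the successor is computed as a filter of `states φ`, hence a sublist. This canonical
form is what keeps the coded sets of states within a finite list. -/
theorem step_mem_states (φ : TrackFormula) (a : List ℕ) {s : ℕ} (hs : s ∈ states φ) :
    step φ a s ∈ states φ := by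
  induction φ generalizing s with
  | ex i φ ih =>
    simp only [step, states, List.mem_map, List.mem_sublists']
    exact ⟨_, List.filter_sublist, rfl⟩
  | and φ ψ ih1 ih2 =>
    simp only [states, List.mem_flatMap, List.mem_map] at hs
    obtain ⟨s1, h1, s2, h2, rfl⟩ := hs
    simp only [step, states, List.mem_flatMap, List.mem_map, Nat.unpair_pair]
    exact ⟨_, ih1 h1, _, ih2 h2, rfl⟩
  | neg φ ih => exact ih hs
  | atom κ i j l => simp [step, states]

theorem run_mem_states (φ : TrackFormula) (a : ℕ → List ℕ) (n : ℕ) : run φ a n ∈ states φ := by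
  induction n with
  | zero => exact init_mem_states φ
  | succ n ih => exact step_mem_states φ _ ih

theorem run_congr (φ : TrackFormula) {a b : ℕ → List ℕ} {n : ℕ} (h : ∀ p < n, a p = b p) :
    run φ a n = run φ b n := by
  induction n with
  | zero => rfl
  | succ n ih => rw [run, run, ih fun p hp => h p (by omega), h n (by omega)]

theorem run_and (φ ψ : TrackFormula) (a : ℕ → List ℕ) (n : ℕ) :
    run (.and φ ψ) a n = Nat.pair (run φ a n) (run ψ a n) := by
  induction n with
  | zero => rfl
  | succ n ih => simp [run, ih, step]

theorem run_neg (φ : TrackFormula) (a : ℕ → List ℕ) (n : ℕ) :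
    run (.neg φ) a n = run φ a n := by
  induction n with
  | zero => rfl
  | succ n ih => simp [run, ih, step]

theorem run_atom (κ : Fin 5) (i j l : ℕ) (a : ℕ → List ℕ) (n : ℕ) :
    run (.atom κ i j l) a n = atomRun κ (fun p => (a p).contains i) (fun p => (a p).contains j)
      (fun p => (a p).contains l) n := by
  induction n with
  | zero => rfl
  | succ n ih => simp [run, ih, step, atomRun]

open Classical in
/-- The letters `a` with track `i` replaced by `P`. -/
noncomputable def setTrack (a : ℕ → List ℕ) (i : ℕ) (P : Set ℕ) (p : ℕ) : List ℕ :=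
  if p ∈ P then i :: a p else (a p).filter fun j => !(j == i)

theorem mem_setTrack (a : ℕ → List ℕ) (i : ℕ) (P : Set ℕ) (j p : ℕ) :
    j ∈ setTrack a i P p ↔ p ∈ Function.update (fun j => {p | j ∈ a p}) i P j := by
  unfold setTrack
  by_cases hj : j = i
  · subst hj
    by_cases hp : p ∈ P <;> simp [hp]
  · by_cases hp : p ∈ P <;> simp [hp, hj]

/-- Correctness of the subset construction: the coded set consists of the states reached under all
possible contents of the quantified track. -/
theorem mem_run_ex (i : ℕ) (φ : TrackFormula) (a : ℕ → List ℕ) (n t : ℕ) :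
    t ∈ decodeList (run (.ex i φ) a n) ↔ ∃ P : Set ℕ, run φ (setTrack a i P) n = t := by
  induction n generalizing t with
  | zero => simp [run, init, eq_comm]
  | succ n ih =>
    simp only [run, step, decodeList_encodeList, List.mem_filter, List.contains_eq_mem,
      List.mem_flatMap, ih, decide_eq_true_eq, List.mem_cons, List.not_mem_nil, or_false]
    constructor
    · rintro ⟨-, t', ⟨P, rfl⟩, h⟩
      -- The run up to `n` depends only on the track below `n`, so membership of `n` can still be
      -- chosen freely, as `insert n P` or `P \ {n}`.
      have h1 : ∀ Q : Set ℕ, (∀ p < n, p ∈ Q ↔ p ∈ P) →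
          run φ (setTrack a i Q) n = run φ (setTrack a i P) n := fun Q hQ =>
        run_congr φ fun p hp => by
          by_cases hp' : p ∈ P <;> simp [setTrack, hQ p hp, hp']
      rcases h with rfl | rfl
      · refine ⟨insert n P, ?_⟩
        rw [h1 _ fun p hp => by simp [hp.ne], setTrack, if_pos (Set.mem_insert _ _)]
      · refine ⟨P \ {n}, ?_⟩
        rw [h1 _ fun p hp => by simp [hp.ne], setTrack, if_neg (by simp)]
    · rintro ⟨P, rfl⟩
      refine ⟨step_mem_states φ _ (run_mem_states φ _ n), _, ⟨P, rfl⟩, ?_⟩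
      by_cases hn : n ∈ P <;> simp [setTrack, hn]

/-- The automaton of a formula accepts the words in which the formula is true. -/
theorem holds_iff_acc (φ : TrackFormula) (a : ℕ → List ℕ) (n : ℕ) :
    Holds n (fun i => {p | i ∈ a p}) φ ↔ acc φ (run φ a n) = true := by
  induction φ generalizing a with
  | ex i φ ih =>
    simp only [Holds, acc, List.any_eq_true, mem_run_ex]
    have h : ∀ P : Set ℕ, Holds n (Function.update (fun i => {p | i ∈ a p}) i P) φ ↔
        acc φ (run φ (setTrack a i P) n) = true := fun P => by
      rw [← ih]
      refine iff_of_eq (congrArg (Holds n · φ) ?_)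
      ext j p
      exact (mem_setTrack a i P j p).symm
    simp only [h]
    grind
  | and φ ψ ih1 ih2 => simp [Holds, acc, run_and, ih1, ih2]
  | neg φ ih => simp [Holds, acc, run_neg, ih]
  | atom κ i j l =>
    simp only [Holds, acc, run_atom, Fin.ofNat_eq_cast, Fin.cast_val_eq_self]
    rw [← atomHolds_iff]
    simp

/-! #### Codes -/

/-- Code of a formula. -/
def code : TrackFormula → ℕ
  | .ex i φ => Nat.pair 1 (Nat.pair i φ.code)
  | .and φ ψ => Nat.pair 2 (Nat.pair φ.code ψ.code)
  | .neg φ => Nat.pair 3 φ.code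
  | .atom κ i j l => Nat.pair 4 (Nat.pair κ (Nat.pair i (Nat.pair j l)))

theorem code_lt_ex (i : ℕ) (φ : TrackFormula) : φ.code < (ex i φ).code :=
  (Nat.right_le_pair _ _).trans_lt (lt_natPair_succ 0 _)

theorem code_lt_and_left (φ ψ : TrackFormula) : φ.code < (and φ ψ).code :=
  (Nat.left_le_pair _ _).trans_lt (lt_natPair_succ 1 _)

theorem code_lt_and_right (φ ψ : TrackFormula) : ψ.code < (and φ ψ).code :=
  (Nat.right_le_pair _ _).trans_lt (lt_natPair_succ 1 _)

theorem code_lt_neg (φ : TrackFormula) : φ.code < (neg φ).code := lt_natPair_succ 2 _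

/-- The scheme for all recursions on codes below: `l` lists the recursive calls according to the
tag, `g` combines their results, and the inequalities between codes show that no call on a genuine
code is dropped. -/
theorem exists_primrec_init : ∃ f : ℕ → ℕ, Primrec f ∧ ∀ φ : TrackFormula, f φ.code = init φ := by
  obtain ⟨f, hf, h⟩ := exists_primrec_rec (m := fun c : ℕ => c)
    (l := fun c => if c.unpair.1 = 1 then [c.unpair.2.unpair.2] else
      if c.unpair.1 = 2 then [c.unpair.2.unpair.1, c.unpair.2.unpair.2] else
      if c.unpair.1 = 3 then [c.unpair.2] else [])
    (g := fun c r => if c.unpair.1 = 1 then encodeList [r.getD 0 0] else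
      if c.unpair.1 = 2 then Nat.pair (r.getD 0 0) (r.getD 1 0) else
      if c.unpair.1 = 3 then r.getD 0 0 else 0)
    (by fun_prop) (by fun_prop) (by fun_prop)
  refine ⟨f, hf, fun φ => ?_⟩
  induction φ with
  | ex i φ ih =>
    have := code_lt_ex i φ
    rw [h] <;> simp_all [code, init]
  | and φ ψ ih1 ih2 =>
    have := code_lt_and_left φ ψ
    have := code_lt_and_right φ ψ
    rw [h] <;> simp_all [code, init]
  | neg φ ih =>
    have := code_lt_neg φ
    rw [h] <;> simp_all [code, init]
  | atom κ i j l => rw [h] <;> simp_all [code, init]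

theorem exists_primrec_states :
    ∃ f : ℕ → List ℕ, Primrec f ∧ ∀ φ : TrackFormula, f φ.code = states φ := by
  obtain ⟨f, hf, h⟩ := exists_primrec_rec (m := fun c : ℕ => c)
    (l := fun c => if c.unpair.1 = 1 then [c.unpair.2.unpair.2] else
      if c.unpair.1 = 2 then [c.unpair.2.unpair.1, c.unpair.2.unpair.2] else
      if c.unpair.1 = 3 then [c.unpair.2] else [])
    (g := fun c (r : List (List ℕ)) =>
      if c.unpair.1 = 1 then (r.getD 0 []).sublists'.map fun s => encodeList s else
      if c.unpair.1 = 2 then (r.getD 0 []).flatMap fun s => (r.getD 1 []).map fun t =>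
        Nat.pair s t else
      if c.unpair.1 = 3 then r.getD 0 [] else List.range 5)
    (by fun_prop) (by fun_prop) (by fun_prop)
  refine ⟨f, hf, fun φ => ?_⟩
  induction φ with
  | ex i φ ih =>
    have := code_lt_ex i φ
    rw [h] <;> simp_all [code, states]
  | and φ ψ ih1 ih2 =>
    have := code_lt_and_left φ ψ
    have := code_lt_and_right φ ψ
    rw [h] <;> simp_all [code, states]
  | neg φ ih =>
    have := code_lt_neg φ
    rw [h] <;> simp_all [code, states]
  | atom κ i j l => rw [h] <;> simp_all [code, states]

theorem primrec_atomAcc : Primrec fun p : Fin 5 × Fin 5 => atomAcc p.1 p.2 :=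
  Primrec.dom_finite _

theorem primrec_ofNat_five : Primrec fun n : ℕ => Fin.ofNat 5 n :=
  Primrec.fin_val_iff.1 (by simpa using! primrec_mod Primrec.id (Primrec.const 5))

/-- The state changes along the recursion, so it is part of the argument; only the code of the
formula decreases. -/
theorem exists_primrec_acc :
    ∃ f : ℕ × ℕ → Bool, Primrec f ∧ ∀ (φ : TrackFormula) s, f (φ.code, s) = acc φ s := by
  have h1 := primrec_atomAcc
  have h2 := primrec_ofNat_five
  obtain ⟨f, hf, h⟩ := exists_primrec_rec (m := fun c : ℕ × ℕ => c.1)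
    (l := fun c => if c.1.unpair.1 = 1 then
        (decodeList c.2).map fun t => (c.1.unpair.2.unpair.2, t) else
      if c.1.unpair.1 = 2 then [(c.1.unpair.2.unpair.1, c.2.unpair.1),
        (c.1.unpair.2.unpair.2, c.2.unpair.2)] else
      if c.1.unpair.1 = 3 then [(c.1.unpair.2, c.2)] else [])
    (g := fun c (r : List Bool) => if c.1.unpair.1 = 1 then r.any fun b => b else
      if c.1.unpair.1 = 2 then r.getD 0 false && r.getD 1 false else
      if c.1.unpair.1 = 3 then !r.getD 0 false else
        atomAcc (Fin.ofNat 5 c.1.unpair.2.unpair.1) (Fin.ofNat 5 c.2))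
    (by fun_prop) (by fun_prop) (by
      have : Primrec fun p : (ℕ × ℕ) × List Bool =>
          atomAcc (Fin.ofNat 5 p.1.1.unpair.2.unpair.1) (Fin.ofNat 5 p.1.2) :=
        h1.comp (g := fun p : (ℕ × ℕ) × List Bool =>
          (Fin.ofNat 5 p.1.1.unpair.2.unpair.1, Fin.ofNat 5 p.1.2)) (by fun_prop)
      fun_prop)
  refine ⟨f, hf, fun φ => ?_⟩
  induction φ with
  | ex i φ ih =>
    intro s
    have := code_lt_ex i φ
    rw [h]
    · simp [code, acc, ih, List.any_map, Function.comp_def]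
    · clear h
      simp_all [code]
  | and φ ψ ih1 ih2 =>
    intro s
    have := code_lt_and_left φ ψ
    have := code_lt_and_right φ ψ
    rw [h]
    · simp [code, acc, ih1, ih2]
    · clear h
      simp_all [code]
  | neg φ ih =>
    intro s
    have := code_lt_neg φ
    rw [h]
    · simp [code, acc, ih]
    · clear h
      simp_all [code]
  | atom κ i j l => intro s; rw [h] <;> simp [code, acc]

theorem primrec_atomStep :
    Primrec fun p : Fin 5 × Bool × Bool × Bool × Fin 5 =>
      (atomStep p.1 p.2.1 p.2.2.1 p.2.2.2.1 p.2.2.2.2 : ℕ) :=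
  Primrec.dom_finite _

theorem exists_primrec_step : ∃ f : ℕ × List ℕ × ℕ → ℕ, Primrec f ∧
    ∀ (φ : TrackFormula) a s, f (φ.code, a, s) = step φ a s := by
  have h1 := primrec_atomStep
  have h2 := primrec_ofNat_five
  obtain ⟨f0, hf0, h0⟩ := exists_primrec_states
  obtain ⟨f, hf, h⟩ := exists_primrec_rec (m := fun c : ℕ × List ℕ × ℕ => c.1)
    (l := fun c => if c.1.unpair.1 = 1 then
        (decodeList c.2.2).flatMap fun t =>
          [(c.1.unpair.2.unpair.2, c.1.unpair.2.unpair.1 :: c.2.1, t),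
            (c.1.unpair.2.unpair.2, c.2.1.filter fun j => !(j == c.1.unpair.2.unpair.1), t)] else
      if c.1.unpair.1 = 2 then [(c.1.unpair.2.unpair.1, c.2.1, c.2.2.unpair.1),
        (c.1.unpair.2.unpair.2, c.2.1, c.2.2.unpair.2)] else
      if c.1.unpair.1 = 3 then [(c.1.unpair.2, c.2.1, c.2.2)] else [])
    -- For `ex`, the results `r` are all successors of all states in the set, with and without the
    -- quantified track; filtering `states` by them yields the canonical list.
    (g := fun c (r : List ℕ) => if c.1.unpair.1 = 1 then
        encodeList ((f0 c.1.unpair.2.unpair.2).filter fun t => r.contains t) else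
      if c.1.unpair.1 = 2 then Nat.pair (r.getD 0 0) (r.getD 1 0) else
      if c.1.unpair.1 = 3 then r.getD 0 0 else
        (atomStep (Fin.ofNat 5 c.1.unpair.2.unpair.1)
          (c.2.1.contains c.1.unpair.2.unpair.2.unpair.1)
          (c.2.1.contains c.1.unpair.2.unpair.2.unpair.2.unpair.1)
          (c.2.1.contains c.1.unpair.2.unpair.2.unpair.2.unpair.2) (Fin.ofNat 5 c.2.2) : Fin 5))
    (by fun_prop) (by fun_prop) (by
      have := h1.comp (g := fun p : (ℕ × List ℕ × ℕ) × List ℕ =>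
          (Fin.ofNat 5 p.1.1.unpair.2.unpair.1,
            p.1.2.1.contains p.1.1.unpair.2.unpair.2.unpair.1,
            p.1.2.1.contains p.1.1.unpair.2.unpair.2.unpair.2.unpair.1,
            p.1.2.1.contains p.1.1.unpair.2.unpair.2.unpair.2.unpair.2,
            Fin.ofNat 5 p.1.2.2)) (by fun_prop)
      fun_prop)
  refine ⟨f, hf, fun φ => ?_⟩
  induction φ with
  | ex i φ ih =>
    intro a s
    have := code_lt_ex i φ
    rw [h]
    · simp only [code, Nat.unpair_pair, step, if_true, List.map_flatMap, h0, List.map_cons,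
        List.map_nil, ih]
    · clear h
      simp_all [code]
      rintro c l b x - (⟨rfl, -⟩ | ⟨rfl, -⟩) <;> exact this
  | and φ ψ ih1 ih2 =>
    intro a s
    have := code_lt_and_left φ ψ
    have := code_lt_and_right φ ψ
    rw [h]
    · simp [code, step, ih1, ih2]
    · clear h
      simp_all [code]
  | neg φ ih =>
    intro a s
    have := code_lt_neg φ
    rw [h]
    · simp [code, step, ih]
    · clear h
      simp_all [code]
  | atom κ i j l => intro a s; rw [h] <;> simp [code, step]

end TrackFormula
end DataWords

namespace DataWords

variable {S : Type} {𝔸 : Atoms.{u}}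

/-! ### Equality constraints -/

namespace Atoms

/-- A symbol for equality. -/
noncomputable def eqRel (𝔸 : Atoms.{u}) : Fin 𝔸.numRel := 𝔸.hasEq.choose

theorem arity_eqRel (𝔸 : Atoms.{u}) : 𝔸.arity 𝔸.eqRel = 2 := 𝔸.hasEq.choose_spec.choose

theorem rel_eqRel (𝔸 : Atoms.{u}) (d : Fin (𝔸.arity 𝔸.eqRel) → 𝔸.U) :
    𝔸.rel 𝔸.eqRel d ↔ d (Fin.cast 𝔸.arity_eqRel.symm 0) = d (Fin.cast 𝔸.arity_eqRel.symm 1) :=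
  𝔸.hasEq.choose_spec.choose_spec d

/-- The argument tuple `(x, y)` of the equality symbol. -/
def eqArgs {V : Type*} (𝔸 : Atoms.{u}) (x y : V) : Fin (𝔸.arity 𝔸.eqRel) → V :=
  fun j => if (j : ℕ) = 0 then x else y

theorem exists_eqArgs {V : Type*} (ν : V → Option 𝔸.U) (x y : V) :
    (∃ d : Fin (𝔸.arity 𝔸.eqRel) → 𝔸.U, (∀ j, ν (𝔸.eqArgs x y j) = some (d j)) ∧
      𝔸.rel 𝔸.eqRel d) ↔ ∃ u, ν x = some u ∧ ν y = some u := by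
  constructor
  · rintro ⟨d, h, hd⟩
    rw [rel_eqRel] at hd
    have h0 := h (Fin.cast 𝔸.arity_eqRel.symm 0)
    have h1 := h (Fin.cast 𝔸.arity_eqRel.symm 1)
    simp only [eqArgs, Fin.val_cast, Fin.val_zero, Fin.val_one, if_true, one_ne_zero, if_false]
      at h0 h1
    exact ⟨_, h0, by rw [h1, hd]⟩
  · rintro ⟨u, hx, hy⟩
    refine ⟨fun _ => u, fun j => ?_, (rel_eqRel _ _).2 rfl⟩
    unfold eqArgs
    split_ifs <;> assumption

theorem ofFn_eqArgs (f : ℕ → ℕ) (x y : ℕ) :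
    List.ofFn (fun j => f (𝔸.eqArgs x y j)) = [f x, f y] := by
  -- The arity equals `2` only propositionally, so it is generalised before substituting.
  have h : ∀ m, m = 2 → List.ofFn (fun j : Fin m => f (if (j : ℕ) = 0 then x else y)) =
      [f x, f y] := by
    rintro _ rfl
    simp
  exact h _ 𝔸.arity_eqRel

end Atoms

/-- The constraint `x = y`. -/
noncomputable def Constraint.eq {V : Type} (x y : V) : Constraint 𝔸 V :=
  .rel 𝔸.eqRel (𝔸.eqArgs x y)

theorem Constraint.holds_eq {V : Type} (ν : V → Option 𝔸.U) (x y : V) :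
    (Constraint.eq x y : Constraint 𝔸 V).Holds ν ↔ ∃ u, ν x = some u ∧ ν y = some u :=
  Atoms.exists_eqArgs ν x y

theorem DataWord.exists_data? (w : DataWord S 𝔸) {p : ℕ} (hp : p < w.length) :
    ∃ u, w.data? p = some u := by
  simp [DataWord.data?, hp]

theorem bounds_of_mem_subs {a b : ℕ} {X : Set ℕ} (hab : a ≤ b) {I : ℕ × ℕ} (hI : I ∈ subs a b X) :
    a ≤ I.1 ∧ I.1 < I.2 ∧ I.2 ≤ b := by
  obtain ⟨h1, h2, h3, -⟩ := hI
  simp only [Set.mem_union, Set.mem_inter_iff, Set.mem_Ico, Set.mem_insert_iff,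
    Set.mem_singleton_iff] at h1 h2
  omega

/-! ### Registers for the variables bound outside negations -/

namespace Formula

/-- The tag of `exFO` is `0`, and `Nat.pair 0 m = m * m` exceeds `m` only from `m = 2` on. -/
theorem two_le_code [Encodable S] (φ : Formula S 𝔸) : 2 ≤ φ.code := by
  induction φ with
  | exFO x φ ih =>
    have h := (ih.trans (Nat.right_le_pair x φ.code)).trans (Nat.right_le_pair 0 _)
    exact h
  | neg φ ih => exact (Nat.le_add_right 5 _).trans' (by norm_num) |>.trans (Nat.add_le_pair 5 _)
  | exSO X φ ih => exact (ih.trans (Nat.right_le_pair X φ.code)).trans (Nat.right_le_pair 1 _)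
  | segment X φ ih => exact Nat.left_le_pair 2 _
  | and φ ψ => exact (Nat.left_le_pair 3 _).trans' (by norm_num)
  | or φ ψ => exact (Nat.left_le_pair 4 _).trans' (by norm_num)
  | lt x y => exact (Nat.left_le_pair 6 _).trans' (by norm_num)
  | mem X x => exact (Nat.left_le_pair 7 _).trans' (by norm_num)
  | letter a x => exact (Nat.left_le_pair 8 _).trans' (by norm_num)
  | rel R x => exact (Nat.left_le_pair 9 _).trans' (by norm_num)

theorem code_lt_exFO [Encodable S] (x : ℕ) (φ : Formula S 𝔸) : φ.code < (exFO x φ).code := by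
  have h := two_le_code φ
  have h1 := Nat.right_le_pair x φ.code
  have h2 : (exFO x φ).code = Nat.pair x φ.code * Nat.pair x φ.code := by
    change Nat.pair 0 (Nat.pair x φ.code) = _
    generalize Nat.pair x φ.code = m at *
    simp [Nat.pair, show 0 < m by omega]
  rw [h2]
  nlinarith

theorem code_lt_exSO [Encodable S] (X : ℕ) (φ : Formula S 𝔸) : φ.code < (exSO X φ).code :=
  (Nat.right_le_pair _ _).trans_lt (lt_natPair_succ 0 _)

theorem code_lt_segment [Encodable S] (X : ℕ) (φ : Formula S 𝔸) : φ.code < (segment X φ).code :=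
  (Nat.right_le_pair _ _).trans_lt (lt_natPair_succ 1 _)

/-- Codes double as register budgets: a formula translated with first free register `k` uses only
registers in `[k, k + φ.code)`. The sum on the left lets both conjuncts have disjoint blocks. -/
theorem code_lt_and [Encodable S] (φ ψ : Formula S 𝔸) :
    φ.code + ψ.code < (and φ ψ).code :=
  (Nat.add_le_pair _ _).trans_lt (lt_natPair_succ 2 _)

theorem code_lt_or [Encodable S] (φ ψ : Formula S 𝔸) :
    φ.code + ψ.code < (or φ ψ).code :=
  (Nat.add_le_pair _ _).trans_lt (lt_natPair_succ 3 _)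

theorem code_lt_neg [Encodable S] (φ : Formula S 𝔸) : φ.code < (neg φ).code :=
  lt_natPair_succ 4 _

/-- Register number `k`. -/
def reg (K k : ℕ) : Fin (K + 1) := Fin.ofNat (K + 1) k

theorem val_reg {K k : ℕ} (h : k ≤ K) : (reg K k : ℕ) = k := by
  simpa [reg] using Nat.mod_eq_of_lt (Nat.lt_succ_of_le h)

variable {K : ℕ}

/-- The step at list index `p` of the run with register contents `μ` satisfies `c`. -/
def At (w : DataWord S 𝔸) (μ : ℕ → Fin (K + 1) → Option 𝔸.U)
    (c : Constraint 𝔸 (RegVar (K + 1))) (p : ℕ) : Prop :=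
  ∃ α, w.data? p = some α ∧ c.Holds (NRA.combine (μ p) α (μ (p + 1)))

/-- Register `k` holds the current data value. -/
noncomputable def readC (𝔸 : Atoms.{u}) (K k : ℕ) : Constraint 𝔸 (RegVar (K + 1)) :=
  .eq (.post (reg K k)) .cur

/-- Register `k` keeps its value. -/
noncomputable def keepC (𝔸 : Atoms.{u}) (K k : ℕ) : Constraint 𝔸 (RegVar (K + 1)) :=
  .eq (.pre (reg K k)) (.post (reg K k))

/-- The register variable that holds the value at position `x`. Here `E x` is `k + 1` if the value
is kept in register `k`, and `0` if it is the current value. -/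
def labelVar (K : ℕ) (E : ℕ → ℕ) (x : ℕ) : RegVar (K + 1) :=
  if E x = 0 then .cur else .post (reg K (E x - 1))

/-- The constraint for a data atomic formula. -/
def labelC (K : ℕ) (E : ℕ → ℕ) (R : Fin 𝔸.numRel) (x : Fin (𝔸.arity R) → ℕ) :
    Constraint 𝔸 (RegVar (K + 1)) :=
  .rel R fun j => labelVar K E (x j)

open Classical in
/-- Satisfaction where the data values at the first-order variables bound outside negations are
kept in registers. The flag says whether the formula lies in the scope of a negation, `E` assigns
registers to variables, and registers from `k` on are free. -/
def RegSat [Encodable S] (w : DataWord S 𝔸) (μ : ℕ → Fin (K + 1) → Option 𝔸.U) :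
    Bool → (ℕ → ℕ) → ℕ → (ℕ → ℕ) → (ℕ → Set ℕ) → ℕ → ℕ → Formula S 𝔸 → Prop
  | true, E, k, ν, η, a, b, .exFO x φ => ∃ p ∈ Set.Ico a b,
      RegSat w μ true (Function.update E x 0) k (Function.update ν x p) η a b φ
  | false, E, k, ν, η, a, b, .exFO x φ => ∃ p ∈ Set.Ico a b, At w μ (readC 𝔸 K k) p ∧
      (∀ q, a < q → q < b → At w μ (keepC 𝔸 K k) q) ∧
      RegSat w μ false (Function.update E x (k + 1)) (k + 1) (Function.update ν x p) η a b φ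
  | n, E, k, ν, η, a, b, .exSO X φ => ∃ P ⊆ Set.Ico a b,
      RegSat w μ n E k ν (Function.update η X P) a b φ
  | n, E, k, ν, η, a, b, .segment X φ => ∀ I ∈ subs a b (η X), RegSat w μ n E k ν η I.1 I.2 φ
  | n, E, k, ν, η, a, b, .and φ ψ =>
      RegSat w μ n E k ν η a b φ ∧ RegSat w μ n E (k + φ.code) ν η a b ψ
  | n, E, k, ν, η, a, b, .or φ ψ =>
      RegSat w μ n E k ν η a b φ ∨ RegSat w μ n E (k + φ.code) ν η a b ψ
  | _, E, k, ν, η, a, b, .neg φ => ¬ RegSat w μ true E k ν η a b φ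
  | _, _, _, ν, _, _, _, .lt x y => ν x < ν y
  | _, _, _, ν, η, _, _, .mem X x => ν x ∈ η X
  | _, _, _, ν, _, _, _, .letter s x => (w[ν x]?).map Prod.fst = some s
  | _, E, _, ν, _, a, b, .rel R x =>
      if 𝔸.arity R = 0 then ∃ d, 𝔸.rel R d
      else if ∃ j, E (x j) = 0 then
        ∃ p < w.length, (∀ j, E (x j) = 0 → ν (x j) = p) ∧ At w μ (labelC K E R x) p
      else ∃ p ∈ Set.Ico a b, At w μ (labelC K E R x) p

theorem at_readC (w : DataWord S 𝔸) (μ : ℕ → Fin (K + 1) → Option 𝔸.U) (k p : ℕ) :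
    At w μ (readC 𝔸 K k) p ↔ ∃ u, μ (p + 1) (reg K k) = some u ∧ w.data? p = some u := by
  simp only [At, readC, Constraint.holds_eq, NRA.combine]
  constructor
  · rintro ⟨α, h, u, h1, h2⟩
    exact ⟨u, h1, h.trans h2⟩
  · rintro ⟨u, h1, h2⟩
    exact ⟨u, h2, u, h1, rfl⟩

theorem at_keepC (w : DataWord S 𝔸) (μ : ℕ → Fin (K + 1) → Option 𝔸.U) {k p : ℕ}
    (hp : p < w.length) : At w μ (keepC 𝔸 K k) p ↔
      ∃ u, μ p (reg K k) = some u ∧ μ (p + 1) (reg K k) = some u := by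
  simp only [At, keepC, Constraint.holds_eq, NRA.combine]
  obtain ⟨v, hv⟩ := w.exists_data? hp
  exact ⟨fun ⟨α, h, u, h1⟩ => ⟨u, h1⟩, fun ⟨u, h1⟩ => ⟨v, hv, u, h1⟩⟩

/-- The constraint of a data atomic formula at a position where all registers involved hold the
right values. -/
theorem at_labelC (w : DataWord S 𝔸) (μ : ℕ → Fin (K + 1) → Option 𝔸.U) {E ν : ℕ → ℕ} {p : ℕ}
    (hp : p < w.length) (R : Fin 𝔸.numRel) (x : Fin (𝔸.arity R) → ℕ)
    (h : ∀ j, (E (x j) = 0 ∧ ν (x j) = p) ∨ (E (x j) ≠ 0 ∧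
      μ (p + 1) (reg K (E (x j) - 1)) = w.data? (ν (x j)))) :
    At w μ (labelC K E R x) p ↔ ∃ d : Fin (𝔸.arity R) → 𝔸.U,
      (∀ j, w.data? (ν (x j)) = some (d j)) ∧ 𝔸.rel R d := by
  obtain ⟨v, hv⟩ := w.exists_data? hp
  have h1 : ∀ j, NRA.combine (μ p) v (μ (p + 1)) (labelVar K E (x j)) = w.data? (ν (x j)) := by
    intro j
    rcases h j with ⟨h1, h2⟩ | ⟨h1, h2⟩
    · simp [labelVar, h1, NRA.combine, h2, hv]
    · simp [labelVar, h1, NRA.combine, h2]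
  simp only [At, labelC, Constraint.Holds, hv, Option.some_inj, exists_eq_left', h1]

/-- Below a negation registers are only read, so equivalence holds for given contents. The range
from `A` to `B` is the scope in which the negation was entered; it stays fixed while the current
scope shrinks at segments, because a nested variable may lie outside the current scope. Registers
hold the right value on all of it. An atom with a nested variable is evaluated at that variable's
position, unique by well-formedness; any other atom can be evaluated anywhere in the scope. -/
theorem regSat_true_iff [Encodable S] (w : DataWord S 𝔸) (μ : ℕ → Fin (K + 1) → Option 𝔸.U)
    {A B : ℕ} (hB : B ≤ w.length) (φ : Formula S 𝔸) {N : Finset ℕ} {E ν : ℕ → ℕ} {k : ℕ}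
    {η : ℕ → Set ℕ} {a b : ℕ} (hφ : WFAux true N φ) (hA : A ≤ a) (hab : a ≤ b) (hb : b ≤ B)
    (h : ∀ x ∈ φ.freeFO, (E x = 0 ∧ x ∈ N ∧ A ≤ ν x ∧ ν x < B) ∨ (E x ≠ 0 ∧ a < b ∧
      ∀ p, A ≤ p → p < B → μ (p + 1) (reg K (E x - 1)) = w.data? (ν x))) :
    RegSat w μ true E k ν η a b φ ↔ Sat w ν η a b φ := by
  induction φ generalizing N E k ν η a b with
  | exFO x φ ih =>
    simp only [RegSat, Sat]
    refine exists_congr fun p => and_congr_right fun hp => ih hφ hA hab hb fun y hy => ?_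
    by_cases hyx : y = x
    · subst hyx
      simp only [Function.update_self, Finset.mem_insert_self]
      simp only [Set.mem_Ico] at hp
      exact Or.inl ⟨trivial, trivial, by omega, by omega⟩
    · simp only [Function.update_of_ne hyx]
      refine (h y (by simp [freeFO, hy, hyx])).imp_left ?_
      rintro ⟨h1, h2, h3⟩
      exact ⟨h1, Finset.mem_insert_of_mem h2, h3⟩
  | exSO X φ ih =>
    simp only [RegSat, Sat]
    exact exists_congr fun P => and_congr_right fun hP => ih hφ hA hab hb h
  | segment X φ ih =>
    simp only [RegSat, Sat]
    refine forall₂_congr fun I hI => ?_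
    have := bounds_of_mem_subs hab hI
    exact ih hφ (by omega) (by omega) (by omega) fun x hx =>
      (h x hx).imp_right fun h' => ⟨h'.1, by omega, h'.2.2⟩
  | and φ ψ ih1 ih2 =>
    simp only [RegSat, Sat]
    exact and_congr (ih1 hφ.1 hA hab hb fun x hx => h x (by simp [freeFO, hx]))
      (ih2 hφ.2 hA hab hb fun x hx => h x (by simp [freeFO, hx]))
  | or φ ψ ih1 ih2 =>
    simp only [RegSat, Sat]
    exact or_congr (ih1 hφ.1 hA hab hb fun x hx => h x (by simp [freeFO, hx]))
      (ih2 hφ.2 hA hab hb fun x hx => h x (by simp [freeFO, hx]))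
  | neg φ ih =>
    simp only [RegSat, Sat]
    exact not_congr (ih hφ hA hab hb h)
  | lt x y => simp only [RegSat, Sat]
  | mem X x => simp only [RegSat, Sat]
  | letter s x => simp only [RegSat, Sat]
  | rel R x =>
    simp only [RegSat, Sat]
    have hx : ∀ j, x j ∈ (rel R x : Formula S 𝔸).freeFO := fun j => by simp [freeFO]
    -- Arity `0` is separate: such an atom has no free variable that would guarantee a nonempty
    -- scope in which to test it.
    split_ifs with h1 h2
    · have : IsEmpty (Fin (𝔸.arity R)) := by rw [h1]; infer_instance
      simp
    · obtain ⟨j, hj⟩ := h2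
      have hj' := ((h _ (hx j)).resolve_right fun h' => h'.1 hj)
      have hN : ∀ i, E (x i) = 0 → x i = x j := fun i hi =>
        hφ i j ((h _ (hx i)).resolve_right fun h' => h'.1 hi).2.1 hj'.2.1
      have key := at_labelC (ν := ν) w μ (hj'.2.2.2.trans_le hB) R x fun i => by
        rcases h _ (hx i) with h' | h'
        · exact Or.inl ⟨h'.1, by rw [hN i h'.1]⟩
        · exact Or.inr ⟨h'.1, h'.2.2 _ hj'.2.2.1 hj'.2.2.2⟩
      rw [← key]
      constructor
      · rintro ⟨p, -, hp1, hp2⟩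
        rwa [hp1 j hj]
      · exact fun h' => ⟨_, hj'.2.2.2.trans_le hB, fun i hi => by rw [hN i hi], h'⟩
    · push Not at h2
      -- The atom has an argument, its value is in a register, and `h` gives a nonempty scope with
      -- each such variable.
      have hab' : a < b := ((h _ (hx ⟨0, by omega⟩)).resolve_left fun h' => h2 _ h'.1).2.1
      have key : ∀ p ∈ Set.Ico a b, _ := fun p hp =>
        at_labelC (ν := ν) w μ ((hp.2.trans_le hb).trans_le hB) R x fun i =>
          Or.inr ⟨h2 i, ((h _ (hx i)).resolve_left fun h' => h2 _ h'.1).2.2 p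
            (hA.trans hp.1) (hp.2.trans_le hb)⟩
      constructor
      · rintro ⟨p, hp, h'⟩
        exact (key p hp).1 h'
      · exact fun h' => ⟨a, ⟨le_rfl, hab'⟩, (key a ⟨le_rfl, hab'⟩).2 h'⟩

/-- Whatever the contents are, the constraints force the register of a quantified variable to be
constant on the scope and equal to the value at the chosen position. -/
theorem sat_of_regSat [Encodable S] (w : DataWord S 𝔸) (μ : ℕ → Fin (K + 1) → Option 𝔸.U)
    (φ : Formula S 𝔸) {E ν : ℕ → ℕ} {k : ℕ} {η : ℕ → Set ℕ} {a b : ℕ} (hφ : WFAux false ∅ φ)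
    (hab : a ≤ b) (hb : b ≤ w.length)
    (h : ∀ x ∈ φ.freeFO, E x ≠ 0 ∧ a < b ∧
      ∀ p, a ≤ p → p < b → μ (p + 1) (reg K (E x - 1)) = w.data? (ν x))
    (hs : RegSat w μ false E k ν η a b φ) : Sat w ν η a b φ := by
  induction φ generalizing E k ν η a b with
  | exFO x φ ih =>
    simp only [RegSat, Sat] at hs ⊢
    obtain ⟨p, hp, h1, h2, h3⟩ := hs
    obtain ⟨u, hu, hu'⟩ := (at_readC _ _ _ _).1 h1
    -- No constraint links the register to its content before position `a`: that is where its value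
    -- may be guessed. From then on `keepC` preserves it.
    have hk : ∀ q, a ≤ q → q < b → μ (q + 1) (reg K k) = μ (a + 1) (reg K k) := by
      intro q hq
      induction q, hq using Nat.le_induction with
      | base => exact fun _ => rfl
      | succ q hq ih =>
        intro hqb
        obtain ⟨v, hv, hv'⟩ := (at_keepC _ _ (by omega)).1 (h2 (q + 1) (by omega) hqb)
        rw [hv', ← hv, ih (by omega)]
    refine ⟨p, hp, ih (by simpa [WFAux] using hφ) hab hb (fun y hy => ?_) h3⟩
    by_cases hyx : y = x
    · subst hyx
      simp only [Function.update_self]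
      refine ⟨by omega, hp.1.trans_lt hp.2, fun q hq hqb => ?_⟩
      rw [Nat.add_sub_cancel, hk q hq hqb, ← hk p hp.1 hp.2, hu, hu']
    · simp only [Function.update_of_ne hyx]
      exact h y (by simp [freeFO, hy, hyx])
  | exSO X φ ih =>
    simp only [RegSat, Sat] at hs ⊢
    obtain ⟨P, hP, h1⟩ := hs
    exact ⟨P, hP, ih hφ hab hb h h1⟩
  | segment X φ ih =>
    simp only [RegSat, Sat] at hs ⊢
    intro I hI
    have := bounds_of_mem_subs hab hI
    exact ih hφ (by omega) (by omega) (fun x hx => ⟨(h x hx).1, this.2.1, fun p hp hp' =>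
      (h x hx).2.2 p (by omega) (by omega)⟩) (hs I hI)
  | and φ ψ ih1 ih2 =>
    simp only [RegSat, Sat] at hs ⊢
    exact ⟨ih1 hφ.1 hab hb (fun x hx => h x (by simp [freeFO, hx])) hs.1,
      ih2 hφ.2 hab hb (fun x hx => h x (by simp [freeFO, hx])) hs.2⟩
  | or φ ψ ih1 ih2 =>
    simp only [RegSat, Sat] at hs ⊢
    exact hs.imp (ih1 hφ.1 hab hb (fun x hx => h x (by simp [freeFO, hx])))
      (ih2 hφ.2 hab hb (fun x hx => h x (by simp [freeFO, hx])))
  | neg φ ih =>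
    simp only [RegSat, Sat] at hs ⊢
    rwa [regSat_true_iff w μ hb φ hφ le_rfl hab le_rfl fun x hx => Or.inr (h x hx)] at hs
  | lt x y => simpa only [RegSat, Sat] using hs
  | mem X x => simpa only [RegSat, Sat] using hs
  | letter s x => simpa only [RegSat, Sat] using hs
  | rel R x =>
    refine (regSat_true_iff (k := k) (N := ∅) w μ hb (rel R x) (by simp [WFAux]) le_rfl hab le_rfl
      fun x hx => Or.inr (h x hx)).1 ?_
    simpa only [RegSat] using hs

/-- The conclusion is stable so that witnesses can be combined: the new contents change only the
block of registers of `φ`, and any contents that agree with them after the steps of the scope, on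
registers below the end of the block, serve as well. Conjuncts then work in different blocks, and
the witnesses for different segments are pasted together. -/
theorem exists_regSat [Encodable S] (w : DataWord S 𝔸) (φ : Formula S 𝔸)
    (μ : ℕ → Fin (K + 1) → Option 𝔸.U) {E ν : ℕ → ℕ} {k : ℕ} {η : ℕ → Set ℕ} {a b : ℕ}
    (hφ : WFAux false ∅ φ) (hk : k + φ.code ≤ K + 1) (hab : a ≤ b) (hb : b ≤ w.length)
    (h : ∀ x ∈ φ.freeFO, E x ≠ 0 ∧ E x ≤ k ∧ a < b ∧
      ∀ p, a ≤ p → p < b → μ (p + 1) (reg K (E x - 1)) = w.data? (ν x))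
    (hs : Sat w ν η a b φ) :
    ∃ μ' : ℕ → Fin (K + 1) → Option 𝔸.U, μ' 0 = μ 0 ∧
      (∀ p r, r.val < k ∨ k + φ.code ≤ r.val → μ' (p + 1) r = μ (p + 1) r) ∧
      ∀ μ'' : ℕ → Fin (K + 1) → Option 𝔸.U,
        (∀ p r, a ≤ p → p < b → r.val < k + φ.code → μ'' (p + 1) r = μ' (p + 1) r) →
        RegSat w μ'' false E k ν η a b φ := by
  have hreg : ∀ {E k c}, E ≠ 0 → E ≤ k → k + c ≤ K + 1 → 2 ≤ c → (reg K (E - 1)).val < k :=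
    fun h1 h2 h3 h4 => by rw [val_reg (by omega)]; omega
  induction φ generalizing μ E k ν η a b with
  | exFO x φ ih =>
    obtain ⟨p, hp, hs⟩ := hs
    have hc := code_lt_exFO x φ
    have hc2 := two_le_code φ
    have hkr : (reg K k).val = k := val_reg (by omega)
    obtain ⟨u, hu⟩ := w.exists_data? (hp.2.trans_le hb)
    -- The value at `p` is written to register `k` in every configuration but the initial one, which
    -- has to remain unchanged.
    let μ1 : ℕ → Fin (K + 1) → Option 𝔸.U := fun q r =>
      if q = 0 then μ q r else if r.val = k then some u else μ q r
    have hμ1 : ∀ q r, μ1 (q + 1) r = if r.val = k then some u else μ (q + 1) r := fun q r => by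
      simp [μ1]
    obtain ⟨μ', h0, h1, h2⟩ := ih (E := Function.update E x (k + 1)) (k := k + 1)
      (ν := Function.update ν x p) (η := η) μ1 (by simpa [WFAux] using hφ) (by omega) hab hb
      (fun y hy => by
        by_cases hyx : y = x
        · subst hyx
          simp only [Function.update_self]
          refine ⟨by omega, by omega, hp.1.trans_lt hp.2, fun q hq hqb => ?_⟩
          rw [hμ1, Nat.add_sub_cancel, if_pos hkr, hu]
        · simp only [Function.update_of_ne hyx]
          obtain ⟨h1, h2, h3, h4⟩ := h y (by simp [freeFO, hy, hyx])
          refine ⟨h1, by omega, h3, fun q hq hqb => ?_⟩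
          rw [hμ1, if_neg (hreg h1 h2 hk (two_le_code _)).ne, h4 q hq hqb]) hs
    refine ⟨μ', ?_, fun q r hr => ?_, fun μ'' hμ'' => ?_⟩
    · rw [h0]; simp [μ1]
    · rw [h1 q r (by omega), hμ1, if_neg (by omega)]
    · have hval : ∀ q, a ≤ q → q < b → μ'' (q + 1) (reg K k) = some u := fun q hq hqb => by
        rw [hμ'' q _ hq hqb (by omega), h1 q _ (by omega), hμ1, if_pos hkr]
      simp only [RegSat]
      refine ⟨p, hp, (at_readC _ _ _ _).2 ⟨u, hval p hp.1 hp.2, hu⟩, fun q hq hqb => ?_,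
        h2 μ'' fun q r hq hqb hr => hμ'' q r hq hqb (by omega)⟩
      refine (at_keepC _ _ (by omega)).2 ⟨u, ?_, hval q (by omega) hqb⟩
      have := hval (q - 1) (by omega) (by omega)
      rwa [Nat.sub_add_cancel (by omega)] at this
  | exSO X φ ih =>
    obtain ⟨P, hP, hs⟩ := hs
    have hc := code_lt_exSO X φ
    obtain ⟨μ', h0, h1, h2⟩ := ih μ hφ (by omega) hab hb h hs
    refine ⟨μ', h0, fun q r hr => h1 q r (by omega), fun μ'' hμ'' => ?_⟩
    simp only [RegSat]
    exact ⟨P, hP, h2 μ'' fun q r hq hqb hr => hμ'' q r hq hqb (by omega)⟩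
  | segment X φ ih =>
    have hc := code_lt_segment X φ
    have key : ∀ I ∈ subs a b (η X), _ := fun I hI => by
      have hI' := bounds_of_mem_subs hab hI
      exact ih (k := k) μ hφ (by omega) hI'.2.1.le (by omega) (fun x hx => by
        obtain ⟨h1, h2, h3, h4⟩ := h x hx
        exact ⟨h1, h2, hI'.2.1, fun p hp hpb => h4 p (by omega) (by omega)⟩) (hs I hI)
    choose! m hm0 hm1 hm2 using key
    classical
    -- The segment that contains `p`; it is unique because the ends of a segment are consecutive cut
    -- points.
    let f : ℕ → ℕ × ℕ := fun p =>
      if h : ∃ I ∈ subs a b (η X), I.1 ≤ p ∧ p < I.2 then h.choose else (0, 0)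
    have hf : ∀ I ∈ subs a b (η X), ∀ p, I.1 ≤ p → p < I.2 → f p = I := fun I hI p h1 h2 => by
      have hex : ∃ I ∈ subs a b (η X), I.1 ≤ p ∧ p < I.2 := ⟨I, hI, h1, h2⟩
      have hfp : f p = hex.choose := dif_pos hex
      obtain ⟨hJ, hJ1, hJ2⟩ := hex.choose_spec
      rw [← hfp] at hJ hJ1 hJ2
      obtain ⟨a1, a2, a3, a4⟩ := hI
      obtain ⟨b1, b2, b3, b4⟩ := hJ
      have c1 := a4 _ b1
      have c2 := a4 _ b2
      have c3 := b4 _ a1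
      have c4 := b4 _ a2
      exact Prod.ext (by omega) (by omega)
    -- Configuration `q` is the one after reading position `q - 1`, so it follows the witness for
    -- the segment of `q - 1`.
    let μ' : ℕ → Fin (K + 1) → Option 𝔸.U := fun q r =>
      if q = 0 then μ q r else
      if ∃ I ∈ subs a b (η X), I.1 ≤ q - 1 ∧ q - 1 < I.2 then m (f (q - 1)) q r else μ q r
    refine ⟨μ', by simp [μ'], fun q r hr => ?_, fun μ'' hμ'' => ?_⟩
    · simp only [μ', Nat.add_eq_zero_iff, one_ne_zero, and_false, if_false, Nat.add_sub_cancel]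
      split_ifs with hI
      · obtain ⟨I, hI, hI1, hI2⟩ := hI
        rw [hf I hI q hI1 hI2, hm1 I hI q r (by omega)]
      · rfl
    · simp only [RegSat]
      intro I hI
      have hI' := bounds_of_mem_subs hab hI
      refine hm2 I hI μ'' fun q r hq hqb hr => ?_
      rw [hμ'' q r (by omega) (by omega) (by omega)]
      simp only [μ', Nat.add_eq_zero_iff, one_ne_zero, and_false, if_false, Nat.add_sub_cancel]
      rw [if_pos ⟨I, hI, hq, hqb⟩, hf I hI q hq hqb]
  | and φ ψ ih1 ih2 =>
    have hc := code_lt_and φ ψ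
    have hc1 := two_le_code φ
    have hc2 := two_le_code ψ
    obtain ⟨μ1, h10, h11, h12⟩ := ih1 μ hφ.1 (by omega) hab hb
      (fun x hx => h x (by simp [freeFO, hx])) hs.1
    obtain ⟨μ2, h20, h21, h22⟩ := ih2 (k := k + φ.code) μ1 hφ.2 (by omega) hab hb
      (fun x hx => by
        obtain ⟨g1, g2, g3, g4⟩ := h x (by simp [freeFO, hx])
        refine ⟨g1, by omega, g3, fun p hp hpb => ?_⟩
        rw [h11 p _ (Or.inl (hreg g1 g2 hk (two_le_code _))), g4 p hp hpb]) hs.2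
    refine ⟨μ2, h20.trans h10, fun q r hr => ?_, fun μ'' hμ'' => ?_⟩
    · rw [h21 q r (by omega), h11 q r (by omega)]
    · simp only [RegSat]
      refine ⟨h12 μ'' fun q r hq hqb hr => ?_,
        h22 μ'' fun q r hq hqb hr => hμ'' q r hq hqb (by omega)⟩
      rw [hμ'' q r hq hqb (by omega), h21 q r (by omega)]
  | or φ ψ ih1 ih2 =>
    have hc := code_lt_or φ ψ
    rcases hs with hs | hs
    · obtain ⟨μ', h0, h1, h2⟩ := ih1 (k := k) μ hφ.1 (by omega) hab hb
        (fun x hx => h x (by simp [freeFO, hx])) hs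
      refine ⟨μ', h0, fun q r hr => h1 q r (by omega), fun μ'' hμ'' => ?_⟩
      simp only [RegSat]
      exact Or.inl (h2 μ'' fun q r hq hqb hr => hμ'' q r hq hqb (by omega))
    · obtain ⟨μ', h0, h1, h2⟩ := ih2 (k := k + φ.code) μ hφ.2 (by omega) hab hb
        (fun x hx => by
          obtain ⟨g1, g2, g3⟩ := h x (by simp [freeFO, hx])
          exact ⟨g1, by omega, g3⟩) hs
      refine ⟨μ', h0, fun q r hr => h1 q r (by omega), fun μ'' hμ'' => ?_⟩
      simp only [RegSat]
      exact Or.inr (h2 μ'' fun q r hq hqb hr => hμ'' q r hq hqb (by omega))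
  | neg φ ih =>
    refine ⟨μ, rfl, fun _ _ _ => rfl, fun μ'' hμ'' => ?_⟩
    simp only [RegSat, Sat] at hs ⊢
    rwa [regSat_true_iff w μ'' hb φ hφ le_rfl hab le_rfl]
    intro x hx
    obtain ⟨g1, g2, g3, g4⟩ := h x hx
    refine Or.inr ⟨g1, g3, fun p hp hpb => ?_⟩
    rw [hμ'' p _ hp hpb ((hreg g1 g2 hk (two_le_code _)).trans_le (by omega)), g4 p hp hpb]
  | lt x y => exact ⟨μ, rfl, fun _ _ _ => rfl, fun _ _ => by simp only [RegSat]; exact hs⟩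
  | mem X x => exact ⟨μ, rfl, fun _ _ _ => rfl, fun _ _ => by simp only [RegSat]; exact hs⟩
  | letter s x => exact ⟨μ, rfl, fun _ _ _ => rfl, fun _ _ => by simp only [RegSat]; exact hs⟩
  | rel R x =>
    refine ⟨μ, rfl, fun _ _ _ => rfl, fun μ'' hμ'' => ?_⟩
    have := (regSat_true_iff (k := k) (N := ∅) w μ'' hb (rel R x) (by simp [WFAux]) le_rfl hab
      le_rfl fun x hx => by
        obtain ⟨g1, g2, g3, g4⟩ := h x hx
        refine Or.inr ⟨g1, g3, fun p hp hpb => ?_⟩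
        rw [hμ'' p _ hp hpb ((hreg g1 g2 hk (two_le_code _)).trans_le (by omega)),
          g4 p hp hpb]).2 hs
    simpa only [RegSat] using this

/-- A sentence holds in a word if and only if it holds with some register contents. -/
theorem sat_iff_exists_regSat [Encodable S] (w : DataWord S 𝔸) {φ : Formula S 𝔸}
    (hφ : φ.WellFormed) (hφ' : φ.IsSentence) :
    Sat w (fun _ => 0) (fun _ => ∅) 0 w.length φ ↔
      ∃ μ : ℕ → Fin (φ.code + 1) → Option 𝔸.U, μ 0 = (fun _ => none) ∧
        RegSat w μ false (fun _ => 0) 0 (fun _ => 0) (fun _ => ∅) 0 w.length φ := by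
  constructor
  · intro hs
    obtain ⟨μ, h0, -, h⟩ := exists_regSat (K := φ.code) (E := fun _ => 0) (k := 0) w φ
      (fun _ _ => none) hφ (by omega) (Nat.zero_le _) le_rfl (by simp [hφ'.1]) hs
    exact ⟨μ, h0, h μ fun _ _ _ _ _ => rfl⟩
  · rintro ⟨μ, -, h⟩
    exact sat_of_regSat w μ φ hφ (Nat.zero_le _) le_rfl (by simp [hφ'.1]) h

end Formula
end DataWords

namespace DataWords

variable {S : Type} {𝔸 : Atoms.{u}} {K : ℕ}

/-! ### Translation to formulas over tracks -/

namespace TrackFormula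

/-- Track `i` is a singleton. -/
def single (i : ℕ) : TrackFormula := .and (.atom 0 i i i) (.neg (.atom 2 i i i))

theorem holds_single (n : ℕ) (V : ℕ → Set ℕ) (i : ℕ) :
    Holds n V (single i) ↔ ∃ p < n, ∀ q < n, q ∈ V i ↔ q = p := by
  simp only [single, Holds, AtomHolds, and_self]
  constructor
  · rintro ⟨⟨p, hp, hpi⟩, h⟩
    refine ⟨p, hp, fun q hq => ⟨fun hqi => ?_, fun hqp => hqp ▸ hpi⟩⟩
    rcases lt_trichotomy q p with h' | h' | h'
    · exact absurd ⟨q, p, h', hp, hqi, hpi⟩ h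
    · exact h'
    · exact absurd ⟨p, q, h', hq, hpi, hqi⟩ h
  · rintro ⟨p, hp, h⟩
    refine ⟨⟨p, hp, (h p hp).2 rfl⟩, ?_⟩
    rintro ⟨q, q', h1, h2, h3, h4⟩
    have := (h q (h1.trans h2)).1 h3
    have := (h q' h2).1 h4
    omega

/-- A formula that is always true. -/
def verum : TrackFormula := .atom 1 0 0 0

/-- Conjunction of a list of formulas. -/
def conj (l : List TrackFormula) : TrackFormula := l.foldr .and verum

theorem holds_conj (n : ℕ) (V : ℕ → Set ℕ) (l : List TrackFormula) :
    Holds n V (conj l) ↔ ∀ φ ∈ l, Holds n V φ := by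
  induction l with
  | nil => simp [conj, verum, Holds, AtomHolds]
  | cons φ l ih =>
    rw [List.forall_mem_cons, ← ih]
    rfl

end TrackFormula

namespace Formula

open TrackFormula (single conj verum Holds AtomHolds holds_single holds_conj)

/-- The track of the scope at segment depth `j`. -/
def scopeTrack (j : ℕ) : ℕ := Nat.pair 0 j

/-- The track of a first-order variable. -/
def foTrack (x : ℕ) : ℕ := Nat.pair 1 x

/-- The track of a second-order variable. -/
def soTrack (X : ℕ) : ℕ := Nat.pair 2 X

/-- The track of the positions that satisfy the constraint with code `c`. -/
def guardTrack (c : ℕ) : ℕ := Nat.pair 3 c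

/-- The track of the positions with a given letter. -/
def letterTrack [Encodable S] (s : S) : ℕ := Nat.pair 4 (Encodable.encode s)

/-- The track of an auxiliary first-order variable. -/
def auxTrack : ℕ := Nat.pair 5 0

open Classical in
/-- Translation of a formula to a formula over tracks. -/
noncomputable def toTrack [Encodable S] (K : ℕ) :
    Bool → (ℕ → ℕ) → ℕ → ℕ → Formula S 𝔸 → TrackFormula
  | true, E, k, j, .exFO x φ => .ex (foTrack x) (.and (single (foTrack x)) (.and
      (.atom 1 (foTrack x) (scopeTrack j) 0) (toTrack K true (Function.update E x 0) k j φ)))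
  | false, E, k, j, .exFO x φ => .ex (foTrack x) (.and (single (foTrack x)) (.and
      (.atom 1 (foTrack x) (scopeTrack j) 0) (.and
      (.atom 1 (foTrack x) (guardTrack (readC 𝔸 K k).code) 0) (.and
      (.atom 3 (scopeTrack j) (guardTrack (keepC 𝔸 K k).code) 0)
      (toTrack K false (Function.update E x (k + 1)) (k + 1) j φ)))))
  | n, E, k, j, .exSO X φ =>
      .ex (soTrack X) (.and (.atom 1 (soTrack X) (scopeTrack j) 0) (toTrack K n E k j φ))
  | n, E, k, j, .segment X φ => .neg (.ex (scopeTrack (j + 1)) (.and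
      (.atom 4 (scopeTrack j) (soTrack X) (scopeTrack (j + 1)))
      (.neg (toTrack K n E k (j + 1) φ))))
  | n, E, k, j, .and φ ψ => .and (toTrack K n E k j φ) (toTrack K n E (k + φ.code) j ψ)
  | n, E, k, j, .or φ ψ =>
      .neg (.and (.neg (toTrack K n E k j φ)) (.neg (toTrack K n E (k + φ.code) j ψ)))
  | _, E, k, j, .neg φ => .neg (toTrack K true E k j φ)
  | _, _, _, _, .lt x y => .atom 2 (foTrack x) (foTrack y) 0
  | _, _, _, _, .mem X x => .atom 1 (foTrack x) (soTrack X) 0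
  | _, _, _, _, .letter s x => .atom 1 (foTrack x) (letterTrack s) 0
  | _, E, _, j, .rel R x =>
      if 𝔸.arity R = 0 then (if ∃ d, 𝔸.rel R d then verum else .neg verum)
      else .ex auxTrack (.and (single auxTrack) (.and
        (.atom 1 auxTrack (guardTrack (labelC K E R x).code) 0)
        (if (List.ofFn x).all fun y => !(E y == 0) then .atom 1 auxTrack (scopeTrack j) 0
          else conj ((List.ofFn x).map fun y =>
            if E y = 0 then .atom 1 (foTrack y) auxTrack 0 else verum))))

/-- The constraints that occur in the translation of a formula. -/
noncomputable def labels [Encodable S] (K : ℕ) :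
    Bool → (ℕ → ℕ) → ℕ → Formula S 𝔸 → List (Constraint 𝔸 (RegVar (K + 1)))
  | true, E, k, .exFO x φ => labels K true (Function.update E x 0) k φ
  | false, E, k, .exFO x φ =>
      readC 𝔸 K k :: keepC 𝔸 K k :: labels K false (Function.update E x (k + 1)) (k + 1) φ
  | n, E, k, .exSO _ φ => labels K n E k φ
  | n, E, k, .segment _ φ => labels K n E k φ
  | n, E, k, .and φ ψ => labels K n E k φ ++ labels K n E (k + φ.code) ψ
  | n, E, k, .or φ ψ => labels K n E k φ ++ labels K n E (k + φ.code) ψ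
  | _, E, k, .neg φ => labels K true E k φ
  | _, _, _, .lt _ _ => []
  | _, _, _, .mem _ _ => []
  | _, _, _, .letter _ _ => []
  | _, E, _, .rel R x => [labelC K E R x]

/-- When `A` is a single range, the local boundary conditions of a segment say exactly that its ends
are consecutive among the cut points and the two ends of the range. -/
theorem isSegment_iff_mem_subs {n a b : ℕ} (hab : a ≤ b) (hb : b ≤ n) {X A B C : Set ℕ}
    (hA : ∀ p < n, p ∈ A ↔ a ≤ p ∧ p < b) (hB : ∀ p < n, p ∈ B ↔ p ∈ X) :
    TrackFormula.IsSegment n A B C ↔ ∃ I ∈ subs a b X, ∀ p < n, p ∈ C ↔ I.1 ≤ p ∧ p < I.2 := by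
  constructor
  · rintro ⟨c, d, h1, h2, h3, h4, h5, h6, h7⟩
    have hc := (hA c (by omega)).1 (h4 c le_rfl h1)
    have hd := (hA (d - 1) (by omega)).1 (h4 (d - 1) (by omega) (by omega))
    refine ⟨(c, d), ⟨?_, ?_, h1, ?_⟩, h3⟩
    · by_cases hca : c = a
      · simp [hca]
      · refine Or.inl ⟨?_, by simp; omega⟩
        rcases h6 with h6 | h6 | h6
        · exact (hB c (by omega)).1 h6
        · omega
        · exact absurd ((hA (c - 1) (by omega)).2 (by omega)) h6
    · by_cases hdb : d = b
      · simp [hdb]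
      · refine Or.inl ⟨?_, by simp; omega⟩
        rcases h7 with h7 | h7 | h7
        · omega
        · exact absurd ((hA d (by omega)).2 (by omega)) h7
        · exact (hB d (by omega)).1 h7
    · rintro p (⟨hp1, hp2⟩ | hp) ⟨hp3, hp4⟩
      · exact h5 p hp3 hp4 ((hB p (by simp at hp3 hp4 ⊢; omega)).2 hp1)
      · simp at hp hp3 hp4
        omega
  · rintro ⟨I, hI, hC⟩
    have hI1 := bounds_of_mem_subs hab hI
    obtain ⟨h1, h2, h3, h4⟩ := hI
    refine ⟨I.1, I.2, h3, by omega, hC, fun p hp hp' => (hA p (by omega)).2 (by omega),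
      fun p hp hp' hpB => h4 p (Or.inl ⟨(hB p (by omega)).1 hpB, by simp; omega⟩) ⟨hp, hp'⟩,
      ?_, ?_⟩
    · by_cases ha : I.1 = a
      · by_cases h0 : a = 0
        · exact Or.inr (Or.inl (by omega))
        · refine Or.inr (Or.inr fun h => ?_)
          have := (hA _ (by omega)).1 h
          omega
      · refine Or.inl ((hB _ (by omega)).2 ?_)
        rcases h1 with h1 | h1
        · exact h1.1
        · simp at h1; omega
    · by_cases hI2 : I.2 = b
      · by_cases hbn : b = n
        · exact Or.inl (by omega)
        · refine Or.inr (Or.inl fun h => ?_)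
          have := (hA _ (by omega)).1 h
          omega
      · refine Or.inr (Or.inr ((hB _ (by omega)).2 ?_))
        rcases h2 with h2 | h2
        · exact h2.1
        · simp at h2; omega

/-- Kinds of tracks carry different tags, so updating the track of a variable disturbs neither the
scope nor the guards nor the letters. The track of the scope is indexed by segment depth, so that an
inner segment does not overwrite the scope from which it is cut. Tracks matter only at positions of
the word, hence the bounds in all hypotheses. -/
theorem holds_toTrack [Encodable S] (w : DataWord S 𝔸) (μ : ℕ → Fin (K + 1) → Option 𝔸.U)
    (φ : Formula S 𝔸) {V : ℕ → Set ℕ} {n : Bool} {E ν : ℕ → ℕ} {k j : ℕ} {η : ℕ → Set ℕ}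
    {a b : ℕ} (hab : a ≤ b) (hb : b ≤ w.length)
    (hsc : ∀ p < w.length, p ∈ V (scopeTrack j) ↔ a ≤ p ∧ p < b)
    (hfo : ∀ x ∈ φ.freeFO, ν x < w.length ∧ ∀ p < w.length, p ∈ V (foTrack x) ↔ p = ν x)
    (hso : ∀ X ∈ φ.freeSO, ∀ p < w.length, p ∈ V (soTrack X) ↔ p ∈ η X)
    (hg : ∀ c ∈ labels K n E k φ, ∀ p < w.length, p ∈ V (guardTrack c.code) ↔ At w μ c p)
    (hl : ∀ s : S, ∀ p < w.length, p ∈ V (letterTrack s) ↔ (w[p]?).map Prod.fst = some s) :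
    Holds w.length V (toTrack K n E k j φ) ↔ RegSat w μ n E k ν η a b φ := by
  induction φ generalizing V n E ν k j η a b with
  | exFO x φ ih =>
    have key : ∀ n' E' k', (∀ c ∈ labels K n' E' k' φ, ∀ p < w.length,
        p ∈ V (guardTrack c.code) ↔ At w μ c p) → ∀ P : Set ℕ, ∀ p < w.length,
        (∀ q < w.length, q ∈ P ↔ q = p) →
        (Holds w.length (Function.update V (foTrack x) P) (toTrack K n' E' k' j φ) ↔
          RegSat w μ n' E' k' (Function.update ν x p) η a b φ) := by
      intro n' E' k' hg' P p hp hP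
      refine ih hab hb ?_ ?_ ?_ ?_ ?_
      · simpa [scopeTrack, foTrack] using hsc
      · intro y hy
        by_cases hyx : y = x
        · subst hyx
          simpa using ⟨hp, hP⟩
        · simpa [foTrack, hyx] using hfo y (by simp [freeFO, hy, hyx])
      · simpa [soTrack, foTrack, freeSO] using hso
      · simpa [guardTrack, foTrack] using hg'
      · simpa [letterTrack, foTrack] using hl
    cases n with
    | true =>
      simp only [toTrack, RegSat, Holds, holds_single, AtomHolds, Function.update_self]
      constructor
      · rintro ⟨P, ⟨p, hp, hP⟩, h1, h2⟩
        have h1' := h1 p hp ((hP p hp).2 rfl)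
        rw [Function.update_of_ne (by simp [scopeTrack, foTrack])] at h1'
        exact ⟨p, (hsc p hp).1 h1', (key _ _ _ hg P p hp hP).1 h2⟩
      · rintro ⟨p, hp, h⟩
        have hpn : p < w.length := hp.2.trans_le hb
        refine ⟨{p}, ⟨p, hpn, by simp⟩, fun q hq hqp => ?_,
          (key _ _ _ hg {p} p hpn (by simp)).2 h⟩
        obtain rfl : q = p := hqp
        rw [Function.update_of_ne (by simp [scopeTrack, foTrack])]
        exact (hsc q hq).2 hp
    | false =>
      simp only [labels, List.forall_mem_cons] at hg
      obtain ⟨hg1, hg2, hg3⟩ := hg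
      simp only [toTrack, RegSat, Holds, holds_single, AtomHolds, Function.update_self]
      have e1 : scopeTrack j ≠ foTrack x := by simp [scopeTrack, foTrack]
      have e2 : ∀ c, guardTrack c ≠ foTrack x := by simp [guardTrack, foTrack]
      -- The positions `p + 1` with both `p` and `p + 1` in the scope are those of the scope except
      -- its first.
      have hkeep : (∀ p, p + 1 < w.length → p ∈ V (scopeTrack j) → p + 1 ∈ V (scopeTrack j) →
          p + 1 ∈ V (guardTrack (keepC 𝔸 K k).code)) ↔
          ∀ q, a < q → q < b → At w μ (keepC 𝔸 K k) q := by
        constructor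
        · intro h q hq hqb
          obtain ⟨q, rfl⟩ : ∃ q', q = q' + 1 := ⟨q - 1, by omega⟩
          exact (hg2 _ (by omega)).1 (h q (by omega) ((hsc _ (by omega)).2 (by omega))
            ((hsc _ (by omega)).2 (by omega)))
        · intro h q hq h1 h2
          rw [hsc _ (by omega)] at h1 h2
          exact (hg2 _ hq).2 (h _ (by omega) (by omega))
      simp only [Function.update_of_ne e1, Function.update_of_ne (e2 _), hkeep]
      constructor
      · rintro ⟨P, ⟨p, hp, hP⟩, h1, h2, h3, h4⟩
        have hpP := (hP p hp).2 rfl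
        exact ⟨p, (hsc p hp).1 (h1 p hp hpP), (hg1 p hp).1 (h2 p hp hpP), h3,
          (key _ _ _ hg3 P p hp hP).1 h4⟩
      · rintro ⟨p, hp, h2, h3, h4⟩
        have hpn : p < w.length := hp.2.trans_le hb
        refine ⟨{p}, ⟨p, hpn, by simp⟩, fun q hq hqp => ?_, fun q hq hqp => ?_, h3,
          (key _ _ _ hg3 {p} p hpn (by simp)).2 h4⟩
        · obtain rfl : q = p := hqp
          exact (hsc q hq).2 hp
        · obtain rfl : q = p := hqp
          exact (hg1 q hq).2 h2
  | exSO X φ ih =>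
    simp only [toTrack, RegSat, Holds, AtomHolds, Function.update_self]
    have e1 : scopeTrack j ≠ soTrack X := by simp [scopeTrack, soTrack]
    simp only [Function.update_of_ne e1]
    have key : ∀ P Q : Set ℕ, (∀ q < w.length, q ∈ P ↔ q ∈ Q) →
        (Holds w.length (Function.update V (soTrack X) P) (toTrack K n E k j φ) ↔
          RegSat w μ n E k ν (Function.update η X Q) a b φ) := by
      intro P Q hPQ
      refine ih hab hb ?_ ?_ ?_ ?_ ?_
      · simpa [scopeTrack, soTrack] using hsc
      · simpa [foTrack, soTrack, freeFO] using hfo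
      · intro Y hY
        by_cases hYX : Y = X
        · subst hYX
          simpa using hPQ
        · simpa [soTrack, hYX] using hso Y (by simp [freeSO, hY, hYX])
      · simpa [guardTrack, soTrack, labels] using hg
      · simpa [letterTrack, soTrack] using hl
    constructor
    · rintro ⟨P, h1, h2⟩
      -- The track is unrestricted beyond the end of the word, so it is cut down to the scope.
      refine ⟨P ∩ Set.Ico a b, Set.inter_subset_right, (key P _ fun q hq => ?_).1 h2⟩
      exact ⟨fun h => ⟨h, (hsc q hq).1 (h1 q hq h)⟩, fun h => h.1⟩
    · rintro ⟨P, h1, h2⟩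
      exact ⟨P, fun q hq h => (hsc q hq).2 (h1 h), (key P P fun q _ => Iff.rfl).2 h2⟩
  | segment X φ ih =>
    simp only [toTrack, RegSat, Holds, AtomHolds, Function.update_self]
    have e1 : scopeTrack j ≠ scopeTrack (j + 1) := by simp [scopeTrack]
    have e2 : soTrack X ≠ scopeTrack (j + 1) := by simp [scopeTrack, soTrack]
    simp only [Function.update_of_ne e1, Function.update_of_ne e2,
      isSegment_iff_mem_subs hab hb hsc (hso X (by simp [freeSO]))]
    have key : ∀ I ∈ subs a b (η X), ∀ P : Set ℕ, (∀ q < w.length, q ∈ P ↔ I.1 ≤ q ∧ q < I.2) →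
        (Holds w.length (Function.update V (scopeTrack (j + 1)) P) (toTrack K n E k (j + 1) φ) ↔
          RegSat w μ n E k ν η I.1 I.2 φ) := by
      intro I hI P hP
      have := bounds_of_mem_subs hab hI
      refine ih (by omega) (by omega) ?_ ?_ ?_ ?_ ?_
      · simpa using hP
      · simpa [foTrack, scopeTrack, freeFO] using hfo
      · intro Y hY
        simpa [soTrack, scopeTrack] using hso Y (by simp [freeSO, hY])
      · simpa [guardTrack, scopeTrack, labels] using hg
      · simpa [letterTrack, scopeTrack] using hl
    constructor
    · intro h I hI
      by_contra hc
      exact h ⟨Set.Ico I.1 I.2, ⟨I, hI, by simp⟩,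
        fun h' => hc ((key I hI _ (by simp)).1 h')⟩
    · rintro h ⟨P, ⟨I, hI, hP⟩, h'⟩
      exact h' ((key I hI P hP).2 (h I hI))
  | and φ ψ ih1 ih2 =>
    simp only [labels, List.mem_append] at hg
    simp only [toTrack, RegSat, Holds]
    exact and_congr (ih1 hab hb hsc (fun x hx => hfo x (by simp [freeFO, hx]))
        (fun x hx => hso x (by simp [freeSO, hx])) (fun c hc => hg c (Or.inl hc)) hl)
      (ih2 hab hb hsc (fun x hx => hfo x (by simp [freeFO, hx]))
        (fun x hx => hso x (by simp [freeSO, hx])) (fun c hc => hg c (Or.inr hc)) hl)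
  | or φ ψ ih1 ih2 =>
    simp only [labels, List.mem_append] at hg
    simp only [toTrack, RegSat, Holds]
    rw [not_and_or, not_not, not_not]
    exact or_congr (ih1 hab hb hsc (fun x hx => hfo x (by simp [freeFO, hx]))
        (fun x hx => hso x (by simp [freeSO, hx])) (fun c hc => hg c (Or.inl hc)) hl)
      (ih2 hab hb hsc (fun x hx => hfo x (by simp [freeFO, hx]))
        (fun x hx => hso x (by simp [freeSO, hx])) (fun c hc => hg c (Or.inr hc)) hl)
  | neg φ ih =>
    simp only [toTrack, RegSat, Holds]
    exact not_congr (ih hab hb hsc hfo hso (by simpa only [labels] using hg) hl)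
  | lt x y =>
    simp only [toTrack, RegSat, Holds, AtomHolds]
    obtain ⟨hx, hx'⟩ := hfo x (by simp [freeFO])
    obtain ⟨hy, hy'⟩ := hfo y (by simp [freeFO])
    constructor
    · rintro ⟨p, q, h1, h2, h3, h4⟩
      rw [hx' p (by omega)] at h3
      rw [hy' q (by omega)] at h4
      omega
    · exact fun h => ⟨ν x, ν y, h, hy, (hx' _ hx).2 rfl, (hy' _ hy).2 rfl⟩
  | mem X x =>
    simp only [toTrack, RegSat, Holds, AtomHolds]
    obtain ⟨hx, hx'⟩ := hfo x (by simp [freeFO])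
    rw [← hso X (by simp [freeSO]) _ hx]
    exact ⟨fun h => h _ hx ((hx' _ hx).2 rfl), fun h p hp hpx => (hx' p hp).1 hpx ▸ h⟩
  | letter s x =>
    simp only [toTrack, RegSat, Holds, AtomHolds]
    obtain ⟨hx, hx'⟩ := hfo x (by simp [freeFO])
    rw [← hl s _ hx]
    exact ⟨fun h => h _ hx ((hx' _ hx).2 rfl), fun h p hp hpx => (hx' p hp).1 hpx ▸ h⟩
  | rel R x =>
    have hx : ∀ i, ν (x i) < w.length ∧ ∀ p < w.length, p ∈ V (foTrack (x i)) ↔ p = ν (x i) :=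
      fun i => hfo _ (by simp [freeFO])
    simp only [labels, List.mem_singleton, forall_eq] at hg
    simp only [toTrack, RegSat]
    by_cases h0 : 𝔸.arity R = 0
    · simp only [h0, if_true]
      split_ifs with hd <;> simp [Holds, verum, AtomHolds, hd]
    · simp only [h0, if_false, Holds, holds_single, AtomHolds, Function.update_self]
      have e1 : scopeTrack j ≠ auxTrack := by simp [scopeTrack, auxTrack]
      have e2 : ∀ c, guardTrack c ≠ auxTrack := by simp [guardTrack, auxTrack]
      have e3 : ∀ y, foTrack y ≠ auxTrack := by simp [foTrack, auxTrack]
      have key : (List.ofFn x).all (fun y => !(E y == 0)) = true ↔ ¬ ∃ i, E (x i) = 0 := by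
        simp [List.mem_ofFn]
      by_cases hE : ∃ i, E (x i) = 0
      · rw [if_pos hE, if_neg (by simpa [key] using hE)]
        simp only [holds_conj, List.mem_map, List.mem_ofFn, forall_exists_index, and_imp,
          Function.update_of_ne (e2 _)]
        constructor
        · rintro ⟨P, ⟨p, hp, hP⟩, h1, h2⟩
          refine ⟨p, hp, fun i hi => ?_, (hg p hp).1 (h1 p hp ((hP p hp).2 rfl))⟩
          have := h2 _ (x i) i rfl rfl
          rw [if_pos hi] at this
          simp only [Holds, AtomHolds, Function.update_self, Function.update_of_ne (e3 _)] at this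
          exact (hP _ (hx i).1).1 (this _ (hx i).1 (((hx i).2 _ (hx i).1).2 rfl))
        · rintro ⟨p, hp, h1, h2⟩
          refine ⟨{p}, ⟨p, hp, by simp⟩, fun q hq hqp => ?_, ?_⟩
          · obtain rfl : q = p := hqp
            exact (hg q hq).2 h2
          · rintro _ _ i rfl rfl
            split_ifs with hi
            · simp only [Holds, AtomHolds, Function.update_self, Function.update_of_ne (e3 _)]
              intro q hq hqx
              rw [((hx i).2 q hq).1 hqx]
              exact h1 i hi
            · simp [Holds, verum, AtomHolds]
      · rw [if_neg hE, if_pos (key.2 hE)]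
        simp only [Holds, AtomHolds, Function.update_self, Function.update_of_ne (e2 _),
          Function.update_of_ne e1]
        constructor
        · rintro ⟨P, ⟨p, hp, hP⟩, h1, h2⟩
          have hpP := (hP p hp).2 rfl
          exact ⟨p, (hsc p hp).1 (h2 p hp hpP), (hg p hp).1 (h1 p hp hpP)⟩
        · rintro ⟨p, hp, h1⟩
          have hpn : p < w.length := hp.2.trans_le hb
          refine ⟨{p}, ⟨p, hpn, by simp⟩, fun q hq hqp => ?_, fun q hq hqp => ?_⟩
          · obtain rfl : q = p := hqp
            exact (hg q hq).2 h1
          · obtain rfl : q = p := hqp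
            exact (hsc q hq).2 hp

end Formula
end DataWords

/-! ### Injectivity of codes of constraints; letters as sets of tracks -/

namespace DataWords

variable {S : Type} {𝔸 : Atoms.{u}} {K : ℕ}

theorem RegVar.code_injective {k : ℕ} : Function.Injective (RegVar.code (k := k)) := by
  intro x y h
  cases x <;> cases y <;> simp_all [RegVar.code, Fin.ext_iff]

/-- Guard tracks are named by codes, so different constraints must not share one. -/
theorem Constraint.code_injective {k : ℕ} :
    Function.Injective (Constraint.code (𝔸 := 𝔸) (k := k)) := by
  intro Φ
  induction Φ with
  | top => intro Ψ h; cases Ψ <;> simp_all [Constraint.code]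
  | neg Φ ih =>
    intro Ψ h
    cases Ψ <;> simp [Constraint.code] at h
    rw [ih h]
  | and Φ Φ' ih ih' =>
    intro Ψ h
    cases Ψ <;> simp [Constraint.code] at h
    rw [ih h.1, ih' h.2]
  | rel R x =>
    intro Ψ h
    cases Ψ with
    | rel R' x' =>
      simp only [Constraint.code, Nat.pair_eq_pair, true_and] at h
      obtain ⟨h1, h2⟩ := h
      obtain rfl := Fin.ext h1
      have h3 := List.ofFn_injective (Encodable.encode_injective h2)
      congr 1
      funext j
      exact RegVar.code_injective (congrFun h3 j)
    | _ => simp [Constraint.code] at h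
  | isNil x =>
    intro Ψ h
    cases Ψ <;> simp [Constraint.code] at h
    rw [RegVar.code_injective h]

/-- The list of a rule and the list read off a word contain the same tracks, but possibly in
different order or multiplicity. -/
theorem TrackFormula.step_congr (φ : TrackFormula) {a b : List ℕ} (h : ∀ i, i ∈ a ↔ i ∈ b) (s : ℕ) :
    step φ a s = step φ b s := by
  induction φ generalizing a b s with
  | ex i φ ih =>
    have h1 : ∀ t, step φ (i :: a) t = step φ (i :: b) t := fun t => ih (by simp [h]) t
    have h2 : ∀ t, step φ (a.filter fun j => !(j == i)) t =
      step φ (b.filter fun j => !(j == i)) t := fun t => ih (by simp [h]) t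
    simp only [step, h1, h2]
  | and φ ψ ih1 ih2 => simp only [step, ih1 h, ih2 h]
  | neg φ ih => exact ih h s
  | atom κ i j l => simp [step, h]

/-! ### Automata from formulas over tracks -/

section ToNRA

open Formula (At guardTrack letterTrack scopeTrack)

/-- The conjunction of the constraints of `L` with codes in `u` and the negations of the others. -/
def Constraint.select {k : ℕ} (u : List ℕ) (L : List (Constraint 𝔸 (RegVar k))) :
    Constraint 𝔸 (RegVar k) :=
  L.foldr (fun c Φ => .and (if c.code ∈ u then c else .neg c) Φ) .top

theorem Constraint.holds_select {k : ℕ} (u : List ℕ) (L : List (Constraint 𝔸 (RegVar k)))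
    (ν : RegVar k → Option 𝔸.U) :
    (select u L).Holds ν ↔ ∀ c ∈ L, c.code ∈ u ↔ c.Holds ν := by
  induction L with
  | nil => simp [select, Constraint.Holds]
  | cons c L ih =>
    rw [List.forall_mem_cons, ← ih]
    change Constraint.Holds ν _ ∧ _ ↔ _
    refine and_congr ?_ Iff.rfl
    split_ifs with h <;> simp [h, Constraint.Holds]

/-- The tracks at a position with letter `s` where the constraints with codes in `u` hold. -/
def tracksOf [Encodable S] (s : S) (u : List ℕ) : List ℕ :=
  letterTrack s :: scopeTrack 0 :: u.map guardTrack

variable [Encodable S]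

/-- The initial state of the automaton that runs `m`. -/
def initOf (m : TrackFormula) : List (Fin (m.states.length + 1)) :=
  [Fin.ofNat _ (m.states.idxOf m.init)]

/-- The accepting states of the automaton that runs `m`. -/
def finalOf (m : TrackFormula) : List (Fin (m.states.length + 1)) :=
  (m.states.filter m.acc).map fun s => Fin.ofNat _ (m.states.idxOf s)

/-- The rules of the automaton that runs `m`. -/
noncomputable def rulesOf [Finite S] (m : TrackFormula)
    (L : List (Constraint 𝔸 (RegVar (K + 1)))) : List (Rule S 𝔸 (m.states.length + 1) (K + 1)) :=
  m.states.flatMap fun s => (Set.finite_univ (α := S)).toFinset.toList.flatMap fun σ =>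
    (L.map Constraint.code).sublists'.map fun u =>
      { source := Fin.ofNat _ (m.states.idxOf s)
        letter := σ
        guard := Constraint.select u L
        target := Fin.ofNat _ (m.states.idxOf (m.step (tracksOf σ u) s)) }

theorem mem_rulesOf [Finite S] (m : TrackFormula) (L : List (Constraint 𝔸 (RegVar (K + 1))))
    (t : Rule S 𝔸 (m.states.length + 1) (K + 1)) :
    t ∈ rulesOf m L ↔ ∃ s ∈ m.states, ∃ σ, ∃ u, u.Sublist (L.map Constraint.code) ∧
      (⟨Fin.ofNat _ (m.states.idxOf s), σ, Constraint.select u L,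
        Fin.ofNat _ (m.states.idxOf (m.step (tracksOf σ u) s))⟩ : Rule S 𝔸 _ _) = t := by
  simp [rulesOf]

/-- The automaton that runs `m` on the tracks given by letters and constraints. -/
noncomputable def toNRA [Finite S] (m : TrackFormula) (L : List (Constraint 𝔸 (RegVar (K + 1)))) :
    NRA S 𝔸 where
  numStates := m.states.length + 1
  numRegs := K + 1
  init := initOf m
  final := finalOf m
  rules := rulesOf m L

open Classical in
/-- The tracks along a word with given register contents. -/
noncomputable def trackWord (w : DataWord S 𝔸) (μ : ℕ → Fin (K + 1) → Option 𝔸.U)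
    (L : List (Constraint 𝔸 (RegVar (K + 1)))) (p : ℕ) : List ℕ :=
  match w[p]? with
  | none => []
  | some d => tracksOf d.1 ((L.filter fun c => At w μ c p).map Constraint.code)

theorem val_ofNat_idxOf (l : List ℕ) (s : ℕ) :
    (Fin.ofNat (l.length + 1) (l.idxOf s) : ℕ) = l.idxOf s :=
  Nat.mod_eq_of_lt (Nat.lt_succ_of_le List.idxOf_le_length)

/-- Indices run up to `l.length`, the index of a missing element, which is why the automaton has one
spare state. -/
theorem ofNat_idxOf_inj {l : List ℕ} {s t : ℕ} (hs : s ∈ l)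
    (h : Fin.ofNat (l.length + 1) (l.idxOf s) = Fin.ofNat (l.length + 1) (l.idxOf t)) : s = t := by
  have h' := congrArg Fin.val h
  rw [val_ofNat_idxOf, val_ofNat_idxOf] at h'
  exact (List.idxOf_inj hs).1 h'

open Classical in
-- The guard of a rule forces its selection `u` to be exactly the set of constraints that hold, so
-- the state follows the deterministic run of `m` on the tracks. All remaining nondeterminism lies
-- in the register contents.
theorem mem_language_toNRA [Finite S] (m : TrackFormula)
    (L : List (Constraint 𝔸 (RegVar (K + 1)))) (w : DataWord S 𝔸) :
    w ∈ (toNRA m L).language ↔ ∃ μ : ℕ → Fin (K + 1) → Option 𝔸.U, μ 0 = (fun _ => none) ∧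
      m.acc (m.run (trackWord w μ L) w.length) = true := by
  have hat : ∀ μ : ℕ → Fin (K + 1) → Option 𝔸.U, ∀ i (hi : i < w.length), ∀ c,
      At w μ c i ↔ c.Holds (NRA.combine (μ i) w[i].2 (μ (i + 1))) := by
    intro μ i hi c
    simp [At, DataWord.data?, hi]
  constructor
  · rintro ⟨c, ⟨h1, h2⟩, h3, h4⟩
    refine ⟨fun i => (c i).2, funext h2, ?_⟩
    set μ : ℕ → Fin (K + 1) → Option 𝔸.U := fun i => (c i).2 with hμ
    have key : ∀ i ≤ w.length, (c i).1 =
        Fin.ofNat (m.states.length + 1) (m.states.idxOf (m.run (trackWord w μ L) i)) := by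
      intro i hi
      induction i with
      | zero => exact List.mem_singleton.1 h1
      | succ i ih =>
        obtain ⟨t, ht, hs, hl, htg, hg⟩ := h3 i hi
        obtain ⟨s, hs', σ, u, hu, rfl⟩ := (mem_rulesOf m L _).1 ht
        simp only at hs hl htg hg
        rw [ih (by omega)] at hs
        obtain rfl := ofNat_idxOf_inj hs' hs
        rw [← htg, TrackFormula.run]
        congr 2
        refine TrackFormula.step_congr m (fun x => ?_) _
        simp only [trackWord, List.getElem?_eq_getElem (show i < w.length by omega), tracksOf, hl]
        -- The guessed codes are those of the constraints true at this step: one inclusion uses that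
        -- `u` is a sublist of the codes of `L`, and both use the guard.
        have : ∀ y, y ∈ u ↔ y ∈ (L.filter fun c => At w μ c i).map Constraint.code := by
          intro y
          have hg := (Constraint.holds_select u L (NRA.combine (μ i) w[i].2 (μ (i + 1)))).1 hg
          simp only [List.mem_map, List.mem_filter, decide_eq_true_eq]
          constructor
          · intro hy
            obtain ⟨c', hc', rfl⟩ := List.mem_map.1 (hu.subset hy)
            exact ⟨c', ⟨hc', (hat μ i hi c').2 ((hg c' hc').1 hy)⟩, rfl⟩
          · rintro ⟨c', ⟨hc', hA⟩, rfl⟩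
            exact (hg c' hc').2 ((hat μ i hi c').1 hA)
        have h' : ∀ y, y ∈ u.map guardTrack ↔
            y ∈ ((L.filter fun c => At w μ c i).map Constraint.code).map guardTrack := fun y => by
          rw [List.mem_map, List.mem_map]
          exact exists_congr fun z => and_congr_left fun _ => this z
        simp only [List.mem_cons, h']
    rw [key _ le_rfl] at h4
    obtain ⟨s, hs, h⟩ := List.mem_map.1 h4
    obtain ⟨hs, hacc⟩ := List.mem_filter.1 hs
    obtain rfl := ofNat_idxOf_inj hs h
    exact hacc
  · rintro ⟨μ, h0, hacc⟩
    refine ⟨fun i => (Fin.ofNat (m.states.length + 1)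
      (m.states.idxOf (m.run (trackWord w μ L) i)), μ i), ⟨?_, ?_⟩, ?_, ?_⟩
    · exact List.mem_singleton.2 rfl
    · intro r
      exact congrFun h0 r
    · intro i hi
      have hu : ((L.filter fun c => At w μ c i).map Constraint.code).Sublist
        (L.map Constraint.code) := List.filter_sublist.map _
      refine ⟨_, (mem_rulesOf m L _).2 ⟨_, m.run_mem_states (trackWord w μ L) i, w[i].1, _, hu,
        rfl⟩, rfl, rfl, ?_, ?_⟩
      · simp only [TrackFormula.run, trackWord, List.getElem?_eq_getElem hi]
        rfl
      · refine (Constraint.holds_select _ L (NRA.combine (μ i) w[i].2 (μ (i + 1)))).2 fun c hc => ?_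
        rw [← hat μ i hi]
        simp only [List.mem_map, List.mem_filter, decide_eq_true_eq]
        constructor
        · rintro ⟨c', ⟨-, hA⟩, h⟩
          rwa [← Constraint.code_injective h]
        · intro hA
          exact ⟨c, ⟨hc, hA⟩, rfl⟩
    · exact List.mem_map.2 ⟨_, List.mem_filter.2 ⟨m.run_mem_states _ _, hacc⟩, rfl⟩

/-- The automaton for a sentence of Scoped MSO. -/
noncomputable def SMSO.toNRA [Finite S] (φ : SMSO S 𝔸) : NRA S 𝔸 :=
  DataWords.toNRA (φ.1.toTrack φ.1.code false (fun _ => 0) 0 0)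
    (φ.1.labels φ.1.code false (fun _ => 0) 0)

theorem SMSO.language_toNRA [Finite S] (φ : SMSO S 𝔸) : φ.toNRA.language = φ.language := by
  ext w
  obtain ⟨φ, hφ, hφ'⟩ := φ
  refine (mem_language_toNRA _ _ w).trans ?_
  change _ ↔ φ.Sat w (fun _ => 0) (fun _ => ∅) 0 w.length
  rw [Formula.sat_iff_exists_regSat w hφ hφ']
  refine exists_congr fun μ => and_congr_right fun _ => ?_
  rw [← TrackFormula.holds_iff_acc]
  refine Formula.holds_toTrack w μ φ (Nat.zero_le _) le_rfl ?_ ?_ ?_ ?_ ?_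
  · intro p hp
    simp [trackWord, hp, tracksOf]
  · simp [hφ'.1]
  · simp [hφ'.2]
  · intro c hc p hp
    simp only [trackWord, List.getElem?_eq_getElem hp, tracksOf, Set.mem_ofPred_eq, List.mem_cons,
      List.mem_map, List.mem_filter, decide_eq_true_eq]
    constructor
    · rintro (h | h | ⟨_, ⟨c', ⟨-, hA⟩, rfl⟩, h⟩)
      · simp [guardTrack, letterTrack] at h
      · simp [guardTrack, scopeTrack] at h
      · rw [guardTrack, guardTrack, Nat.pair_eq_pair] at h
        rwa [← Constraint.code_injective h.2]
    · intro hA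
      exact Or.inr (Or.inr ⟨_, ⟨c, ⟨hc, hA⟩, rfl⟩, rfl⟩)
  · intro s p hp
    simp [trackWord, hp, tracksOf, guardTrack, letterTrack, scopeTrack, eq_comm]

end ToNRA
end DataWords

/-! ### The translation from sentences to track formulas on codes -/

namespace DataWords

variable {S : Type} {𝔸 : Atoms.{u}} {K : ℕ}

/-- A table for a function on relation symbols. -/
theorem exists_primrec_table {β : Type*} [Primcodable β] {n : ℕ} (t : Fin n → β) (d : β) :
    ∃ f : ℕ → β, Primrec f ∧ ∀ R : Fin n, f R = t R := by
  refine ⟨fun R => (List.ofFn t).getD R d, by fun_prop, fun R => ?_⟩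
  simp [List.getD_eq_getElem?_getD]

namespace Formula

/-- Lookup in an association list with default value `0`. -/
def lookup (e : List (ℕ × ℕ)) (x : ℕ) : ℕ :=
  e.foldr (fun p r => bif p.1 == x then p.2 else r) 0

@[fun_prop] theorem primrec_lookup {α : Type*} [Primcodable α] {f : α → List (ℕ × ℕ)} {g : α → ℕ}
    (hf : Primrec f) (hg : Primrec g) : Primrec fun x => lookup (f x) (g x) := by
  unfold lookup
  have hg' : Primrec fun p : α × (ℕ × ℕ) × ℕ => g p.1 := hg.comp Primrec.fst
  fun_prop

/-- Register assignments are functions in the translation and have to become finite objects on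
codes; prepending a pair plays the role of an update. -/
theorem lookup_cons (e : List (ℕ × ℕ)) (x v : ℕ) :
    lookup ((x, v) :: e) = Function.update (lookup e) x v := by
  funext y
  by_cases h : y = x
  · subst h
    simp [lookup]
  · simp only [lookup, List.foldr_cons, Function.update_of_ne h]
    have : (x == y) = false := by simpa using Ne.symm h
    simp [this]

section Codes

variable {α : Type*} [Primcodable α]

/-- Code of the track formula `ex i φ`, where `φ` has code `c`. -/
def exCode (i c : ℕ) : ℕ := Nat.pair 1 (Nat.pair i c)

/-- Code of a conjunction of track formulas. -/
def andCode (c d : ℕ) : ℕ := Nat.pair 2 (Nat.pair c d)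

/-- Code of a negated track formula. -/
def negCode (c : ℕ) : ℕ := Nat.pair 3 c

/-- Code of an atomic track formula. -/
def atomCode (κ i j l : ℕ) : ℕ := Nat.pair 4 (Nat.pair κ (Nat.pair i (Nat.pair j l)))

@[fun_prop] theorem primrec_exCode {f g : α → ℕ} (hf : Primrec f) (hg : Primrec g) :
    Primrec fun x => exCode (f x) (g x) := by
  unfold exCode
  fun_prop

@[fun_prop] theorem primrec_andCode {f g : α → ℕ} (hf : Primrec f) (hg : Primrec g) :
    Primrec fun x => andCode (f x) (g x) := by
  unfold andCode
  fun_prop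

@[fun_prop] theorem primrec_negCode {f : α → ℕ} (hf : Primrec f) :
    Primrec fun x => negCode (f x) := by
  unfold negCode
  fun_prop

@[fun_prop] theorem primrec_atomCode {f g h i : α → ℕ} (hf : Primrec f) (hg : Primrec g)
    (hh : Primrec h) (hi : Primrec i) :
    Primrec fun x => atomCode (f x) (g x) (h x) (i x) := by
  unfold atomCode
  fun_prop

/-- Code of the track formula `single i`. -/
def singleCode (i : ℕ) : ℕ := andCode (atomCode 0 i i i) (negCode (atomCode 2 i i i))

/-- Code of the track formula `verum`. -/
def verumCode : ℕ := atomCode 1 0 0 0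

@[fun_prop] theorem primrec_singleCode {g : α → ℕ}
    (hg : Primrec g) : Primrec fun x => singleCode (g x) := by
  unfold singleCode
  fun_prop

end Codes

theorem code_single (i : ℕ) : (TrackFormula.single i).code = singleCode i := rfl

theorem code_verum : TrackFormula.verum.code = verumCode := rfl

theorem code_conj (l : List TrackFormula) : (TrackFormula.conj l).code =
    (l.map TrackFormula.code).foldr andCode verumCode := by
  induction l with
  | nil => rfl
  | cons φ l ih =>
    simp only [List.map_cons, List.foldr_cons, ← ih]
    rfl

/-- Code of an equality constraint. -/
noncomputable def eqCode (𝔸 : Atoms.{u}) (x y : ℕ) : ℕ :=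
  Nat.pair 3 (Nat.pair 𝔸.eqRel (encodeList [x, y]))

@[fun_prop] theorem primrec_eqCode {α : Type*} [Primcodable α] {f g : α → ℕ}
    (hf : Primrec f) (hg : Primrec g) : Primrec fun x => eqCode 𝔸 (f x) (g x) := by
  unfold eqCode
  fun_prop

theorem code_eq {k : ℕ} (x y : RegVar k) :
    (Constraint.eq x y : Constraint 𝔸 _).code = eqCode 𝔸 x.code y.code := by
  have h : (fun j => (𝔸.eqArgs x y j).code) = fun j => id (𝔸.eqArgs x.code y.code j) := by
    funext j
    unfold Atoms.eqArgs
    split_ifs <;> rfl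
  simp only [Constraint.eq, Constraint.code, eqCode, h, Atoms.ofFn_eqArgs]
  rfl

/-- Code of the register variable for a variable. -/
def labelVarCode (K : ℕ) (e : List (ℕ × ℕ)) (x : ℕ) : ℕ :=
  if lookup e x = 0 then Nat.pair 2 0 else Nat.pair 1 ((lookup e x - 1) % (K + 1))

@[fun_prop] theorem primrec_labelVarCode {α : Type*} [Primcodable α] {f g : α → ℕ}
    {e : α → List (ℕ × ℕ)} (hf : Primrec f) (he : Primrec e) (hg : Primrec g) :
    Primrec fun x => labelVarCode (f x) (e x) (g x) := by
  unfold labelVarCode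
  fun_prop

/-- Code of the constraint for the data atomic formula with symbol `R` and arguments `x`. -/
def labelCode (K : ℕ) (e : List (ℕ × ℕ)) (R : ℕ) (x : List ℕ) : ℕ :=
  Nat.pair 3 (Nat.pair R (encodeList (x.map (labelVarCode K e))))

theorem code_labelC (e : List (ℕ × ℕ)) (R : Fin 𝔸.numRel) (x : Fin (𝔸.arity R) → ℕ) :
    (labelC K (lookup e) R x).code =
      labelCode K e R (List.ofFn x) := by
  simp only [labelC, labelCode, Constraint.code, List.map_ofFn, encodeList]
  congr 3
  congr 1
  funext j
  simp only [labelVar, labelVarCode, Function.comp]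
  split_ifs <;> rfl

/-- Arguments of the translation on codes: code of the formula, flag, environment, first free
register, segment depth and bound on registers. -/
abbrev TransArgs : Type := ℕ × Bool × List (ℕ × ℕ) × ℕ × ℕ × ℕ

/-- The translation of `exFO x φ` on codes. -/
noncomputable def transFO (𝔸 : Atoms.{u}) (x : ℕ) (n : Bool) (k j K : ℕ) (r : ℕ × List ℕ) :
    ℕ × List ℕ :=
  bif n then
    (exCode (Nat.pair 1 x) (andCode (singleCode (Nat.pair 1 x))
      (andCode (atomCode 1 (Nat.pair 1 x) (Nat.pair 0 j) 0) r.1)), r.2)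
  else
    (exCode (Nat.pair 1 x) (andCode (singleCode (Nat.pair 1 x))
      (andCode (atomCode 1 (Nat.pair 1 x) (Nat.pair 0 j) 0)
      (andCode (atomCode 1 (Nat.pair 1 x)
        (Nat.pair 3 (eqCode 𝔸 (Nat.pair 1 (k % (K + 1))) (Nat.pair 2 0))) 0)
      (andCode (atomCode 3 (Nat.pair 0 j)
        (Nat.pair 3 (eqCode 𝔸 (Nat.pair 0 (k % (K + 1))) (Nat.pair 1 (k % (K + 1))))) 0) r.1)))),
      eqCode 𝔸 (Nat.pair 1 (k % (K + 1))) (Nat.pair 2 0) ::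
      eqCode 𝔸 (Nat.pair 0 (k % (K + 1))) (Nat.pair 1 (k % (K + 1))) :: r.2)

/-- The translation of a data atomic formula with positive arity on codes. -/
def transRel (e : List (ℕ × ℕ)) (j K R : ℕ) (x : List ℕ) : ℕ :=
  exCode (Nat.pair 5 0) (andCode (singleCode (Nat.pair 5 0))
    (andCode (atomCode 1 (Nat.pair 5 0) (Nat.pair 3 (labelCode K e R x)) 0)
    (bif x.all fun y => !(lookup e y == 0) then atomCode 1 (Nat.pair 5 0) (Nat.pair 0 j) 0
      else (x.map fun y => if lookup e y = 0 then atomCode 1 (Nat.pair 1 y) (Nat.pair 5 0) 0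
        else verumCode).foldr andCode verumCode)))

section

variable {α : Type*} [Primcodable α]

@[fun_prop] theorem primrec_transFO {x k j K : α → ℕ} {n : α → Bool} {r : α → ℕ × List ℕ}
    (hx : Primrec x) (hn : Primrec n) (hk : Primrec k) (hj : Primrec j) (hK : Primrec K)
    (hr : Primrec r) : Primrec fun a => transFO 𝔸 (x a) (n a) (k a) (j a) (K a) (r a) := by
  unfold transFO
  fun_prop

@[fun_prop] theorem primrec_labelCode {R K : α → ℕ} {e : α → List (ℕ × ℕ)} {x : α → List ℕ}
    (hK : Primrec K) (he : Primrec e) (hR : Primrec R) (hx : Primrec x) :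
    Primrec fun a => labelCode (K a) (e a) (R a) (x a) := by
  unfold labelCode
  have hK' : Primrec fun p : α × ℕ => K p.1 := hK.comp Primrec.fst
  have he' : Primrec fun p : α × ℕ => e p.1 := he.comp Primrec.fst
  fun_prop

@[fun_prop] theorem primrec_transRel {R j K : α → ℕ} {e : α → List (ℕ × ℕ)} {x : α → List ℕ}
    (he : Primrec e) (hj : Primrec j) (hK : Primrec K) (hR : Primrec R) (hx : Primrec x) :
    Primrec fun a => transRel (e a) (j a) (K a) (R a) (x a) := by
  unfold transRel
  have he' : Primrec fun p : α × ℕ => e p.1 := he.comp Primrec.fst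
  fun_prop

end

/-- The track formula and its list of constraints are computed together, since both follow the same
recursion on the formula with the same assignment of registers. -/
theorem exists_primrec_toTrack [Encodable S] : ∃ f : TransArgs → ℕ × List ℕ, Primrec f ∧
    ∀ (φ : Formula S 𝔸) n e k j K, f (φ.code, n, e, k, j, K) =
      ((toTrack K n (lookup e) k j φ).code, (labels K n (lookup e) k φ).map Constraint.code) := by
  obtain ⟨ar, har, har'⟩ := exists_primrec_table 𝔸.arity 0
  classical
  -- Nothing is assumed about computability of the relations; only the truth values of nullary
  -- symbols are needed, and they form a finite table.
  obtain ⟨tv, htv, htv'⟩ := exists_primrec_table (fun R => decide (∃ d, 𝔸.rel R d)) false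
  obtain ⟨f, hf, h⟩ := exists_primrec_rec (β := TransArgs) (σ := ℕ × List ℕ) (m := fun b => b.1)
    (l := fun b =>
      if b.1.unpair.1 = 0 then
        [(b.1.unpair.2.unpair.2, b.2.1,
          (b.1.unpair.2.unpair.1, bif b.2.1 then 0 else b.2.2.2.1 + 1) :: b.2.2.1,
          (bif b.2.1 then b.2.2.2.1 else b.2.2.2.1 + 1), b.2.2.2.2)]
      else if b.1.unpair.1 = 1 then [(b.1.unpair.2.unpair.2, b.2)]
      else if b.1.unpair.1 = 2 then
        [(b.1.unpair.2.unpair.2, b.2.1, b.2.2.1, b.2.2.2.1, b.2.2.2.2.1 + 1, b.2.2.2.2.2)]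
      else if (b.1.unpair.1 == 3 || b.1.unpair.1 == 4) = true then
        [(b.1.unpair.2.unpair.1, b.2), (b.1.unpair.2.unpair.2, b.2.1, b.2.2.1,
          b.2.2.2.1 + b.1.unpair.2.unpair.1, b.2.2.2.2)]
      else if b.1.unpair.1 = 5 then [(b.1.unpair.2, true, b.2.2)]
      else [])
    (g := fun b r =>
      if b.1.unpair.1 = 0 then transFO 𝔸 b.1.unpair.2.unpair.1 b.2.1 b.2.2.2.1 b.2.2.2.2.1
        b.2.2.2.2.2 (r.getD 0 (0, []))
      else if b.1.unpair.1 = 1 then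
        (exCode (Nat.pair 2 b.1.unpair.2.unpair.1) (andCode (atomCode 1
          (Nat.pair 2 b.1.unpair.2.unpair.1) (Nat.pair 0 b.2.2.2.2.1) 0) (r.getD 0 (0, [])).1),
          (r.getD 0 (0, [])).2)
      else if b.1.unpair.1 = 2 then
        (negCode (exCode (Nat.pair 0 (b.2.2.2.2.1 + 1)) (andCode (atomCode 4
          (Nat.pair 0 b.2.2.2.2.1) (Nat.pair 2 b.1.unpair.2.unpair.1)
          (Nat.pair 0 (b.2.2.2.2.1 + 1))) (negCode (r.getD 0 (0, [])).1))),
          (r.getD 0 (0, [])).2)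
      else if b.1.unpair.1 = 3 then
        (andCode (r.getD 0 (0, [])).1 (r.getD 1 (0, [])).1,
          (r.getD 0 (0, [])).2 ++ (r.getD 1 (0, [])).2)
      else if b.1.unpair.1 = 4 then
        (negCode (andCode (negCode (r.getD 0 (0, [])).1) (negCode (r.getD 1 (0, [])).1)),
          (r.getD 0 (0, [])).2 ++ (r.getD 1 (0, [])).2)
      else if b.1.unpair.1 = 5 then (negCode (r.getD 0 (0, [])).1, (r.getD 0 (0, [])).2)
      else if b.1.unpair.1 = 6 then
        (atomCode 2 (Nat.pair 1 b.1.unpair.2.unpair.1) (Nat.pair 1 b.1.unpair.2.unpair.2) 0, [])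
      else if b.1.unpair.1 = 7 then
        (atomCode 1 (Nat.pair 1 b.1.unpair.2.unpair.2) (Nat.pair 2 b.1.unpair.2.unpair.1) 0, [])
      else if b.1.unpair.1 = 8 then
        (atomCode 1 (Nat.pair 1 b.1.unpair.2.unpair.2) (Nat.pair 4 b.1.unpair.2.unpair.1) 0, [])
      else (if ar b.1.unpair.2.unpair.1 = 0 then
            (bif tv b.1.unpair.2.unpair.1 then verumCode else negCode verumCode)
          else transRel b.2.2.1 b.2.2.2.2.1 b.2.2.2.2.2 b.1.unpair.2.unpair.1
            (decodeList b.1.unpair.2.unpair.2),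
          [labelCode b.2.2.2.2.2 b.2.2.1 b.1.unpair.2.unpair.1
            (decodeList b.1.unpair.2.unpair.2)]))
    (by fun_prop) (by fun_prop) (by fun_prop)
  refine ⟨f, hf, fun φ => ?_⟩
  induction φ with
  | exFO x φ ih =>
    intro n e k j K
    have := code_lt_exFO x φ
    rw [h]
    · cases n
      · simp [code, ih, lookup_cons, transFO, toTrack, labels, exCode, andCode, atomCode,
          TrackFormula.code, code_single, code_eq, readC, keepC, RegVar.code, reg, foTrack,
          scopeTrack, guardTrack]
      · simp [code, ih, lookup_cons, transFO, toTrack, labels, exCode, andCode, atomCode,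
          TrackFormula.code, code_single, foTrack, scopeTrack]
    · clear h
      simp_all [code]
  | exSO X φ ih =>
    intro n e k j K
    have := code_lt_exSO X φ
    rw [h]
    · simp [code, ih, toTrack, labels, exCode, andCode, atomCode, TrackFormula.code, soTrack,
          scopeTrack]
    · clear h
      simp_all [code]
  | segment X φ ih =>
    intro n e k j K
    have := code_lt_segment X φ
    rw [h]
    · simp [code, ih, toTrack, labels, exCode, andCode, atomCode, negCode, TrackFormula.code,
        soTrack, scopeTrack]
    · clear h
      simp_all [code]
  | and φ ψ ih1 ih2 =>
    intro n e k j K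
    have := code_lt_and φ ψ
    have h1 : φ.code < (and φ ψ).code := by omega
    have h2 : ψ.code < (and φ ψ).code := by omega
    rw [h]
    · simp [code, ih1, ih2, toTrack, labels, andCode, TrackFormula.code]
    · clear h
      simp_all [code]
  | or φ ψ ih1 ih2 =>
    intro n e k j K
    have := code_lt_or φ ψ
    have h1 : φ.code < (or φ ψ).code := by omega
    have h2 : ψ.code < (or φ ψ).code := by omega
    rw [h]
    · simp [code, ih1, ih2, toTrack, labels, andCode, negCode, TrackFormula.code]
    · clear h
      simp_all [code]
  | neg φ ih =>
    intro n e k j K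
    have := code_lt_neg φ
    rw [h]
    · simp [code, ih, toTrack, labels, negCode, TrackFormula.code]
    · clear h
      simp_all [code]
  | lt x y =>
    intro n e k j K
    rw [h]
    · simp [code, toTrack, labels, atomCode, TrackFormula.code, foTrack]
    · clear h
      simp_all [code]
  | mem X x =>
    intro n e k j K
    rw [h]
    · simp [code, toTrack, labels, atomCode, TrackFormula.code, foTrack, soTrack]
    · clear h
      simp_all [code]
  | letter s x =>
    intro n e k j K
    rw [h]
    · simp [code, toTrack, labels, atomCode, TrackFormula.code, foTrack, letterTrack]
    · clear h
      simp_all [code]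
  | rel R x =>
    intro n e k j K
    have hx : decodeList (Encodable.encode (List.ofFn x)) = List.ofFn x :=
      decodeList_encodeList _
    rw [h]
    · simp only [code, Nat.unpair_pair, har', htv', hx, labels, List.map_cons, List.map_nil,
        code_labelC]
      norm_num
      rw [toTrack]
      split_ifs with h1 h2 h3
      · simp [h2, code_verum]
      · simp [h2, code_verum, TrackFormula.code, negCode]
      · simp [h3, transRel, TrackFormula.code, exCode, andCode, atomCode, code_single, code_labelC,
          auxTrack, guardTrack, scopeTrack]
      · rw [Bool.not_eq_true] at h3
        have hm : (fun y => if lookup e y = 0 then atomCode 1 (Nat.pair 1 y) (Nat.pair 5 0) 0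
            else verumCode) = TrackFormula.code ∘ fun y => if lookup e y = 0 then
              TrackFormula.atom 1 (foTrack y) auxTrack 0 else TrackFormula.verum := by
          funext y
          simp only [Function.comp]
          split_ifs <;> rfl
        rw [transRel, h3, hm, cond_false]
        simp only [TrackFormula.code, code_single, code_labelC, code_conj, List.map_map]
        rfl
    · clear h
      simp_all [code]

end Formula

end DataWords

namespace DataWords

variable {S : Type} {𝔸 : Atoms.{u}} {K : ℕ}

/-! ### Reduction of satisfiability to emptiness -/

section Reduction

variable [Encodable S]

/-- Code of a selection of constraints. -/
def selectCode (u L : List ℕ) : ℕ :=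
  L.foldr (fun c r => Nat.pair 2 (Nat.pair (if u.contains c then c else Nat.pair 1 c) r))
    (Nat.pair 0 0)

@[fun_prop] theorem primrec_selectCode {α : Type*} [Primcodable α] {f g : α → List ℕ}
    (hf : Primrec f) (hg : Primrec g) : Primrec fun x => selectCode (f x) (g x) := by
  unfold selectCode
  have hf' : Primrec fun p : α × ℕ × ℕ => f p.1 := hf.comp Primrec.fst
  fun_prop

theorem code_select {k : ℕ} (u : List ℕ) (L : List (Constraint 𝔸 (RegVar k))) :
    (Constraint.select u L).code = selectCode u (L.map Constraint.code) := by
  unfold selectCode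
  induction L with
  | nil => rfl
  | cons c L ih =>
    simp only [List.map_cons, List.foldr_cons, ← ih]
    change Nat.pair 2 (Nat.pair (Constraint.code (if _ then _ else _)) _) = _
    by_cases h : c.code ∈ u <;> simp [h, Constraint.code, Constraint.select]

theorem NRA.code_eq (A : NRA S 𝔸) : A.code =
    Nat.pair A.numStates (Nat.pair A.numRegs (Nat.pair (encodeList (A.init.map Fin.val)) (Nat.pair
      (encodeList (A.final.map Fin.val)) (encodeList (A.rules.map Rule.code))))) := by
  have h : ∀ {n : ℕ} (l : List (Fin n)), List.flatMap (fun a : Fin n => [(a : ℕ)]) l =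
      l.map Fin.val :=
    fun l => List.flatMap_pure_eq_map _ l
  simp [NRA.code, encodeList, h]

theorem exists_primrec_toNRA [Finite S] : ∃ f : ℕ × ℕ × List ℕ → ℕ, Primrec f ∧
    ∀ (m : TrackFormula) (K : ℕ) (L : List (Constraint 𝔸 (RegVar (K + 1)))),
      f (m.code, K, L.map Constraint.code) = (toNRA (S := S) m L).code := by
  obtain ⟨fi, hfi, hi⟩ := TrackFormula.exists_primrec_init
  obtain ⟨fs, hfs, hs⟩ := TrackFormula.exists_primrec_states
  obtain ⟨fa, hfa, ha⟩ := TrackFormula.exists_primrec_acc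
  obtain ⟨ft, hft, ht⟩ := TrackFormula.exists_primrec_step
  -- The alphabet is fixed, so the list of its letter codes is a constant of the algorithm.
  let letters : List ℕ := ((Set.finite_univ (α := S)).toFinset.toList).map Encodable.encode
  let f : ℕ × ℕ × List ℕ → ℕ := fun b =>
    Nat.pair ((fs b.1).length + 1) (Nat.pair (b.2.1 + 1) (Nat.pair
      (encodeList [(fs b.1).idxOf (fi b.1)]) (Nat.pair
      (encodeList (((fs b.1).filter fun s => fa (b.1, s)).map fun s => (fs b.1).idxOf s))
      (encodeList ((fs b.1).flatMap fun s => letters.flatMap fun σ => b.2.2.sublists'.map fun u =>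
        Nat.pair ((fs b.1).idxOf s) (Nat.pair σ (Nat.pair (selectCode u b.2.2)
          ((fs b.1).idxOf (ft (b.1, Nat.pair 4 σ :: Nat.pair 0 0 ::
            u.map fun c => Nat.pair 3 c, s))))))))))
  refine ⟨f, ?_, fun m K L => ?_⟩
  · unfold f
    fun_prop
  · have hv := fun s => val_ofNat_idxOf m.states s
    simp only [f, hi, hs, ha, ht, NRA.code_eq, toNRA, initOf, finalOf, rulesOf, List.map_map,
      List.map_flatMap, Function.comp_def, Rule.code, code_select, hv, letters, List.flatMap_map]
    simp only [List.map_cons, List.map_nil, hv]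
    rfl

theorem satisfiabilityDecidable_of_emptinessDecidable [Finite S]
    (h : EmptinessDecidable S 𝔸) : SatisfiabilityDecidable S 𝔸 := by
  obtain ⟨g, hg, hg'⟩ := h
  obtain ⟨f1, hf1, h1⟩ := Formula.exists_primrec_toTrack (S := S) (𝔸 := 𝔸)
  obtain ⟨f2, hf2, h2⟩ := exists_primrec_toNRA (S := S) (𝔸 := 𝔸)
  -- The code of the sentence also serves as the bound on registers, as in `SMSO.toNRA`.
  let F : ℕ → ℕ := fun c => f2 ((f1 (c, false, [], 0, 0, c)).1, c, (f1 (c, false, [], 0, 0, c)).2)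
  have hF : Primrec F := by fun_prop
  have key : ∀ φ : SMSO S 𝔸, F φ.code = φ.toNRA.code := fun φ => by
    change f2 ((f1 (φ.1.code, false, [], 0, 0, φ.1.code)).1, φ.1.code,
      (f1 (φ.1.code, false, [], 0, 0, φ.1.code)).2) = _
    rw [h1, h2]
    rfl
  refine ⟨fun c => !g (F c), Primrec.not.to_comp.comp (hg.comp hF.to_comp), fun φ => ?_⟩
  change (!g (F φ.code)) = true ↔ φ.language.Nonempty
  rw [key, Set.nonempty_iff_ne_empty, ← φ.language_toNRA, ← not_iff_not, not_not]
  exact Iff.trans (by simp) (hg' φ.toNRA)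

end Reduction
end DataWords

namespace DataWords

variable {S : Type} {𝔸 : Atoms.{u}}

namespace Formula

/-! ### Derived connectives of Scoped MSO -/

/-- A sentence that is always true. -/
def verum : Formula S 𝔸 := .neg (.exFO 0 (.lt 0 0))

/-- Conjunction of a list of formulas. -/
def conj (l : List (Formula S 𝔸)) : Formula S 𝔸 := l.foldr .and verum

/-- Disjunction of a list of formulas. -/
def disj (l : List (Formula S 𝔸)) : Formula S 𝔸 := l.foldr .or (.neg verum)

/-- Existential quantification over a list of first-order variables. -/
def exFOs (l : List ℕ) (φ : Formula S 𝔸) : Formula S 𝔸 := l.foldr .exFO φ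

/-- Existential quantification over a list of second-order variables. -/
def exSOs (l : List ℕ) (φ : Formula S 𝔸) : Formula S 𝔸 := l.foldr .exSO φ

/-- The data values at `x` and `y` are equal. -/
noncomputable def eqData (x y : ℕ) : Formula S 𝔸 := .rel 𝔸.eqRel (𝔸.eqArgs x y)

section Sat

variable (w : DataWord S 𝔸) (ν : ℕ → ℕ) (η : ℕ → Set ℕ) (a b : ℕ)

@[simp] theorem sat_verum : Sat w ν η a b verum := by simp [verum, Sat]

@[simp] theorem sat_conj (l : List (Formula S 𝔸)) :
    Sat w ν η a b (conj l) ↔ ∀ φ ∈ l, Sat w ν η a b φ := by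
  induction l with
  | nil => simp [conj]
  | cons φ l ih =>
    rw [List.forall_mem_cons, ← ih]
    rfl

@[simp] theorem sat_disj (l : List (Formula S 𝔸)) :
    Sat w ν η a b (disj l) ↔ ∃ φ ∈ l, Sat w ν η a b φ := by
  induction l with
  | nil => simp [disj, Sat]
  | cons φ l ih =>
    rw [List.exists_mem_cons_iff, ← ih]
    rfl

/-- All quantifiers are absorbed in one valuation, so the positions of a window are chosen
simultaneously. -/
theorem sat_exFOs (l : List ℕ) (φ : Formula S 𝔸) : Sat w ν η a b (exFOs l φ) ↔
    ∃ x : ℕ → ℕ, (∀ v ∈ l, x v ∈ Set.Ico a b) ∧ (∀ v ∉ l, x v = ν v) ∧ Sat w x η a b φ := by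
  induction l generalizing ν with
  | nil =>
    constructor
    · exact fun h => ⟨ν, by simp, by simp, h⟩
    · rintro ⟨x, -, h1, h2⟩
      obtain rfl : x = ν := funext fun v => h1 v (by simp)
      exact h2
  | cons v l ih =>
    change (∃ p ∈ Set.Ico a b, Sat w (Function.update ν v p) η a b (exFOs l φ)) ↔ _
    simp only [ih]
    constructor
    · rintro ⟨p, hp, x, h1, h2, h3⟩
      refine ⟨x, ?_, ?_, h3⟩
      · intro v' hv'
        by_cases hl : v' ∈ l
        · exact h1 v' hl
        · obtain rfl : v' = v := by simpa [hl] using hv'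
          rw [h2 _ hl, Function.update_self]
          exact hp
      · intro v' hv'
        rw [List.mem_cons, not_or] at hv'
        rw [h2 _ hv'.2, Function.update_of_ne hv'.1]
    · rintro ⟨x, h1, h2, h3⟩
      refine ⟨x v, h1 v (by simp), x, fun v' hv' => h1 v' (by simp [hv']), fun v' hv' => ?_, h3⟩
      by_cases hvv : v' = v
      · rw [hvv, Function.update_self]
      · rw [Function.update_of_ne hvv, h2 v' (by simp [hv', hvv])]

theorem sat_exSOs (l : List ℕ) (φ : Formula S 𝔸) : Sat w ν η a b (exSOs l φ) ↔
    ∃ x : ℕ → Set ℕ, (∀ v ∈ l, x v ⊆ Set.Ico a b) ∧ (∀ v ∉ l, x v = η v) ∧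
      Sat w ν x a b φ := by
  induction l generalizing η with
  | nil =>
    constructor
    · exact fun h => ⟨η, by simp, by simp, h⟩
    · rintro ⟨x, -, h1, h2⟩
      obtain rfl : x = η := funext fun v => h1 v (by simp)
      exact h2
  | cons v l ih =>
    change (∃ P ⊆ Set.Ico a b, Sat w ν (Function.update η v P) a b (exSOs l φ)) ↔ _
    simp only [ih]
    constructor
    · rintro ⟨p, hp, x, h1, h2, h3⟩
      refine ⟨x, ?_, ?_, h3⟩
      · intro v' hv'
        by_cases hl : v' ∈ l
        · exact h1 v' hl
        · obtain rfl : v' = v := by simpa [hl] using hv'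
          rw [h2 _ hl, Function.update_self]
          exact hp
      · intro v' hv'
        rw [List.mem_cons, not_or] at hv'
        rw [h2 _ hv'.2, Function.update_of_ne hv'.1]
    · rintro ⟨x, h1, h2, h3⟩
      refine ⟨x v, h1 v (by simp), x, fun v' hv' => h1 v' (by simp [hv']), fun v' hv' => ?_, h3⟩
      by_cases hvv : v' = v
      · rw [hvv, Function.update_self]
      · rw [Function.update_of_ne hvv, h2 v' (by simp [hv', hvv])]

@[simp] theorem sat_eqData (x y : ℕ) : Sat w ν η a b (eqData x y) ↔
    ∃ u, w.data? (ν x) = some u ∧ w.data? (ν y) = some u :=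
  Atoms.exists_eqArgs (fun v => w.data? (ν v)) x y

end Sat

section WellFormed

variable (n : Bool) (N : Finset ℕ)

@[simp] theorem wf_verum : WFAux n N (verum : Formula S 𝔸) := by simp [verum, WFAux]

@[simp] theorem wf_conj (l : List (Formula S 𝔸)) :
    WFAux n N (conj l) ↔ ∀ φ ∈ l, WFAux n N φ := by
  induction l with
  | nil => simp [conj]
  | cons φ l ih =>
    rw [List.forall_mem_cons, ← ih]
    simp [conj, WFAux]

@[simp] theorem wf_disj (l : List (Formula S 𝔸)) :
    WFAux n N (disj l) ↔ ∀ φ ∈ l, WFAux n N φ := by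
  induction l with
  | nil => simp [disj, WFAux]
  | cons φ l ih =>
    rw [List.forall_mem_cons, ← ih]
    simp [disj, WFAux]

@[simp] theorem wf_exFOs (l : List ℕ) (φ : Formula S 𝔸) :
    WFAux false ∅ (exFOs l φ) ↔ WFAux false ∅ φ := by
  induction l with
  | nil => rfl
  | cons v l ih =>
    rw [← ih]
    simp [exFOs, WFAux]

@[simp] theorem wf_exSOs (l : List ℕ) (φ : Formula S 𝔸) :
    WFAux n N (exSOs l φ) ↔ WFAux n N φ := by
  induction l with
  | nil => rfl
  | cons v l ih =>
    rw [← ih]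
    simp [exSOs, WFAux]

@[simp] theorem wf_eqData (x y : ℕ) : WFAux n ∅ (eqData x y : Formula S 𝔸) := by
  simp [eqData, WFAux]

@[simp] theorem freeFO_verum : (verum : Formula S 𝔸).freeFO = ∅ := by simp [verum, freeFO]

@[simp] theorem freeSO_verum : (verum : Formula S 𝔸).freeSO = ∅ := by simp [verum, freeSO]

@[simp] theorem mem_freeFO_conj (l : List (Formula S 𝔸)) (v : ℕ) :
    v ∈ (conj l).freeFO ↔ ∃ φ ∈ l, v ∈ φ.freeFO := by
  induction l with
  | nil => simp [conj]
  | cons φ l ih =>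
    rw [List.exists_mem_cons_iff, ← ih]
    simp [conj, freeFO]

@[simp] theorem mem_freeSO_conj (l : List (Formula S 𝔸)) (v : ℕ) :
    v ∈ (conj l).freeSO ↔ ∃ φ ∈ l, v ∈ φ.freeSO := by
  induction l with
  | nil => simp [conj]
  | cons φ l ih =>
    rw [List.exists_mem_cons_iff, ← ih]
    simp [conj, freeSO]

@[simp] theorem mem_freeFO_disj (l : List (Formula S 𝔸)) (v : ℕ) :
    v ∈ (disj l).freeFO ↔ ∃ φ ∈ l, v ∈ φ.freeFO := by
  induction l with
  | nil => simp [disj, freeFO]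
  | cons φ l ih =>
    rw [List.exists_mem_cons_iff, ← ih]
    simp [disj, freeFO]

@[simp] theorem mem_freeSO_disj (l : List (Formula S 𝔸)) (v : ℕ) :
    v ∈ (disj l).freeSO ↔ ∃ φ ∈ l, v ∈ φ.freeSO := by
  induction l with
  | nil => simp [disj, freeSO]
  | cons φ l ih =>
    rw [List.exists_mem_cons_iff, ← ih]
    simp [disj, freeSO]

@[simp] theorem mem_freeFO_exFOs (l : List ℕ) (φ : Formula S 𝔸) (v : ℕ) :
    v ∈ (exFOs l φ).freeFO ↔ v ∉ l ∧ v ∈ φ.freeFO := by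
  induction l with
  | nil => simp [exFOs]
  | cons v' l ih =>
    change v ∈ (exFOs l φ).freeFO.erase v' ↔ _
    rw [Finset.mem_erase, ih]
    simp [and_assoc]

@[simp] theorem freeSO_exFOs (l : List ℕ) (φ : Formula S 𝔸) :
    (exFOs l φ).freeSO = φ.freeSO := by
  induction l with
  | nil => rfl
  | cons v' l ih => exact ih

@[simp] theorem mem_freeSO_exSOs (l : List ℕ) (φ : Formula S 𝔸) (v : ℕ) :
    v ∈ (exSOs l φ).freeSO ↔ v ∉ l ∧ v ∈ φ.freeSO := by
  induction l with
  | nil => simp [exSOs]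
  | cons v' l ih =>
    change v ∈ (exSOs l φ).freeSO.erase v' ↔ _
    rw [Finset.mem_erase, ih]
    simp [and_assoc]

@[simp] theorem freeFO_exSOs (l : List ℕ) (φ : Formula S 𝔸) :
    (exSOs l φ).freeFO = φ.freeFO := by
  induction l with
  | nil => rfl
  | cons v' l ih => exact ih

theorem mem_freeFO_eqData (x y v : ℕ) (h : v ∈ (eqData x y : Formula S 𝔸).freeFO) :
    v = x ∨ v = y := by
  simp only [eqData, freeFO, Finset.mem_image, Finset.mem_univ, true_and] at h
  obtain ⟨j, rfl⟩ := h
  unfold Atoms.eqArgs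
  split_ifs <;> simp

@[simp] theorem freeSO_eqData (x y : ℕ) : (eqData x y : Formula S 𝔸).freeSO = ∅ := rfl

end WellFormed

/-! ### The sentence that describes accepting runs of an automaton -/

/-- Second-order variable for the positions that represent the empty register. -/
def nilVar : ℕ := Nat.pair 3 1

/-- Second-order variable for the first positions of windows. -/
def cutVar : ℕ := Nat.pair 3 0

/-- First-order variable for the first position. -/
def firstVar : ℕ := Nat.pair 3 0

/-- First-order variable for the last position. -/
def lastVar : ℕ := Nat.pair 3 1

/-- An auxiliary first-order variable. -/
def yVar : ℕ := Nat.pair 3 2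

/-- An auxiliary first-order variable. -/
def zVar : ℕ := Nat.pair 3 3

/-- An auxiliary first-order variable. -/
def zVar' : ℕ := Nat.pair 3 4

/-- Codes of the register variables for `N` registers. -/
def varCodes (N : ℕ) : List ℕ :=
  (List.range N).map (Nat.pair 0) ++ (List.range N).map (Nat.pair 1) ++ [Nat.pair 2 0]

theorem mem_varCodes {N v : ℕ} : v ∈ varCodes N ↔
    (∃ r < N, v = Nat.pair 0 r) ∨ (∃ r < N, v = Nat.pair 1 r) ∨ v = Nat.pair 2 0 := by
  simp [varCodes, eq_comm]

theorem ne_of_mem_varCodes {N v i : ℕ} (h : v ∈ varCodes N) : v ≠ Nat.pair 3 i := by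
  rcases mem_varCodes.1 h with ⟨r, -, rfl⟩ | ⟨r, -, rfl⟩ | rfl <;> simp

theorem code_mem_varCodes {k N : ℕ} (h : k ≤ N) (v : RegVar k) : v.code ∈ varCodes N := by
  rw [mem_varCodes]
  rcases v with r | r | _
  · exact Or.inl ⟨r, by omega, rfl⟩
  · exact Or.inr (Or.inl ⟨r, by omega, rfl⟩)
  · exact Or.inr (Or.inr rfl)

/-- A register constraint as a formula. -/
def ofConstraint {k : ℕ} : Constraint 𝔸 (RegVar k) → Formula S 𝔸
  | .top => verum
  | .neg Φ => .neg (ofConstraint Φ)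
  | .and Φ Ψ => .and (ofConstraint Φ) (ofConstraint Ψ)
  | .rel R x => .and (conj ((List.ofFn fun j => (x j).code).map fun v => .neg (.mem nilVar v)))
      (.rel R fun j => (x j).code)
  | .isNil x => .mem nilVar x.code

/-- The scope does not begin at the first position. -/
def notFirst : Formula S 𝔸 := .neg (.exFO yVar (.neg (.lt firstVar yVar)))

/-- The scope does not end at the last position. -/
def notLast : Formula S 𝔸 := .neg (.exFO yVar (.neg (.lt yVar lastVar)))

/-- A window represents a transition by the rule `t`. States are represented by additional
registers. -/
def ofRule {m k : ℕ} (init final : List ℕ) (t : Rule S 𝔸 m k) : Formula S 𝔸 := conj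
  [ofConstraint t.guard,
    .neg (.mem nilVar (Nat.pair 0 (k + t.source))),
    conj ((List.range m).map fun j : ℕ =>
        if j = (t.target : ℕ) then .neg (.mem nilVar (Nat.pair 1 (k + j)))
      else .mem nilVar (Nat.pair 1 (k + j))),
    if init.contains (t.source : ℕ) then
      .or (conj ((List.range k).map fun r => .mem nilVar (Nat.pair 0 r))) notFirst else notFirst,
    if final.contains (t.target : ℕ) then verum else notLast]

/-- The scope is a window with one position for each variable. -/
def window (N : ℕ) (l : List (Formula S 𝔸)) : Formula S 𝔸 := exFOs (varCodes N) (conj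
  [conj ((varCodes N).map fun v => .mem v v),
    conj ((varCodes N).map fun v =>
      .neg (.exFO yVar (.and (.mem v yVar) (.or (.lt yVar v) (.lt v yVar))))),
    conj ((List.range N).map fun r =>
      .and (.lt (Nat.pair 0 r) (Nat.pair 2 0)) (.lt (Nat.pair 2 0) (Nat.pair 1 r))),
    .neg (.mem nilVar (Nat.pair 2 0)),
    disj l])

/-- Register contents agree at the border of two windows. -/
noncomputable def glue (N : ℕ) : Formula S 𝔸 := conj ((List.range N).map fun r => .or
  (.neg (.exFO zVar (.mem (Nat.pair 0 r) zVar))) (.or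
  (.neg (.exFO zVar (.mem (Nat.pair 1 r) zVar)))
  (.exFO zVar (.exFO zVar' (.and (.mem (Nat.pair 0 r) zVar) (.and (.mem (Nat.pair 1 r) zVar')
    (.or (.and (.mem nilVar zVar) (.mem nilVar zVar'))
      (.and (.neg (.mem nilVar zVar)) (.and (.neg (.mem nilVar zVar')) (eqData zVar zVar'))))))))))

/-- The sentence stating that a word represents an accepting run, if the empty word is not
accepted. -/
noncomputable def runFormula (N : ℕ) (l : List (Formula S 𝔸)) : Formula S 𝔸 :=
  exSOs (cutVar :: nilVar :: varCodes N) (.exFO firstVar (.exFO lastVar (conj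
    [.neg (.exFO yVar (.lt yVar firstVar)), .neg (.exFO yVar (.lt lastVar yVar)),
      .segment cutVar (window N l), .segment (Nat.pair 2 0) (glue N)])))

end Formula

open Formula in
/-- The sentence for an automaton. -/
noncomputable def NRA.toFormula (A : NRA S 𝔸) : Formula S 𝔸 :=
  if (A.init.map Fin.val).any (fun q => (A.final.map Fin.val).contains q) then verum
  else runFormula (A.numRegs + A.numStates)
    (A.rules.map (ofRule (A.init.map Fin.val) (A.final.map Fin.val)))

namespace Formula

theorem wf_ofConstraint {k : ℕ} (n : Bool) (Φ : Constraint 𝔸 (RegVar k)) :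
    WFAux n ∅ (ofConstraint Φ : Formula S 𝔸) := by
  induction Φ generalizing n with
  | top => simp [ofConstraint]
  | neg Φ ih => simpa [ofConstraint, WFAux] using ih true
  | and Φ Ψ ih1 ih2 => simpa [ofConstraint, WFAux] using ⟨ih1 n, ih2 n⟩
  | rel R x => simp [ofConstraint, WFAux]
  | isNil x => simp [ofConstraint, WFAux]

theorem wf_ofRule {m k : ℕ} (init final : List ℕ) (t : Rule S 𝔸 m k) :
    WFAux false ∅ (ofRule init final t) := by
  simp only [ofRule, wf_conj, List.forall_mem_cons, List.not_mem_nil, false_imp_iff, implies_true,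
    and_true, List.mem_map, forall_exists_index, and_imp, forall_apply_eq_imp_iff₂]
  refine ⟨wf_ofConstraint _ _, by simp [WFAux], fun j _ => ?_, ?_, ?_⟩ <;> split_ifs <;>
    simp [WFAux, notFirst, notLast]

/-- The segment modality is not a negation, so the variables of a window and the two variables
compared in `glue` are bound outside negations. Variables bound below a negation occur only in atoms
without data. -/
theorem wellFormed_toFormula (A : NRA S 𝔸) : WFAux false ∅ A.toFormula := by
  unfold NRA.toFormula
  split_ifs
  · simp
  · simp [runFormula, window, glue, WFAux, wf_ofRule]

theorem freeFO_ofConstraint {k : ℕ} (Φ : Constraint 𝔸 (RegVar k)) {v : ℕ}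
    (h : v ∈ (ofConstraint Φ : Formula S 𝔸).freeFO) : v ∈ varCodes k := by
  induction Φ with
  | top => simp [ofConstraint] at h
  | neg Φ ih => exact ih (by simpa [ofConstraint, freeFO] using h)
  | and Φ Ψ ih1 ih2 =>
    have h' : v ∈ (ofConstraint Φ : Formula S 𝔸).freeFO ∨
      v ∈ (ofConstraint Ψ : Formula S 𝔸).freeFO := by simpa [ofConstraint, freeFO] using h
    exact h'.elim ih1 ih2
  | rel R x =>
    obtain ⟨j, rfl⟩ : ∃ j, v = (x j).code := by
      simpa [ofConstraint, freeFO, List.mem_ofFn, eq_comm] using h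
    exact code_mem_varCodes le_rfl _
  | isNil x =>
    obtain rfl : v = x.code := by simpa [ofConstraint, freeFO] using h
    exact code_mem_varCodes le_rfl _

theorem freeSO_ofConstraint {k : ℕ} (Φ : Constraint 𝔸 (RegVar k)) {v : ℕ}
    (h : v ∈ (ofConstraint Φ : Formula S 𝔸).freeSO) : v = nilVar := by
  induction Φ with
  | top => simp [ofConstraint] at h
  | neg Φ ih => exact ih (by simpa [ofConstraint, freeSO] using h)
  | and Φ Ψ ih1 ih2 =>
    have h' : v ∈ (ofConstraint Φ : Formula S 𝔸).freeSO ∨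
      v ∈ (ofConstraint Ψ : Formula S 𝔸).freeSO := by simpa [ofConstraint, freeSO] using h
    exact h'.elim ih1 ih2
  | rel R x =>
    have : (∃ j : Fin (𝔸.arity R), True) ∧ v = nilVar := by
      simpa [ofConstraint, freeSO, List.mem_ofFn] using h
    exact this.2
  | isNil x => simpa [ofConstraint, freeSO] using h

theorem freeFO_ofRule {m k : ℕ} (init final : List ℕ) (t : Rule S 𝔸 m k) {v : ℕ}
    (h : v ∈ (ofRule init final t).freeFO) :
    v ∈ varCodes (k + m) ∨ v = firstVar ∨ v = lastVar := by
  simp only [ofRule, mem_freeFO_conj, List.exists_mem_cons_iff, List.not_mem_nil, false_and,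
    exists_false, or_false, List.mem_map, List.mem_range, exists_exists_and_eq_and] at h
  rcases h with h | h | ⟨j, hj, h⟩ | h | h
  · have := freeFO_ofConstraint _ h
    rw [mem_varCodes] at this ⊢
    rcases this with ⟨r, h, rfl⟩ | ⟨r, h, rfl⟩ | h
    · exact Or.inl (Or.inl ⟨r, by omega, rfl⟩)
    · exact Or.inl (Or.inr (Or.inl ⟨r, by omega, rfl⟩))
    · exact Or.inl (Or.inr (Or.inr h))
  · simp only [freeFO, Finset.mem_singleton] at h
    exact Or.inl (mem_varCodes.2 (Or.inl ⟨_, by omega, h⟩))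
  · refine Or.inl (mem_varCodes.2 (Or.inr (Or.inl ⟨k + j, by omega, ?_⟩)))
    split_ifs at h <;> simpa [freeFO] using h
  · split_ifs at h
    · simp only [freeFO, Finset.mem_union, mem_freeFO_conj, List.mem_map, List.mem_range,
        exists_exists_and_eq_and, Finset.mem_singleton, notFirst, Finset.mem_erase,
        Finset.mem_insert] at h
      rcases h with ⟨r, hr, rfl⟩ | h
      · exact Or.inl (mem_varCodes.2 (Or.inl ⟨r, by omega, rfl⟩))
      · tauto
    · simp only [freeFO, notFirst, Finset.mem_erase, Finset.mem_insert, Finset.mem_singleton] at h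
      tauto
  · split_ifs at h
    · simp at h
    · simp only [freeFO, notLast, Finset.mem_erase, Finset.mem_insert, Finset.mem_singleton] at h
      tauto

theorem freeSO_ofRule {m k : ℕ} (init final : List ℕ) (t : Rule S 𝔸 m k) {v : ℕ}
    (h : v ∈ (ofRule init final t).freeSO) : v = nilVar := by
  simp only [ofRule, mem_freeSO_conj, List.exists_mem_cons_iff, List.not_mem_nil, false_and,
    exists_false, or_false, List.mem_map, List.mem_range, exists_exists_and_eq_and] at h
  rcases h with h | h | ⟨j, hj, h⟩ | h | h
  · exact freeSO_ofConstraint _ h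
  · simpa [freeSO] using h
  · split_ifs at h <;> simpa [freeSO] using h
  · split_ifs at h
    · simp [freeSO, notFirst] at h
      tauto
    · simp [freeSO, notFirst] at h
  · split_ifs at h
    · simp at h
    · simp [freeSO, notLast] at h

theorem isSentence_toFormula (A : NRA S 𝔸) : A.toFormula.IsSentence := by
  unfold NRA.toFormula
  split_ifs
  · simp [IsSentence]
  · constructor
    · refine Finset.eq_empty_of_forall_notMem fun v h => ?_
      simp only [runFormula, freeFO_exSOs, freeFO, Finset.mem_erase, mem_freeFO_conj,
        List.exists_mem_cons_iff, List.not_mem_nil, false_and, exists_false, or_false,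
        Finset.mem_insert, Finset.mem_singleton, window, mem_freeFO_exFOs, mem_freeFO_disj,
        List.mem_map, List.mem_range, exists_exists_and_eq_and, glue, Finset.mem_union] at h
      obtain ⟨h1, h2, h | h | ⟨h3, h⟩ | h⟩ := h
      · tauto
      · tauto
      · rcases h with ⟨v', hv', rfl⟩ | ⟨v', hv', h⟩ | ⟨r, hr, h⟩ | rfl | ⟨t, ht, h⟩
        · exact h3 hv'
        · obtain ⟨h4, h⟩ := h
          have : v = v' := by tauto
          exact h3 (this ▸ hv')
        · refine h3 (mem_varCodes.2 ?_)
          rcases h with (h | h) | (h | h)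
          · exact Or.inl ⟨r, hr, h⟩
          · exact Or.inr (Or.inr h)
          · exact Or.inr (Or.inr h)
          · exact Or.inr (Or.inl ⟨r, hr, h⟩)
        · exact h3 (mem_varCodes.2 (by simp))
        · have := freeFO_ofRule _ _ _ h
          tauto
      · obtain ⟨r, hr, h⟩ := h
        have := mem_freeFO_eqData (S := S) (𝔸 := 𝔸) zVar zVar' v
        tauto
    · refine Finset.eq_empty_of_forall_notMem fun v h => ?_
      simp only [runFormula, mem_freeSO_exSOs, freeSO, mem_freeSO_conj,
        List.exists_mem_cons_iff, List.not_mem_nil, false_and, exists_false, or_false,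
        Finset.mem_insert, Finset.mem_singleton, window, freeSO_exFOs, mem_freeSO_disj,
        List.mem_map, List.mem_range, exists_exists_and_eq_and, glue, Finset.mem_union,
        freeSO_eqData, Finset.notMem_empty, false_or, or_self, Finset.union_empty] at h
      rw [List.mem_cons, List.mem_cons, not_or, not_or] at h
      obtain ⟨⟨h1, h2, h3⟩, h⟩ := h
      have e1 : ∀ r < A.numRegs + A.numStates,
          Nat.pair 0 r ∈ varCodes (A.numRegs + A.numStates) ∧
          Nat.pair 1 r ∈ varCodes (A.numRegs + A.numStates) := fun r hr =>
        ⟨mem_varCodes.2 (Or.inl ⟨r, hr, rfl⟩), mem_varCodes.2 (Or.inr (Or.inl ⟨r, hr, rfl⟩))⟩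
      have e2 : Nat.pair 2 0 ∈ varCodes (A.numRegs + A.numStates) := mem_varCodes.2 (by simp)
      rcases h with (rfl | h) | h
      · tauto
      · rcases h with ⟨v', hv', rfl⟩ | ⟨v', hv', rfl⟩ | ⟨_, _, h⟩ | h | ⟨t, ht, h⟩
        · tauto
        · tauto
        · exact h
        · tauto
        · exact h2 (freeSO_ofRule _ _ _ h)
      · rcases h with rfl | ⟨r, hr, h⟩
        · tauto
        · have := e1 r hr
          rcases h with rfl | rfl | h <;> grind

end Formula

open Formula in
/-- The sentence for an automaton. -/
noncomputable def NRA.toSMSO (A : NRA S 𝔸) : SMSO S 𝔸 :=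
  ⟨A.toFormula, wellFormed_toFormula A, isSentence_toFormula A⟩

end DataWords

/-! ### Meaning of the sentence that describes runs -/

namespace DataWords

variable {S : Type} {𝔸 : Atoms.{u}}

open Formula

open Classical in
/-- The register content represented by a position, where `Z` represents the empty register. -/
noncomputable def DataWord.content (w : DataWord S 𝔸) (Z : Set ℕ) (p : ℕ) : Option 𝔸.U :=
  if p ∈ Z then none else w.data? p

theorem DataWord.content_eq_none (w : DataWord S 𝔸) (Z : Set ℕ) {p : ℕ} (hp : p < w.length) :
    w.content Z p = none ↔ p ∈ Z := by
  obtain ⟨u, hu⟩ := w.exists_data? hp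
  by_cases h : p ∈ Z <;> simp [DataWord.content, h, hu]

namespace NRA

/-- The range `{a, …, b - 1}` represents a step of `A`, where `V p` is the register content at
position `p`. -/
def WindowSpec (A : NRA S 𝔸) (V : ℕ → Option 𝔸.U) (η : ℕ → Set ℕ) (n a b : ℕ) (x : ℕ → ℕ) : Prop :=
  (∀ v ∈ varCodes (A.numRegs + A.numStates), x v ∈ Set.Ico a b ∧ x v ∈ η v ∧
    ∀ y ∈ Set.Ico a b, y ∈ η v → y = x v) ∧
  (∀ r < A.numRegs + A.numStates,
    x (Nat.pair 0 r) < x (Nat.pair 2 0) ∧ x (Nat.pair 2 0) < x (Nat.pair 1 r)) ∧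
  V (x (Nat.pair 2 0)) ≠ none ∧
  ∃ t ∈ A.rules, t.guard.Holds (fun v => V (x v.code)) ∧
    V (x (Nat.pair 0 (A.numRegs + t.source))) ≠ none ∧
    (∀ j < A.numStates, V (x (Nat.pair 1 (A.numRegs + j))) = none ↔ j ≠ t.target) ∧
    (a = 0 → t.source ∈ A.init ∧ ∀ r < A.numRegs, V (x (Nat.pair 0 r)) = none) ∧
    (b = n → t.target ∈ A.final)

/-- Register contents agree at the border of two windows in `{a, …, b - 1}`. -/
def GlueSpec (N : ℕ) (V : ℕ → Option 𝔸.U) (η : ℕ → Set ℕ) (a b : ℕ) : Prop :=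
  ∀ r < N, (∀ z ∈ Set.Ico a b, z ∉ η (Nat.pair 0 r)) ∨ (∀ z ∈ Set.Ico a b, z ∉ η (Nat.pair 1 r)) ∨
    ∃ z ∈ Set.Ico a b, ∃ z' ∈ Set.Ico a b, z ∈ η (Nat.pair 0 r) ∧ z' ∈ η (Nat.pair 1 r) ∧ V z = V z'

end NRA

namespace Formula

variable (w : DataWord S 𝔸) {ν : ℕ → ℕ} {η : ℕ → Set ℕ} {a b : ℕ}

theorem sat_ofConstraint {k : ℕ} (Φ : Constraint 𝔸 (RegVar k))
    (hν : ∀ v : RegVar k, ν v.code < w.length) :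
    Sat w ν η a b (ofConstraint Φ) ↔ Φ.Holds fun v => w.content (η nilVar) (ν v.code) := by
  induction Φ with
  | top => simp [ofConstraint, Constraint.Holds]
  | neg Φ ih => simp only [ofConstraint, Constraint.Holds, Sat, ih]
  | and Φ Ψ ih1 ih2 => simp only [ofConstraint, Constraint.Holds, Sat, ih1, ih2]
  | rel R x =>
    have h : (∀ j, ν (x j).code ∉ η nilVar) ↔ ∀ j, w.content (η nilVar) (ν (x j).code) ≠ none :=
      forall_congr' fun j => (not_congr (w.content_eq_none _ (hν _))).symm
    simp only [ofConstraint, Constraint.Holds, Sat, sat_conj, List.mem_map, List.mem_ofFn,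
      forall_exists_index, and_imp, forall_apply_eq_imp_iff]
    constructor
    · rintro ⟨h1, d, h2, h3⟩
      refine ⟨d, fun j => ?_, h3⟩
      rw [DataWord.content, if_neg (h1 j), h2]
    · rintro ⟨d, h2, h3⟩
      have h1 := h.2 fun j => by simp [h2]
      refine ⟨h1, d, fun j => ?_, h3⟩
      rw [← h2, DataWord.content, if_neg (h1 j)]
  | isNil x => simp only [ofConstraint, Constraint.Holds, Sat, w.content_eq_none _ (hν _)]

theorem sat_notFirst (hab : a < b) (hf : ν firstVar = 0) :
    Sat w ν η a b notFirst ↔ a ≠ 0 := by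
  have h : firstVar ≠ yVar := by simp [firstVar, yVar]
  simp only [notFirst, Sat, Function.update_self, Function.update_of_ne h, hf, Set.mem_Ico]
  constructor
  · rintro h rfl
    exact h ⟨0, by omega, by omega⟩
  · rintro h ⟨p, hp, hp'⟩
    omega

theorem sat_notLast (hab : a < b) (hb : b ≤ w.length) (hl : ν lastVar = w.length - 1) :
    Sat w ν η a b notLast ↔ b ≠ w.length := by
  have h : lastVar ≠ yVar := by simp [lastVar, yVar]
  simp only [notLast, Sat, Function.update_self, Function.update_of_ne h, hl, Set.mem_Ico]
  constructor
  · rintro h rfl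
    exact h ⟨w.length - 1, by omega, by omega⟩
  · rintro h ⟨p, hp, hp'⟩
    omega

/-- The target is pinned down by all `m` state registers after the step; before the step it suffices
that the register of the source is nonempty, as gluing supplies the rest. Initial and final
conditions bind only in windows at the ends of the word. -/
theorem sat_ofRule {m k : ℕ} (init final : List (Fin m)) (t : Rule S 𝔸 m k) (hab : a < b)
    (hb : b ≤ w.length) (hf : ν firstVar = 0) (hl : ν lastVar = w.length - 1)
    (hν : ∀ v ∈ varCodes (k + m), ν v < w.length) :
    Sat w ν η a b (ofRule (init.map Fin.val) (final.map Fin.val) t) ↔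
      t.guard.Holds (fun v => w.content (η nilVar) (ν v.code)) ∧
      w.content (η nilVar) (ν (Nat.pair 0 (k + t.source))) ≠ none ∧
      (∀ j < m, w.content (η nilVar) (ν (Nat.pair 1 (k + j))) = none ↔ j ≠ t.target) ∧
      (a = 0 → t.source ∈ init ∧ ∀ r < k, w.content (η nilVar) (ν (Nat.pair 0 r)) = none) ∧
      (b = w.length → t.target ∈ final) := by
  have h0 : ∀ r < k + m, (w.content (η nilVar) (ν (Nat.pair 0 r)) = none ↔
      ν (Nat.pair 0 r) ∈ η nilVar) := fun r hr =>
    w.content_eq_none _ (hν _ (mem_varCodes.2 (Or.inl ⟨r, hr, rfl⟩)))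
  have h1 : ∀ r < k + m, (w.content (η nilVar) (ν (Nat.pair 1 r)) = none ↔
      ν (Nat.pair 1 r) ∈ η nilVar) := fun r hr =>
    w.content_eq_none _ (hν _ (mem_varCodes.2 (Or.inr (Or.inl ⟨r, hr, rfl⟩))))
  have e1 : (init.map Fin.val).contains (t.source : ℕ) = true ↔ t.source ∈ init := by
    simp [← Fin.ext_iff]
  have e2 : (final.map Fin.val).contains (t.target : ℕ) = true ↔ t.target ∈ final := by
    simp [← Fin.ext_iff]
  simp only [ofRule, sat_conj, List.forall_mem_cons, List.not_mem_nil, false_imp_iff, implies_true,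
    and_true, List.mem_map, forall_exists_index, and_imp, forall_apply_eq_imp_iff₂, List.mem_range]
  rw [sat_ofConstraint w _ fun v => hν _ (code_mem_varCodes (by omega) v)]
  refine and_congr Iff.rfl (and_congr ?_ (and_congr ?_ (and_congr ?_ ?_)))
  · rw [ne_eq, h0 _ (by omega)]
    rfl
  · refine forall_congr' fun j => forall_congr' fun hj => ?_
    rw [h1 _ (by omega)]
    split_ifs with h <;> simp [Sat, h]
  · by_cases h : t.source ∈ init
    · rw [if_pos (e1.2 h)]
      simp only [Sat, sat_notFirst w hab hf, sat_conj, List.mem_map, forall_exists_index, and_imp,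
        forall_apply_eq_imp_iff₂, List.mem_range, h, true_and]
      have : (∀ r < k, w.content (η nilVar) (ν (Nat.pair 0 r)) = none) ↔
          ∀ r < k, ν (Nat.pair 0 r) ∈ η nilVar :=
        forall_congr' fun r => forall_congr' fun hr => h0 r (by omega)
      rw [this]
      tauto
    · rw [if_neg fun h' => h (e1.1 h'), sat_notFirst w hab hf]
      tauto
  · by_cases h : t.target ∈ final
    · rw [if_pos (e2.2 h)]
      simp [h]
    · rw [if_neg fun h' => h (e2.1 h'), sat_notLast w hab hb hl]
      tauto

theorem sat_window (A : NRA S 𝔸) (hab : a < b) (hb : b ≤ w.length) (hf : ν firstVar = 0)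
    (hl : ν lastVar = w.length - 1) :
    Sat w ν η a b (window (A.numRegs + A.numStates)
      (A.rules.map (ofRule (A.init.map Fin.val) (A.final.map Fin.val)))) ↔
      ∃ x, A.WindowSpec (w.content (η nilVar)) η w.length a b x := by
  rw [window, sat_exFOs]
  have key : ∀ x : ℕ → ℕ, (∀ v ∈ varCodes (A.numRegs + A.numStates), x v ∈ Set.Ico a b) →
      x firstVar = 0 → x lastVar = w.length - 1 →
      (Sat w x η a b (conj [conj ((varCodes (A.numRegs + A.numStates)).map fun v => .mem v v),
        conj ((varCodes (A.numRegs + A.numStates)).map fun v =>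
          .neg (.exFO yVar (.and (.mem v yVar) (.or (.lt yVar v) (.lt v yVar))))),
        conj ((List.range (A.numRegs + A.numStates)).map fun r =>
          .and (.lt (Nat.pair 0 r) (Nat.pair 2 0)) (.lt (Nat.pair 2 0) (Nat.pair 1 r))),
        .neg (.mem nilVar (Nat.pair 2 0)),
        disj (A.rules.map (ofRule (A.init.map Fin.val) (A.final.map Fin.val)))]) ↔
      A.WindowSpec (w.content (η nilVar)) η w.length a b x) := by
    intro x hx hf hl
    simp only [sat_conj, sat_disj, List.forall_mem_cons, List.not_mem_nil, false_imp_iff,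
      implies_true, and_true, List.mem_map, forall_exists_index, and_imp,
      forall_apply_eq_imp_iff₂, List.mem_range, exists_exists_and_eq_and, NRA.WindowSpec]
    rw [← and_assoc]
    refine and_congr ?_ (and_congr Iff.rfl (and_congr ?_ ?_))
    · rw [← forall₂_and]
      refine forall₂_congr fun v hv => ?_
      have hvy : v ≠ yVar := ne_of_mem_varCodes hv
      simp only [Sat, Function.update_self, Function.update_of_ne hvy, hx v hv, true_and]
      refine and_congr_right fun _ => ⟨fun h y hy hyv => ?_, ?_⟩
      · by_contra hne
        exact h ⟨y, hy, hyv, lt_or_gt_of_ne hne⟩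
      · rintro h ⟨y, hy, hyv, h'⟩
        have := h y hy hyv
        omega
    · have : x (Nat.pair 2 0) < w.length :=
        (hx _ (mem_varCodes.2 (by simp))).2.trans_le hb
      rw [ne_eq, w.content_eq_none _ this]
      rfl
    · refine exists_congr fun t => and_congr_right fun _ => ?_
      exact sat_ofRule w _ _ t hab hb hf hl fun v hv => (hx v hv).2.trans_le hb
  have hfv : firstVar ∉ varCodes (A.numRegs + A.numStates) := fun h => ne_of_mem_varCodes h rfl
  have hlv : lastVar ∉ varCodes (A.numRegs + A.numStates) := fun h => ne_of_mem_varCodes h rfl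
  constructor
  · rintro ⟨x, h1, h2, h3⟩
    exact ⟨x, (key x h1 ((h2 _ hfv).trans hf) ((h2 _ hlv).trans hl)).1 h3⟩
  · rintro ⟨x, hx⟩
    classical
    -- The specification says nothing about other variables, so they can keep their values, as
    -- quantification over `varCodes` requires.
    let x' : ℕ → ℕ := fun v => if v ∈ varCodes (A.numRegs + A.numStates) then x v else ν v
    have e : ∀ v ∈ varCodes (A.numRegs + A.numStates), x' v = x v := fun v hv => if_pos hv
    have e' : ∀ v ∉ varCodes (A.numRegs + A.numStates), x' v = ν v := fun v hv => if_neg hv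
    refine ⟨x', fun v hv => by rw [e v hv]; exact (hx.1 v hv).1, e', ?_⟩
    rw [key x' (fun v hv => by rw [e v hv]; exact (hx.1 v hv).1) ((e' _ hfv).trans hf)
      ((e' _ hlv).trans hl)]
    have e0 : ∀ r < A.numRegs + A.numStates, x' (Nat.pair 0 r) = x (Nat.pair 0 r) := fun r hr =>
      e _ (mem_varCodes.2 (Or.inl ⟨r, hr, rfl⟩))
    have e1 : ∀ r < A.numRegs + A.numStates, x' (Nat.pair 1 r) = x (Nat.pair 1 r) := fun r hr =>
      e _ (mem_varCodes.2 (Or.inr (Or.inl ⟨r, hr, rfl⟩)))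
    have e2 : x' (Nat.pair 2 0) = x (Nat.pair 2 0) := e _ (mem_varCodes.2 (by simp))
    obtain ⟨h1, h2, h3, t, ht, h4, h5, h6, h7, h8⟩ := hx
    refine ⟨fun v hv => by rw [e v hv]; exact h1 v hv, fun r hr => ?_, by rwa [e2], t, ht, ?_, ?_,
      fun j hj => ?_, fun ha => ⟨(h7 ha).1, fun r hr => ?_⟩, h8⟩
    · rw [e0 r hr, e1 r hr, e2]
      exact h2 r hr
    · convert h4 using 3 with v
      exact e _ (code_mem_varCodes (by omega) v)
    · rwa [e0 _ (by omega)]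
    · rw [e1 _ (by omega)]
      exact h6 j hj
    · rw [e0 _ (by omega)]
      exact (h7 ha).2 r hr

theorem sat_glue (hb : b ≤ w.length) (N : ℕ) :
    Sat w ν η a b (glue N) ↔ NRA.GlueSpec N (w.content (η nilVar)) η a b := by
  have hz : zVar ≠ zVar' := by simp [zVar, zVar']
  simp only [glue, sat_conj, List.mem_map, forall_exists_index, and_imp, forall_apply_eq_imp_iff₂,
    List.mem_range, NRA.GlueSpec, Sat, Function.update_self, Function.update_of_ne hz, sat_eqData]
  refine forall₂_congr fun r hr => or_congr (by simp) (or_congr (by simp) ?_)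
  refine exists_congr fun z => and_congr_right fun hz => exists_congr fun z' =>
    and_congr_right fun hz' => and_congr_right fun _ => and_congr_right fun _ => ?_
  obtain ⟨u, hu⟩ := w.exists_data? (hz.2.trans_le hb)
  obtain ⟨u', hu'⟩ := w.exists_data? (hz'.2.trans_le hb)
  by_cases h1 : z ∈ η nilVar <;> by_cases h2 : z' ∈ η nilVar <;>
    simp [DataWord.content, h1, h2, hu, hu', eq_comm]

/-- The two outer first-order quantifiers force the word to be nonempty, and their negated conjuncts
pin them to its first and last position. -/
theorem sat_runFormula (A : NRA S 𝔸) :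
    Sat w (fun _ => 0) (fun _ => ∅) 0 w.length (runFormula (A.numRegs + A.numStates)
      (A.rules.map (ofRule (A.init.map Fin.val) (A.final.map Fin.val)))) ↔
    0 < w.length ∧ ∃ η : ℕ → Set ℕ,
      (∀ v ∈ cutVar :: nilVar :: varCodes (A.numRegs + A.numStates), η v ⊆ Set.Ico 0 w.length) ∧
      (∀ v ∉ cutVar :: nilVar :: varCodes (A.numRegs + A.numStates), η v = ∅) ∧
      (∀ I ∈ subs 0 w.length (η cutVar),
        ∃ x, A.WindowSpec (w.content (η nilVar)) η w.length I.1 I.2 x) ∧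
      (∀ I ∈ subs 0 w.length (η (Nat.pair 2 0)),
        NRA.GlueSpec (A.numRegs + A.numStates) (w.content (η nilVar)) η I.1 I.2) := by
  have e1 : firstVar ≠ lastVar := by simp [firstVar, lastVar]
  have e2 : firstVar ≠ yVar := by simp [firstVar, yVar]
  have e3 : lastVar ≠ yVar := by simp [lastVar, yVar]
  have hsub : ∀ η : ℕ → Set ℕ, ∀ ν : ℕ → ℕ, 0 < w.length → ν firstVar = 0 →
      ν lastVar = w.length - 1 → ((Sat w ν η 0 w.length (.segment cutVar (window
        (A.numRegs + A.numStates) (A.rules.map (ofRule (A.init.map Fin.val)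
          (A.final.map Fin.val))))) ∧
        Sat w ν η 0 w.length (.segment (Nat.pair 2 0) (glue (A.numRegs + A.numStates)))) ↔
      (∀ I ∈ subs 0 w.length (η cutVar),
        ∃ x, A.WindowSpec (w.content (η nilVar)) η w.length I.1 I.2 x) ∧
      (∀ I ∈ subs 0 w.length (η (Nat.pair 2 0)),
        NRA.GlueSpec (A.numRegs + A.numStates) (w.content (η nilVar)) η I.1 I.2)) := by
    intro η ν _ hf hl
    refine and_congr ?_ ?_
    · refine forall₂_congr fun I hI => ?_
      have := bounds_of_mem_subs (Nat.zero_le _) hI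
      exact sat_window w A this.2.1 this.2.2 hf hl
    · refine forall₂_congr fun I hI => ?_
      have := bounds_of_mem_subs (Nat.zero_le _) hI
      exact sat_glue w this.2.2 _
  rw [runFormula, sat_exSOs]
  constructor
  · rintro ⟨η, h1, h2, f, hf, l, hl, h⟩
    simp only [sat_conj, List.forall_mem_cons, List.not_mem_nil, false_imp_iff, implies_true,
      and_true] at h
    obtain ⟨h3, h4, h5⟩ := h
    have hn : 0 < w.length := by
      have := hf.2
      omega
    have hf0 : f = 0 := by
      by_contra hf0
      refine h3 ⟨0, ⟨le_rfl, hn⟩, ?_⟩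
      simp only [Sat, Function.update_self, Function.update_of_ne e1, Function.update_of_ne e2]
      omega
    have hl0 : l = w.length - 1 := by
      by_contra hl0
      refine h4 ⟨w.length - 1, ⟨by omega, by omega⟩, ?_⟩
      simp only [Sat, Function.update_self, Function.update_of_ne e3]
      have := hl.2
      omega
    exact ⟨hn, η, h1, h2, (hsub η _ hn (by simp [e1, hf0]) (by simp [hl0])).1 h5⟩
  · rintro ⟨hn, η, h1, h2, h⟩
    refine ⟨η, h1, h2, 0, ⟨le_rfl, hn⟩, w.length - 1, ⟨by omega, by omega⟩, ?_⟩
    simp only [sat_conj, List.forall_mem_cons, List.not_mem_nil, false_imp_iff, implies_true,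
      and_true]
    refine ⟨?_, ?_, (hsub η _ hn (by simp [e1]) (by simp)).2 h⟩
    · rintro ⟨p, hp, h'⟩
      simp [Sat, e1, e2] at h'
    · rintro ⟨p, hp, h'⟩
      simp only [Sat, Function.update_self, Function.update_of_ne e3] at h'
      have := hp.2
      omega

end Formula
end DataWords

/-! ### From a model of the sentence to an accepting run -/

namespace DataWords

variable {S : Type} {𝔸 : Atoms.{u}}

/-- The segment runs from the greatest cut point that is at most `p` to the least one above `p`. -/
theorem exists_mem_subs {a b p : ℕ} (X : Set ℕ) (hp : p ∈ Set.Ico a b) :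
    ∃ I ∈ subs a b X, I.1 ≤ p ∧ p < I.2 := by
  classical
  set C : Set ℕ := X ∩ Set.Ico a b ∪ {a, b} with hC
  have hbC : ∃ q, q ∈ C ∧ p < q := ⟨b, by simp [hC], hp.2⟩
  have haC : a ∈ C := by simp [hC]
  let d := Nat.find hbC
  have hd : d ∈ C ∧ p < d := Nat.find_spec hbC
  let c := Nat.findGreatest (fun q => q ∈ C) p
  have hc : c ∈ C := Nat.findGreatest_spec (P := fun q => q ∈ C) hp.1 haC
  have hcp : c ≤ p := Nat.findGreatest_le p
  refine ⟨(c, d), ⟨hc, hd.1, by show c < d; omega, ?_⟩, hcp, hd.2⟩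
  rintro q hq ⟨h1, h2⟩
  by_cases hqp : q ≤ p
  · exact absurd (Nat.le_findGreatest (P := fun q => q ∈ C) hqp hq) (not_le.2 h1)
  · exact Nat.find_min hbC h2 ⟨hq, not_le.1 hqp⟩

theorem exists_subs_before {a b : ℕ} (hab : a ≤ b) {X : Set ℕ} {I : ℕ × ℕ} (hI : I ∈ subs a b X)
    (h : I.1 ≠ a) : ∃ J ∈ subs a b X, J.2 = I.1 := by
  have hb := bounds_of_mem_subs hab hI
  obtain ⟨J, hJ, h1, h2⟩ := exists_mem_subs (p := I.1 - 1) X (a := a) (b := b)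
    ⟨by omega, by omega⟩
  refine ⟨J, hJ, ?_⟩
  have := hJ.2.2.2 _ hI.1
  omega

namespace NRA

/-- Reachability between configurations. -/
def Reach (A : NRA S 𝔸) : A.Config → A.Config → Prop :=
  Relation.ReflTransGen fun c c' => ∃ l, A.Step c l c'

theorem exists_run_of_reach (A : NRA S 𝔸) {c c' : A.Config} (h : A.Reach c c') :
    ∃ (w : DataWord S 𝔸) (r : ℕ → A.Config), r 0 = c ∧
      (∀ i (hi : i < w.length), A.Step (r i) w[i] (r (i + 1))) ∧ r w.length = c' := by
  induction h using Relation.ReflTransGen.head_induction_on with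
  | refl => exact ⟨[], fun _ => c', rfl, by simp, rfl⟩
  | @head d e h1 _ ih =>
    obtain ⟨l, hl⟩ := h1
    obtain ⟨w, r, h2, h3, h4⟩ := ih
    refine ⟨l :: w, fun i => Nat.casesOn i d r, rfl, fun i hi => ?_, h4⟩
    rcases i with _ | i
    · simpa [h2] using hl
    · exact h3 i (by simpa using hi)

theorem language_nonempty_iff (A : NRA S 𝔸) : A.language.Nonempty ↔
    ∃ q ∈ A.init, ∃ c : A.Config, c.1 ∈ A.final ∧ A.Reach (q, fun _ => none) c := by
  constructor
  · rintro ⟨w, c, ⟨h1, h2⟩, h3, h4⟩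
    refine ⟨_, h1, _, h4, ?_⟩
    have h0 : c 0 = ((c 0).1, fun _ => none) := Prod.ext rfl (funext h2)
    rw [← h0]
    have key : ∀ i ≤ w.length, A.Reach (c 0) (c i) := by
      intro i hi
      induction i with
      | zero => exact Relation.ReflTransGen.refl
      | succ i ih => exact (ih (by omega)).tail ⟨_, h3 i (by omega)⟩
    exact key _ le_rfl
  · rintro ⟨q, hq, c, hc, h⟩
    obtain ⟨w, r, h1, h2, h3⟩ := A.exists_run_of_reach h
    refine ⟨w, r, ⟨?_, ?_⟩, h2, ?_⟩
    · rwa [h1]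
    · simp [h1]
    · rwa [h3]

open Formula (varCodes mem_varCodes)

/-- Each window yields a step, which reads the letter of its rule and the value at its middle
position; the letters of the model play no role. Steps of neighbouring windows fit together because
the glueing segment between their middle positions contains the contents after the first step and
before the second. -/
theorem language_nonempty_of_windows (A : NRA S 𝔸) {n : ℕ} (hn : 0 < n) {X : Set ℕ}
    {V : ℕ → Option 𝔸.U} {η : ℕ → Set ℕ}
    (hX : ∀ I ∈ subs 0 n X, ∃ x, A.WindowSpec V η n I.1 I.2 x)
    (hG : ∀ I ∈ subs 0 n (η (Nat.pair 2 0)),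
      GlueSpec (A.numRegs + A.numStates) V η I.1 I.2) : A.language.Nonempty := by
  rw [language_nonempty_iff]
  choose! x hx using hX
  have m0 : ∀ r < A.numRegs + A.numStates, Nat.pair 0 r ∈ varCodes (A.numRegs + A.numStates) :=
    fun r hr => mem_varCodes.2 (Or.inl ⟨r, hr, rfl⟩)
  have m1 : ∀ r < A.numRegs + A.numStates, Nat.pair 1 r ∈ varCodes (A.numRegs + A.numStates) :=
    fun r hr => mem_varCodes.2 (Or.inr (Or.inl ⟨r, hr, rfl⟩))
  have m2 : Nat.pair 2 0 ∈ varCodes (A.numRegs + A.numStates) := mem_varCodes.2 (by simp)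
  have glued : ∀ I ∈ subs 0 n X, ∀ J ∈ subs 0 n X, J.2 = I.1 → ∀ r < A.numRegs + A.numStates,
      V (x I (Nat.pair 0 r)) = V (x J (Nat.pair 1 r)) := by
    intro I hI J hJ hJI r hr
    have bI := bounds_of_mem_subs (Nat.zero_le _) hI
    have bJ := bounds_of_mem_subs (Nat.zero_le _) hJ
    obtain ⟨hI1, hI2, -⟩ := hx I hI
    obtain ⟨hJ1, hJ2, -⟩ := hx J hJ
    obtain ⟨cI, cI', cI''⟩ := hI1 _ m2
    obtain ⟨cJ, cJ', cJ''⟩ := hJ1 _ m2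
    -- Each window has exactly one middle position, so no other cut point lies between those of two
    -- adjacent windows.
    have hmem : (x J (Nat.pair 2 0), x I (Nat.pair 2 0)) ∈ subs 0 n (η (Nat.pair 2 0)) := by
      simp only [Set.mem_Ico] at cI cJ
      refine ⟨Or.inl ⟨cJ', by simp; omega⟩, Or.inl ⟨cI', by simp; omega⟩, by simp; omega, ?_⟩
      rintro p hp ⟨h1, h2⟩
      simp only at h1 h2
      rcases hp with ⟨hp, -⟩ | hp
      · by_cases hpI : I.1 ≤ p
        · have := cI'' p ⟨hpI, by omega⟩ hp
          omega
        · have := cJ'' p ⟨by omega, by omega⟩ hp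
          omega
      · simp at hp
        omega
    obtain ⟨pI, pI', pI''⟩ := hI1 _ (m0 r hr)
    obtain ⟨pJ, pJ', pJ''⟩ := hJ1 _ (m0 r hr)
    obtain ⟨qI, qI', qI''⟩ := hI1 _ (m1 r hr)
    obtain ⟨qJ, qJ', qJ''⟩ := hJ1 _ (m1 r hr)
    have oI := hI2 r hr
    have oJ := hJ2 r hr
    simp only [Set.mem_Ico] at *
    -- The first two alternatives let the outermost glueing segments pass; here both contents lie in
    -- the segment, by the order of positions in a window.
    rcases hG _ hmem r hr with h | h | ⟨z, hz, z', hz', h1, h2, h3⟩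
    · exact absurd pI' (h _ (by simp; omega))
    · exact absurd qJ' (h _ (by simp; omega))
    · simp only [Set.mem_Ico] at hz hz'
      have e1 : z = x I (Nat.pair 0 r) := by
        by_cases hzI : I.1 ≤ z
        · exact pI'' z ⟨hzI, by omega⟩ h1
        · have := pJ'' z ⟨by omega, by omega⟩ h1
          omega
      have e2 : z' = x J (Nat.pair 1 r) := by
        by_cases hzI : I.1 ≤ z'
        · have := qI'' z' ⟨hzI, by omega⟩ h2
          omega
        · exact qJ'' z' ⟨by omega, by omega⟩ h2
      rw [← e1, ← e2, h3]
  -- Induction on the right end of a window. The state is carried as the only nonempty state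
  -- register, so that glueing also transfers it.
  have main : ∀ b, ∀ I ∈ subs 0 n X, I.2 = b → ∃ q ∈ A.init, ∃ s : Fin A.numStates,
      A.Reach (q, fun _ => none) (s, fun r => V (x I (Nat.pair 1 r))) ∧
      (∀ j < A.numStates, V (x I (Nat.pair 1 (A.numRegs + j))) = none ↔ j ≠ s) ∧
      (I.2 = n → s ∈ A.final) := by
    intro b
    induction b using Nat.strong_induction_on with
    | _ b ih =>
      intro I hI hIb
      have bI := bounds_of_mem_subs (Nat.zero_le _) hI
      obtain ⟨hI1, hI2, hI3, t, ht, hI4, hI5, hI6, hI7, hI8⟩ := hx I hI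
      obtain ⟨u, hu⟩ := Option.ne_none_iff_exists'.1 hI3
      have step : ∀ μ : Fin A.numRegs → Option 𝔸.U, (∀ r, μ r = V (x I (Nat.pair 0 r))) →
          A.Step (t.source, μ) (t.letter, u) (t.target, fun r => V (x I (Nat.pair 1 r))) := by
        intro μ hμ
        refine ⟨t, ht, rfl, rfl, rfl, ?_⟩
        convert hI4 using 2 with v
        rcases v with r | r | _
        · exact hμ r
        · rfl
        · exact hu.symm
      by_cases h0 : I.1 = 0
      · obtain ⟨h1, h2⟩ := hI7 h0
        exact ⟨_, h1, t.target, Relation.ReflTransGen.single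
          ⟨_, step _ fun r => (h2 r r.2).symm⟩, hI6, hI8⟩
      · obtain ⟨J, hJ, hJI⟩ := exists_subs_before (Nat.zero_le _) hI h0
        obtain ⟨q, hq, s, h1, h2, -⟩ := ih J.2 (by omega) J hJ rfl
        have hg := glued I hI J hJ hJI
        -- The source register is nonempty at the start of `I`, hence at the end of `J`, where only
        -- the register of `s` is.
        have hs : t.source = s := by
          by_contra hne
          have := (h2 t.source t.source.2).2 fun h => hne (Fin.ext h)
          rw [← hg _ (by omega)] at this
          exact hI5 this
        refine ⟨q, hq, t.target, h1.tail ⟨(t.letter, u), ?_⟩, hI6, hI8⟩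
        rw [← hs]
        exact step _ fun r => (hg r (by omega)).symm
  obtain ⟨I, hI, h1, h2⟩ := exists_mem_subs (a := 0) (b := n) (p := n - 1) X ⟨by omega, by omega⟩
  have bI := bounds_of_mem_subs (Nat.zero_le _) hI
  obtain ⟨q, hq, s, h3, h4, h5⟩ := main _ I hI rfl
  exact ⟨q, hq, _, h5 (by omega), h3⟩

end NRA
end DataWords

/-! ### From an accepting run to a model of the sentence -/

namespace DataWords

variable {S : Type} {𝔸 : Atoms.{u}}

theorem mul_add_mod_of_lt {i M o : ℕ} (ho : o < M) : (i * M + o) % M = o := by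
  rw [Nat.add_comm, Nat.add_mul_mod_self_right, Nat.mod_eq_of_lt ho]

theorem mul_add_div_of_lt {i M o : ℕ} (ho : o < M) : (i * M + o) / M = i := by
  rw [Nat.add_comm, Nat.add_mul_div_right _ _ (by omega), Nat.div_eq_of_lt ho, zero_add]

theorem mem_subs_multiples {n M : ℕ} (hM : 0 < M) {X : Set ℕ}
    (hX : ∀ p, p ∈ X ↔ p < n * M ∧ p % M = 0) {I : ℕ × ℕ} (hI : I ∈ subs 0 (n * M) X) :
    ∃ i < n, I.1 = i * M ∧ I.2 = i * M + M := by
  have hb := bounds_of_mem_subs (Nat.zero_le _) hI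
  have key : ∀ p ∈ X ∩ Set.Ico 0 (n * M) ∪ {0, n * M}, ∃ i, p = i * M := by
    rintro p (⟨hp, -⟩ | hp)
    · exact ⟨p / M, (Nat.div_mul_cancel (Nat.dvd_of_mod_eq_zero ((hX p).1 hp).2)).symm⟩
    · rcases hp with rfl | rfl
      · exact ⟨0, by simp⟩
      · exact ⟨n, rfl⟩
  obtain ⟨h1, h2, h3, h4⟩ := hI
  obtain ⟨i, hi⟩ := key _ h1
  obtain ⟨j, hj⟩ := key _ h2
  have hij : i < j := by
    rw [hi, hj] at h3
    exact lt_of_mul_lt_mul_right h3 (Nat.zero_le _)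
  have hjn : j ≤ n := by
    have := hb.2.2
    rw [hj] at this
    exact le_of_mul_le_mul_right this hM
  refine ⟨i, by omega, hi, ?_⟩
  have hle : (i + 1) * M ≤ j * M := Nat.mul_le_mul_right _ hij
  have hsucc : (i + 1) * M = i * M + M := Nat.succ_mul i M
  have hjn' : j * M ≤ n * M := Nat.mul_le_mul_right _ hjn
  by_contra hne
  refine h4 (i * M + M) (Or.inl ⟨(hX _).2 ⟨by omega, ?_⟩, by simp; omega⟩) ⟨by omega, by omega⟩
  rw [← hsucc, Nat.mul_mod_left]

namespace NRA

open Formula (varCodes mem_varCodes cutVar nilVar)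

open Classical in
/-- Register contents extended by the state: register `numRegs + j` is non-empty exactly in
state `j`. -/
noncomputable def extended (A : NRA S 𝔸) (u : 𝔸.U) (c : A.Config) (o : ℕ) : Option 𝔸.U :=
  if h : o < A.numRegs then c.2 ⟨o, h⟩ else if o - A.numRegs = c.1 then some u else none

/-- The position of a variable within a window. -/
def offset (N v : ℕ) : ℕ :=
  if v.unpair.1 = 0 then v.unpair.2 else if v.unpair.1 = 1 then N + 1 + v.unpair.2 else N

theorem offset_lt {N v : ℕ} (hv : v ∈ varCodes N) : offset N v < 2 * N + 1 := by
  rcases mem_varCodes.1 hv with ⟨r, hr, rfl⟩ | ⟨r, hr, rfl⟩ | rfl <;> simp [offset] <;> omega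

/-- Step `i` occupies the block of length `M` that begins at `i * M`: contents before the step at
offsets below `N`, the input value at offset `N`, contents after the step above it. -/
theorem windowSpec_of_run (A : NRA S 𝔸) {w : DataWord S 𝔸} {c : ℕ → A.Config}
    (hc : A.AcceptingRun w c) (u : 𝔸.U) {V : ℕ → Option 𝔸.U} {η : ℕ → Set ℕ} {N M : ℕ}
    (hN : N = A.numRegs + A.numStates) (hM : M = 2 * N + 1)
    (hV0 : ∀ i < w.length, ∀ r < N, V (i * M + r) = A.extended u (c i) r)
    (hVc : ∀ i < w.length, V (i * M + N) = w.data? i)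
    (hV1 : ∀ i < w.length, ∀ r < N, V (i * M + (N + 1 + r)) = A.extended u (c (i + 1)) r)
    (hη : ∀ v ∈ varCodes N, ∀ p, p ∈ η v ↔ p < w.length * M ∧ p % M = offset N v)
    {i : ℕ} (hi : i < w.length) :
    A.WindowSpec V η (w.length * M) (i * M) (i * M + M) (fun v => i * M + offset N v) := by
  have o0 : ∀ r, offset N (Nat.pair 0 r) = r := fun r => by simp [offset]
  have o1 : ∀ r, offset N (Nat.pair 1 r) = N + 1 + r := fun r => by simp [offset]
  have o2 : offset N (Nat.pair 2 0) = N := by simp [offset]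
  have hle : i * M + M ≤ w.length * M := by
    rw [← Nat.succ_mul]
    exact Nat.mul_le_mul_right _ hi
  obtain ⟨⟨hc1, hc2⟩, hc3, hc4⟩ := hc
  obtain ⟨t, ht, ht1, ht2, ht3, ht4⟩ := hc3 i hi
  subst hN
  refine ⟨fun v hv => ?_, fun r hr => ?_, ?_, t, ht, ?_, ?_, fun j hj => ?_, fun h0 => ?_,
    fun h1 => ?_⟩
  · have ho := offset_lt hv
    rw [← hM] at ho
    dsimp only
    refine ⟨⟨by omega, by omega⟩, (hη v hv _).2 ⟨by omega, mul_add_mod_of_lt ho⟩,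
      fun y hy hyv => ?_⟩
    obtain ⟨o, rfl⟩ := Nat.exists_eq_add_of_le hy.1
    have hoM : o < M := by
      have := hy.2
      omega
    rw [← ((hη v hv _).1 hyv).2, mul_add_mod_of_lt hoM]
  · simp only [o0, o1, o2]
    omega
  · simp only [o2, hVc i hi]
    simp [DataWord.data?, hi]
  · convert ht4 using 2 with v
    rcases v with r | r | _
    · change V (i * M + offset _ (Nat.pair 0 r)) = _
      rw [o0, hV0 i hi _ (by omega), extended, dif_pos r.2]
      rfl
    · change V (i * M + offset _ (Nat.pair 1 r)) = _
      rw [o1, hV1 i hi _ (by omega), extended, dif_pos r.2]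
      rfl
    · change V (i * M + offset _ (Nat.pair 2 0)) = _
      rw [o2, hVc i hi]
      simp [DataWord.data?, hi, combine]
  · simp only [o0]
    rw [hV0 i hi _ (by omega)]
    simp [extended, ht1]
  · simp only [o1]
    rw [hV1 i hi _ (by omega)]
    simp [extended, ht3]
  · have hi0 : i = 0 := by
      rcases Nat.mul_eq_zero.1 h0 with h | h <;> omega
    subst hi0
    refine ⟨ht1 ▸ hc1, fun r hr => ?_⟩
    simp only [o0]
    rw [hV0 0 hi _ (by omega), extended, dif_pos hr]
    exact hc2 _
  · have hi1 : i + 1 = w.length := by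
      rw [← Nat.succ_mul] at h1
      exact Nat.eq_of_mul_eq_mul_right (by omega) h1
    rw [ht3, hi1]
    exact hc4

/-- If a glueing segment contains contents before step `i` and contents after step `j`, then `i = j
+ 1`, so both come from the same configuration. -/
theorem glueSpec_of_run (A : NRA S 𝔸) {n : ℕ} {c : ℕ → A.Config} (u : 𝔸.U)
    {V : ℕ → Option 𝔸.U} {η : ℕ → Set ℕ} {N M : ℕ} (hM : M = 2 * N + 1)
    (hV0 : ∀ i < n, ∀ r < N, V (i * M + r) = A.extended u (c i) r)
    (hV1 : ∀ i < n, ∀ r < N, V (i * M + (N + 1 + r)) = A.extended u (c (i + 1)) r)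
    (hη : ∀ v ∈ varCodes N, ∀ p, p ∈ η v ↔ p < n * M ∧ p % M = offset N v)
    {I : ℕ × ℕ} (hI : I ∈ subs 0 (n * M) (η (Nat.pair 2 0))) : GlueSpec N V η I.1 I.2 := by
  intro r hr
  by_contra! hcon
  obtain ⟨⟨z, hz, hzη⟩, ⟨z', hz', hzη'⟩, hcon⟩ := hcon
  have hb := bounds_of_mem_subs (Nat.zero_le _) hI
  refine hcon z hz z' hz' hzη hzη' ?_
  obtain ⟨h1, h2⟩ := (hη _ (mem_varCodes.2 (Or.inl ⟨r, hr, rfl⟩)) z).1 hzη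
  obtain ⟨h1', h2'⟩ := (hη _ (mem_varCodes.2 (Or.inr (Or.inl ⟨r, hr, rfl⟩))) z').1 hzη'
  have o0 : offset N (Nat.pair 0 r) = r := by simp [offset]
  have o1 : offset N (Nat.pair 1 r) = N + 1 + r := by simp [offset]
  have o2 : offset N (Nat.pair 2 0) = N := by simp [offset]
  rw [o0] at h2
  rw [o1] at h2'
  obtain ⟨i, rfl⟩ : ∃ i, z = i * M + r := ⟨z / M, by rw [← h2, Nat.div_add_mod']⟩
  obtain ⟨j, rfl⟩ : ∃ j, z' = j * M + (N + 1 + r) := ⟨z' / M, by rw [← h2', Nat.div_add_mod']⟩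
  have hi : i < n := by
    by_contra hle
    have := Nat.mul_le_mul_right M (not_lt.1 hle)
    omega
  have hj : j < n := by
    by_contra hle
    have := Nat.mul_le_mul_right M (not_lt.1 hle)
    omega
  have cur : ∀ l, I.1 < l * M + N → l * M + N < I.2 → False := by
    intro l h3 h4
    refine hI.2.2.2 (l * M + N) (Or.inl ⟨(hη _ (mem_varCodes.2 (by simp)) _).2 ⟨by omega, ?_⟩,
      by simp; omega⟩) ⟨h3, h4⟩
    rw [o2, mul_add_mod_of_lt (by omega)]
  simp only [Set.mem_Ico] at hz hz'
  -- For `i ≤ j` the input position of block `i` would lie strictly inside the segment, for `i > j +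
  -- 1` that of block `j + 1`.
  have hji : i = j + 1 := by
    rcases lt_trichotomy i (j + 1) with h | h | h
    · have := Nat.mul_le_mul_right M (Nat.le_of_lt_succ h)
      exact (cur i (by omega) (by omega)).elim
    · exact h
    · have h5 : (j + 1 + 1) * M ≤ i * M := Nat.mul_le_mul_right M h
      have h6 : (j + 1 + 1) * M = j * M + M + M := by rw [Nat.succ_mul, Nat.succ_mul]
      have h7 : (j + 1) * M = j * M + M := Nat.succ_mul _ _
      exact (cur (j + 1) (by omega) (by omega)).elim
  rw [hV0 i hi r hr, hV1 j hj r hr, hji]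

theorem exists_sat_runFormula (A : NRA S 𝔸) {w : DataWord S 𝔸} {c : ℕ → A.Config}
    (hc : A.AcceptingRun w c) (hw : 0 < w.length) : ∃ w' : DataWord S 𝔸,
      Formula.Sat w' (fun _ => 0) (fun _ => ∅) 0 w'.length
        (Formula.runFormula (A.numRegs + A.numStates) (A.rules.map
          (Formula.ofRule (A.init.map Fin.val) (A.final.map Fin.val)))) := by
  classical
  obtain ⟨N, hN⟩ : ∃ N, N = A.numRegs + A.numStates := ⟨_, rfl⟩
  obtain ⟨M, hM⟩ : ∃ M, M = 2 * N + 1 := ⟨_, rfl⟩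
  -- Supplies dummies: one letter for all positions, and one data value both for empty cells and for
  -- marking the current state.
  obtain ⟨d⟩ : Nonempty (S × 𝔸.U) := ⟨w[0]⟩
  let cell : ℕ → Option 𝔸.U := fun p =>
    if p % M < N then A.extended d.2 (c (p / M)) (p % M)
    else if p % M = N then w.data? (p / M)
    else A.extended d.2 (c (p / M + 1)) (p % M - (N + 1))
  let w' : DataWord S 𝔸 := (List.range (w.length * M)).map fun p => (d.1, (cell p).getD d.2)
  have hw' : w'.length = w.length * M := by simp [w']
  let η : ℕ → Set ℕ := fun v =>
    if v = cutVar then {p | p < w.length * M ∧ p % M = 0}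
    else if v = nilVar then {p | p < w.length * M ∧ cell p = none}
    else if v ∈ varCodes N then {p | p < w.length * M ∧ p % M = offset N v} else ∅
  have hcut : η cutVar = {p | p < w.length * M ∧ p % M = 0} := if_pos rfl
  have hnil : η nilVar = {p | p < w.length * M ∧ cell p = none} := by
    have : nilVar ≠ cutVar := by simp [nilVar, cutVar]
    simp only [η, if_neg this, if_true]
  have hη : ∀ v ∈ varCodes N, ∀ p, p ∈ η v ↔ p < w.length * M ∧ p % M = offset N v := by
    intro v hv p
    have h1 : v ≠ cutVar := Formula.ne_of_mem_varCodes hv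
    have h2 : v ≠ nilVar := Formula.ne_of_mem_varCodes hv
    simp [η, h1, h2, hv]
  have hV : ∀ p < w.length * M, w'.content (η nilVar) p = cell p := by
    intro p hp
    rw [DataWord.content, hnil]
    by_cases h : cell p = none
    · rw [if_pos ⟨hp, h⟩, h]
    · rw [if_neg fun h' => h h'.2]
      obtain ⟨u, hu⟩ := Option.ne_none_iff_exists'.1 h
      simp [DataWord.data?, w', hp, hu]
  have hle : ∀ i < w.length, i * M + M ≤ w.length * M := fun i hi => by
    rw [← Nat.succ_mul]
    exact Nat.mul_le_mul_right _ hi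
  have hV0 : ∀ i < w.length, ∀ r < N,
      w'.content (η nilVar) (i * M + r) = A.extended d.2 (c i) r := by
    intro i hi r hr
    have := hle i hi
    rw [hV _ (by omega)]
    simp only [cell, mul_add_mod_of_lt (show r < M by omega),
      mul_add_div_of_lt (show r < M by omega), if_pos hr]
  have hVc : ∀ i < w.length, w'.content (η nilVar) (i * M + N) = w.data? i := by
    intro i hi
    have := hle i hi
    rw [hV _ (by omega)]
    simp only [cell, mul_add_mod_of_lt (show N < M by omega),
      mul_add_div_of_lt (show N < M by omega), lt_irrefl, if_false, if_true]
  have hV1 : ∀ i < w.length, ∀ r < N,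
      w'.content (η nilVar) (i * M + (N + 1 + r)) = A.extended d.2 (c (i + 1)) r := by
    intro i hi r hr
    have := hle i hi
    rw [hV _ (by omega)]
    simp only [cell, mul_add_mod_of_lt (show N + 1 + r < M by omega),
      mul_add_div_of_lt (show N + 1 + r < M by omega), if_neg (show ¬ N + 1 + r < N by omega),
      if_neg (show ¬ N + 1 + r = N by omega), Nat.add_sub_cancel_left]
  refine ⟨w', (Formula.sat_runFormula w' A).2 ⟨?_, η, fun v hv => ?_, fun v hv => ?_, ?_, ?_⟩⟩
  · rw [hw']
    exact Nat.mul_pos hw (by omega)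
  · rw [hw']
    intro p hp
    refine ⟨Nat.zero_le _, ?_⟩
    simp only [η] at hp
    split_ifs at hp
    · exact hp.1
    · exact hp.1
    · exact hp.1
    · exact hp.elim
  · rw [← hN] at hv
    simp only [List.mem_cons, not_or] at hv
    simp [η, hv]
  · rw [hw']
    intro I hI
    obtain ⟨i, hi, h1, h2⟩ := mem_subs_multiples (by omega) (fun p => by rw [hcut]; rfl) hI
    rw [h1, h2]
    exact ⟨_, A.windowSpec_of_run hc d.2 hN hM hV0 hVc hV1 hη hi⟩
  · rw [hw', ← hN]
    intro I hI
    exact A.glueSpec_of_run d.2 hM hV0 hV1 hη hI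

/-- The empty word has no window and is treated apart: it is accepted exactly if some state is both
initial and final, and then the sentence is `verum`. -/
theorem language_toSMSO (A : NRA S 𝔸) : A.toSMSO.language.Nonempty ↔ A.language.Nonempty := by
  change (∃ w, Formula.Sat w (fun _ => 0) (fun _ => ∅) 0 w.length A.toFormula) ↔ _
  unfold NRA.toFormula
  have hany : ((A.init.map Fin.val).any fun q => (A.final.map Fin.val).contains q) = true ↔
      ∃ q ∈ A.init, q ∈ A.final := by
    simp [← Fin.ext_iff]
  split_ifs with h
  · refine iff_of_true ⟨[], by simp⟩ ?_
    obtain ⟨q, h1, h2⟩ := hany.1 h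
    exact A.language_nonempty_iff.2 ⟨q, h1, _, h2, Relation.ReflTransGen.refl⟩
  · constructor
    · rintro ⟨w, hw⟩
      obtain ⟨h1, η, -, -, h2, h3⟩ := (Formula.sat_runFormula w A).1 hw
      exact A.language_nonempty_of_windows h1 h2 h3
    · rintro ⟨w, c, hc⟩
      refine A.exists_sat_runFormula hc (Nat.pos_of_ne_zero fun h0 => h (hany.2 ?_))
      have := hc.2.2
      rw [h0] at this
      exact ⟨_, hc.1.1, this⟩

end NRA
end DataWords

namespace DataWords

variable {S : Type} {𝔸 : Atoms.{u}}

namespace Formula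

/-! ### The sentence for an automaton on codes -/

section Codes

variable {α : Type*} [Primcodable α]

/-- Code of a negated formula. -/
def cNeg (c : ℕ) : ℕ := Nat.pair 5 c

/-- Code of a conjunction. -/
def cAnd (c d : ℕ) : ℕ := Nat.pair 3 (Nat.pair c d)

/-- Code of a disjunction. -/
def cOr (c d : ℕ) : ℕ := Nat.pair 4 (Nat.pair c d)

/-- Code of `exFO x φ`, where `φ` has code `c`. -/
def cExFO (x c : ℕ) : ℕ := Nat.pair 0 (Nat.pair x c)

/-- Code of `exSO X φ`, where `φ` has code `c`. -/
def cExSO (x c : ℕ) : ℕ := Nat.pair 1 (Nat.pair x c)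

/-- Code of `lt x y`. -/
def cLt (x y : ℕ) : ℕ := Nat.pair 6 (Nat.pair x y)

/-- Code of `mem X x`. -/
def cMem (X x : ℕ) : ℕ := Nat.pair 7 (Nat.pair X x)

/-- Code of `verum`. -/
def cVerum : ℕ := cNeg (cExFO 0 (cLt 0 0))

/-- Code of a conjunction of a list. -/
def cConj (l : List ℕ) : ℕ := l.foldr cAnd cVerum

/-- Code of a disjunction of a list. -/
def cDisj (l : List ℕ) : ℕ := l.foldr cOr (cNeg cVerum)

@[fun_prop] theorem primrec_cNeg {f : α → ℕ} (hf : Primrec f) :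
    Primrec fun x => cNeg (f x) := by
  unfold cNeg
  fun_prop

@[fun_prop] theorem primrec_cAnd {f g : α → ℕ} (hf : Primrec f) (hg : Primrec g) :
    Primrec fun x => cAnd (f x) (g x) := by
  unfold cAnd
  fun_prop

@[fun_prop] theorem primrec_cOr {f g : α → ℕ} (hf : Primrec f) (hg : Primrec g) :
    Primrec fun x => cOr (f x) (g x) := by
  unfold cOr
  fun_prop

@[fun_prop] theorem primrec_cExFO {f g : α → ℕ} (hf : Primrec f) (hg : Primrec g) :
    Primrec fun x => cExFO (f x) (g x) := by
  unfold cExFO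
  fun_prop

@[fun_prop] theorem primrec_cExSO {f g : α → ℕ} (hf : Primrec f) (hg : Primrec g) :
    Primrec fun x => cExSO (f x) (g x) := by
  unfold cExSO
  fun_prop

@[fun_prop] theorem primrec_cLt {f g : α → ℕ} (hf : Primrec f) (hg : Primrec g) :
    Primrec fun x => cLt (f x) (g x) := by
  unfold cLt
  fun_prop

@[fun_prop] theorem primrec_cMem {f g : α → ℕ} (hf : Primrec f) (hg : Primrec g) :
    Primrec fun x => cMem (f x) (g x) := by
  unfold cMem
  fun_prop

@[fun_prop] theorem primrec_cConj {f : α → List ℕ} (hf : Primrec f) :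
    Primrec fun x => cConj (f x) := by
  unfold cConj
  fun_prop

@[fun_prop] theorem primrec_cDisj {f : α → List ℕ} (hf : Primrec f) :
    Primrec fun x => cDisj (f x) := by
  unfold cDisj
  fun_prop

@[fun_prop] theorem primrec_varCodes {f : α → ℕ} (hf : Primrec f) :
    Primrec fun x => varCodes (f x) := by
  unfold varCodes
  fun_prop

end Codes

variable [Encodable S]

theorem code_verum' : (verum : Formula S 𝔸).code = cVerum := rfl

theorem code_eq_cNeg (φ : Formula S 𝔸) : (neg φ).code = cNeg φ.code := rfl

theorem code_eq_cAnd (φ ψ : Formula S 𝔸) : (and φ ψ).code = cAnd φ.code ψ.code := rfl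

theorem code_eq_cOr (φ ψ : Formula S 𝔸) : (or φ ψ).code = cOr φ.code ψ.code := rfl

theorem code_eq_cExFO (x : ℕ) (φ : Formula S 𝔸) : (exFO x φ).code = cExFO x φ.code := rfl

theorem code_eq_cLt (x y : ℕ) : (lt x y : Formula S 𝔸).code = cLt x y := rfl

theorem code_eq_cMem (X x : ℕ) : (mem X x : Formula S 𝔸).code = cMem X x := rfl

theorem code_eq_segment (X : ℕ) (φ : Formula S 𝔸) :
    (segment X φ).code = Nat.pair 2 (Nat.pair X φ.code) := rfl

theorem code_conj' (l : List (Formula S 𝔸)) : (conj l).code = cConj (l.map code) := by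
  induction l with
  | nil => rfl
  | cons φ l ih =>
    change cAnd φ.code (conj l).code = _
    rw [ih]
    rfl

theorem code_disj (l : List (Formula S 𝔸)) : (disj l).code = cDisj (l.map code) := by
  induction l with
  | nil => rfl
  | cons φ l ih =>
    change cOr φ.code (disj l).code = _
    rw [ih]
    rfl

theorem code_exFOs (l : List ℕ) (φ : Formula S 𝔸) : (exFOs l φ).code = l.foldr cExFO φ.code := by
  induction l with
  | nil => rfl
  | cons v l ih =>
    change cExFO v (exFOs l φ).code = _
    rw [ih]
    rfl

theorem code_exSOs (l : List ℕ) (φ : Formula S 𝔸) : (exSOs l φ).code = l.foldr cExSO φ.code := by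
  induction l with
  | nil => rfl
  | cons v l ih =>
    change cExSO v (exSOs l φ).code = _
    rw [ih]
    rfl

theorem exists_primrec_ofConstraint : ∃ f : ℕ → ℕ, Primrec f ∧
    ∀ (k : ℕ) (Φ : Constraint 𝔸 (RegVar k)), f Φ.code = (ofConstraint Φ : Formula S 𝔸).code := by
  obtain ⟨f, hf, h⟩ := exists_primrec_rec (m := fun c : ℕ => c)
    (l := fun c => if c.unpair.1 = 1 then [c.unpair.2] else
      if c.unpair.1 = 2 then [c.unpair.2.unpair.1, c.unpair.2.unpair.2] else [])
    (g := fun c (r : List ℕ) => if c.unpair.1 = 0 then cVerum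
      else if c.unpair.1 = 1 then cNeg (r.getD 0 0)
      else if c.unpair.1 = 2 then cAnd (r.getD 0 0) (r.getD 1 0)
      -- Codes of register variables are the names of first-order variables, so the symbol with its
      -- argument list is taken over unchanged under the tag of `Formula.rel`.
      else if c.unpair.1 = 3 then
        cAnd (cConj ((decodeList c.unpair.2.unpair.2).map fun v => cNeg (cMem nilVar v)))
          (Nat.pair 9 c.unpair.2)
      else cMem nilVar c.unpair.2)
    (by fun_prop) (by fun_prop) (by fun_prop)
  refine ⟨f, hf, fun k Φ => ?_⟩
  induction Φ with
  | top =>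
    rw [h]
    · simp [Constraint.code, ofConstraint, code_verum']
    · clear h
      simp [Constraint.code]
  | neg Φ ih =>
    have := lt_natPair_succ 0 Φ.code
    rw [h]
    · simp [Constraint.code, ofConstraint, ih, code, cNeg]
    · clear h
      simp_all [Constraint.code]
  | and Φ Ψ ih1 ih2 =>
    have h1 : Φ.code < Nat.pair 2 (Nat.pair Φ.code Ψ.code) :=
      (Nat.left_le_pair _ _).trans_lt (lt_natPair_succ 1 _)
    have h2 : Ψ.code < Nat.pair 2 (Nat.pair Φ.code Ψ.code) :=
      (Nat.right_le_pair _ _).trans_lt (lt_natPair_succ 1 _)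
    rw [h]
    · simp [Constraint.code, ofConstraint, ih1, ih2, code, cAnd]
    · clear h
      simp_all [Constraint.code]
  | rel R x =>
    have hx : decodeList (Encodable.encode (List.ofFn fun j => (x j).code)) =
        List.ofFn fun j => (x j).code := decodeList_encodeList _
    rw [h]
    · simp only [Constraint.code, ofConstraint, code, cAnd, code_conj', Nat.unpair_pair, hx,
        List.map_map]
      rfl
    · clear h
      simp [Constraint.code]
  | isNil x =>
    rw [h]
    · simp [Constraint.code, ofConstraint, code, cMem]
    · clear h
      simp [Constraint.code]

/-- Code of `notFirst`. -/
def cNotFirst : ℕ := cNeg (cExFO yVar (cNeg (cLt firstVar yVar)))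

/-- Code of `notLast`. -/
def cNotLast : ℕ := cNeg (cExFO yVar (cNeg (cLt yVar lastVar)))

/-- Code of `ofRule`, where `g` is the code of the formula for the guard, and `s` and `s'` are the
source and the target of the rule. -/
def cOfRule (m k : ℕ) (init final : List ℕ) (g s s' : ℕ) : ℕ :=
  cConj [g, cNeg (cMem nilVar (Nat.pair 0 (k + s))),
    cConj ((List.range m).map fun j => if j = s' then cNeg (cMem nilVar (Nat.pair 1 (k + j)))
      else cMem nilVar (Nat.pair 1 (k + j))),
    if init.contains s = true then
      cOr (cConj ((List.range k).map fun r => cMem nilVar (Nat.pair 0 r))) cNotFirst else cNotFirst,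
    if final.contains s' = true then cVerum else cNotLast]

theorem code_ofRule {m k : ℕ} (init final : List ℕ) (t : Rule S 𝔸 m k) :
    (ofRule init final t).code =
      cOfRule m k init final (ofConstraint t.guard : Formula S 𝔸).code t.source t.target := by
  simp only [ofRule, cOfRule, code_conj', List.map_cons, List.map_nil, List.map_map]
  congr 4
  · congr 2
    funext j
    simp only [Function.comp]
    split_ifs <;> rfl
  · congr 1
    · split_ifs
      · simp only [code, code_conj', List.map_map]
        rfl
      · rfl
    · congr 1
      split_ifs <;> rfl

/-- Code of `window`. -/
def cWindow (N : ℕ) (l : List ℕ) : ℕ := (varCodes N).foldr cExFO (cConj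
  [cConj ((varCodes N).map fun v => cMem v v),
    cConj ((varCodes N).map fun v =>
      cNeg (cExFO yVar (cAnd (cMem v yVar) (cOr (cLt yVar v) (cLt v yVar))))),
    cConj ((List.range N).map fun r =>
      cAnd (cLt (Nat.pair 0 r) (Nat.pair 2 0)) (cLt (Nat.pair 2 0) (Nat.pair 1 r))),
    cNeg (cMem nilVar (Nat.pair 2 0)),
    cDisj l])

theorem code_window (N : ℕ) (l : List (Formula S 𝔸)) :
    (window N l).code = cWindow N (l.map code) := by
  simp only [window, cWindow, code_exFOs, code_conj', code_disj, List.map_cons, List.map_nil,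
    List.map_map, code_eq_cNeg, code_eq_cAnd, code_eq_cOr, code_eq_cExFO,
    code_eq_cLt, code_eq_cMem, Function.comp_def]

/-- Code of `glue`. -/
noncomputable def cGlue (𝔸 : Atoms.{u}) (N : ℕ) : ℕ := cConj ((List.range N).map fun r => cOr
  (cNeg (cExFO zVar (cMem (Nat.pair 0 r) zVar))) (cOr
  (cNeg (cExFO zVar (cMem (Nat.pair 1 r) zVar)))
  (cExFO zVar (cExFO zVar' (cAnd (cMem (Nat.pair 0 r) zVar) (cAnd (cMem (Nat.pair 1 r) zVar')
    (cOr (cAnd (cMem nilVar zVar) (cMem nilVar zVar'))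
      (cAnd (cNeg (cMem nilVar zVar)) (cAnd (cNeg (cMem nilVar zVar'))
        (Nat.pair 9 (Nat.pair 𝔸.eqRel (encodeList [zVar, zVar']))))))))))))

theorem code_glue (N : ℕ) : (glue N : Formula S 𝔸).code = cGlue 𝔸 N := by
  have h : (eqData zVar zVar' : Formula S 𝔸).code =
      Nat.pair 9 (Nat.pair 𝔸.eqRel (encodeList [zVar, zVar'])) := by
    have h' := Atoms.ofFn_eqArgs (𝔸 := 𝔸) id zVar zVar'
    simp only [id] at h'
    simp only [eqData, code, h', encodeList]
  simp only [glue, cGlue, code_conj', List.map_map, h, code_eq_cNeg, code_eq_cAnd, code_eq_cOr,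
    code_eq_cExFO, code_eq_cMem, Function.comp_def]

/-- Code of `runFormula`. -/
noncomputable def cRunFormula (𝔸 : Atoms.{u}) (N : ℕ) (l : List ℕ) : ℕ :=
  (cutVar :: nilVar :: varCodes N).foldr cExSO (cExFO firstVar (cExFO lastVar (cConj
    [cNeg (cExFO yVar (cLt yVar firstVar)), cNeg (cExFO yVar (cLt lastVar yVar)),
      Nat.pair 2 (Nat.pair cutVar (cWindow N l)),
      Nat.pair 2 (Nat.pair (Nat.pair 2 0) (cGlue 𝔸 N))])))

theorem code_runFormula (N : ℕ) (l : List (Formula S 𝔸)) :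
    (runFormula N l).code = cRunFormula 𝔸 N (l.map code) := by
  simp only [runFormula, cRunFormula, code_exSOs, code_conj', List.map_cons, List.map_nil,
    code_window, code_glue, code_eq_cNeg, code_eq_cExFO,
    code_eq_cLt, code_eq_segment]

section

variable {α : Type*} [Primcodable α]

@[fun_prop] theorem primrec_cOfRule {m k g s s' : α → ℕ} {init final : α → List ℕ}
    (hm : Primrec m) (hk : Primrec k) (hi : Primrec init) (hf : Primrec final) (hg : Primrec g)
    (hs : Primrec s) (hs' : Primrec s') :
    Primrec fun x => cOfRule (m x) (k x) (init x) (final x) (g x) (s x) (s' x) := by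
  unfold cOfRule
  have hk' : Primrec fun p : α × ℕ => k p.1 := hk.comp Primrec.fst
  have hs'' : Primrec fun p : α × ℕ => s' p.1 := hs'.comp Primrec.fst
  fun_prop

@[fun_prop] theorem primrec_cRunFormula {N : α → ℕ} {l : α → List ℕ}
    (hN : Primrec N) (hl : Primrec l) : Primrec fun x => cRunFormula 𝔸 (N x) (l x) := by
  have h1 : Primrec fun x => cWindow (N x) (l x) := by
    unfold cWindow
    fun_prop
  have h2 : Primrec fun x => cGlue 𝔸 (N x) := by
    unfold cGlue
    fun_prop
  unfold cRunFormula
  fun_prop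

end

end Formula

/-! ### Reduction of emptiness to satisfiability -/

section Reduction

variable [Encodable S]

open Formula

theorem exists_primrec_toSMSO : ∃ f : ℕ → ℕ, Primrec f ∧
    ∀ A : NRA S 𝔸, f A.code = A.toSMSO.code := by
  obtain ⟨g, hg, hg'⟩ := exists_primrec_ofConstraint (S := S) (𝔸 := 𝔸)
  let f : ℕ × ℕ × List ℕ × List ℕ × List ℕ → ℕ := fun b =>
    if (b.2.2.1.any fun q => b.2.2.2.1.contains q) = true then cVerum
    else cRunFormula 𝔸 (b.2.1 + b.1) (b.2.2.2.2.map fun t => cOfRule b.1 b.2.1 b.2.2.1 b.2.2.2.1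
      (g t.unpair.2.unpair.2.unpair.1) t.unpair.1 t.unpair.2.unpair.2.unpair.2)
  have hf : Primrec f := by
    have h : Primrec fun p : (ℕ × ℕ × List ℕ × List ℕ × List ℕ) × ℕ =>
        cOfRule p.1.1 p.1.2.1 p.1.2.2.1 p.1.2.2.2.1 (g p.2.unpair.2.unpair.2.unpair.1)
          p.2.unpair.1 p.2.unpair.2.unpair.2.unpair.2 := by fun_prop
    exact primrec_ite (by fun_prop) (by fun_prop) (primrec_cRunFormula (by fun_prop)
      (primrec_map (by fun_prop) h))
  refine ⟨fun c => f (c.unpair.1, c.unpair.2.unpair.1, decodeList c.unpair.2.unpair.2.unpair.1,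
    decodeList c.unpair.2.unpair.2.unpair.2.unpair.1,
    decodeList c.unpair.2.unpair.2.unpair.2.unpair.2), by fun_prop, fun A => ?_⟩
  simp only [NRA.code_eq, Nat.unpair_pair, decodeList_encodeList, f, SMSO.code, NRA.toSMSO,
    NRA.toFormula]
  split_ifs
  · rfl
  · rw [code_runFormula, List.map_map, List.map_map]
    refine congrArg _ (List.map_congr_left fun t _ => ?_)
    simp only [Function.comp, code_ofRule, Rule.code, hg', Nat.unpair_pair]

theorem emptinessDecidable_of_satisfiabilityDecidable
    (h : SatisfiabilityDecidable S 𝔸) : EmptinessDecidable S 𝔸 := by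
  obtain ⟨g, hg, hg'⟩ := h
  obtain ⟨f, hf, h⟩ := exists_primrec_toSMSO (S := S) (𝔸 := 𝔸)
  refine ⟨fun c => !g (f c), Primrec.not.to_comp.comp (hg.comp hf.to_comp), fun A => ?_⟩
  change (!g (f A.code)) = true ↔ A.language = ∅
  rw [h, ← not_iff_not, ← ne_eq, ← ne_eq, ← Set.nonempty_iff_ne_empty, ← A.language_toSMSO]
  exact Iff.trans (by simp) (hg' A.toSMSO)

end Reduction
end DataWords

namespace DataWords

/-! ### Reachability in finite graphs -/

section Closure

variable {α β : Type*} [DecidableEq β]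

/-- The elements of the list `l` that are reachable along `r` inside `l` from those satisfying
`i`. -/
def reachable (l : List β) (i : β → Bool) (r : β → β → Bool) : List β :=
  (fun t => l.filter fun y => t.contains y || t.any fun x => r x y)^[l.length] (l.filter i)

/-- The iterates form an increasing chain of sublists of `l`; until it becomes stationary each round
adds an entry, so `l.length` rounds reach a fixed point. -/
theorem mem_reachable (l : List β) (i : β → Bool) (r : β → β → Bool) (y : β) :
    y ∈ reachable l i r ↔ ∃ x ∈ l, i x = true ∧
      Relation.ReflTransGen (fun a b => b ∈ l ∧ r a b = true) x y := by
  set F : List β → List β := fun t => l.filter fun y => t.contains y || t.any fun x => r x y with hF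
  have memF : ∀ t y, y ∈ F t ↔ y ∈ l ∧ (y ∈ t ∨ ∃ x ∈ t, r x y = true) := by
    intro t y
    simp [hF]
  -- Being filters of the same list, iterates can be compared as sublists, and equal lengths then
  -- give equality.
  have hform : ∀ n, ∃ p : β → Bool, F^[n] (l.filter i) = l.filter p := by
    intro n
    cases n with
    | zero => exact ⟨i, rfl⟩
    | succ n => exact ⟨_, Function.iterate_succ_apply' F n _⟩
  have hsub : ∀ n, (F^[n] (l.filter i)).Sublist (F^[n + 1] (l.filter i)) := by
    intro n
    rw [Function.iterate_succ_apply']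
    obtain ⟨p, hp⟩ := hform n
    rw [hp]
    -- The extra disjunct `p y` makes the inclusion of predicates evident; it is redundant on
    -- elements of `l`.
    have : (l.filter p).Sublist (l.filter fun y =>
        ((l.filter p).contains y || (l.filter p).any fun x => r x y) || p y) :=
      List.monotone_filter_right l fun y hy => by simp [hy]
    have heq : (l.filter fun y => ((l.filter p).contains y || (l.filter p).any fun x => r x y) ||
        p y) = F (l.filter p) := List.filter_congr fun y hy => by cases h : p y <;> simp [hy, h]
    rwa [heq] at this
  have hle : ∀ n, (F^[n] (l.filter i)).length ≤ l.length := by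
    intro n
    obtain ⟨p, hp⟩ := hform n
    rw [hp]
    exact List.length_filter_le _ _
  have hstab : ∀ n, F^[n + 1] (l.filter i) = F^[n] (l.filter i) ∨
      n + 1 ≤ (F^[n + 1] (l.filter i)).length := by
    intro n
    induction n with
    | zero =>
      rcases (hsub 0).length_le.eq_or_lt with h | h
      · exact Or.inl ((hsub 0).eq_of_length h).symm
      · exact Or.inr (by omega)
    | succ n ih =>
      rcases ih with h | h
      · left
        rw [Function.iterate_succ_apply', h, ← Function.iterate_succ_apply' F, h]
      · rcases (hsub (n + 1)).length_le.eq_or_lt with h' | h'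
        · exact Or.inl ((hsub (n + 1)).eq_of_length h').symm
        · exact Or.inr (by omega)
  have hfix : F (reachable l i r) = reachable l i r := by
    change F (F^[l.length] (l.filter i)) = F^[l.length] (l.filter i)
    rw [← Function.iterate_succ_apply' F]
    rcases hstab l.length with h | h
    · exact h
    · have := hle (l.length + 1)
      omega
  have hmono : ∀ n, ∀ y ∈ F^[n] (l.filter i), ∃ x ∈ l, i x = true ∧
      Relation.ReflTransGen (fun a b => b ∈ l ∧ r a b = true) x y := by
    intro n
    induction n with
    | zero =>
      intro y hy
      obtain ⟨h1, h2⟩ := List.mem_filter.1 hy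
      exact ⟨y, h1, h2, Relation.ReflTransGen.refl⟩
    | succ n ih =>
      intro y hy
      rw [Function.iterate_succ_apply', memF] at hy
      obtain ⟨hy, h | ⟨x, hx, hxy⟩⟩ := hy
      · exact ih y h
      · obtain ⟨x', h1, h2, h3⟩ := ih x hx
        exact ⟨x', h1, h2, h3.tail ⟨hy, hxy⟩⟩
  have hinit : ∀ n, ∀ y ∈ l.filter i, y ∈ F^[n] (l.filter i) := by
    intro n
    induction n with
    | zero => exact fun y hy => hy
    | succ n ih => exact fun y hy => (hsub n).subset (ih y hy)
  constructor
  · exact hmono _ y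
  · rintro ⟨x, hx, hix, h⟩
    induction h with
    | refl => exact hinit _ x (List.mem_filter.2 ⟨hx, hix⟩)
    | tail _ h ih =>
      rw [← hfix, memF]
      exact ⟨h.1, Or.inr ⟨_, ih, h.2⟩⟩

@[fun_prop] theorem primrec_reachable [Primcodable α] [Primcodable β] {l : α → List β}
    {i : α → β → Bool} {r : α → β → β → Bool} (hl : Primrec l)
    (hi : Primrec fun p : α × β => i p.1 p.2)
    (hr : Primrec fun p : α × β × β => r p.1 p.2.1 p.2.2) :
    Primrec fun a => reachable (l a) (i a) (r a) := by
  unfold reachable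
  have hr' : Primrec fun p : ((α × List β) × β) × β => r p.1.1.1 p.2 p.1.2 :=
    hr.comp (g := fun p : ((α × List β) × β) × β => (p.1.1.1, p.2, p.1.2)) (by fun_prop)
  fun_prop

end Closure

/-- Lists of length `n` of numbers less than `b`. -/
def tuples (b n : ℕ) : List (List ℕ) :=
  (fun L => L.flatMap fun l => (List.range b).map fun v => v :: l)^[n] [[]]

theorem mem_tuples {b n : ℕ} {l : List ℕ} : l ∈ tuples b n ↔ l.length = n ∧ ∀ v ∈ l, v < b := by
  induction n generalizing l with
  | zero =>
    simp only [tuples, Function.iterate_zero, id, List.mem_singleton, List.length_eq_zero_iff]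
    constructor
    · rintro rfl
      simp
    · exact fun h => h.1
  | succ n ih =>
    rw [tuples, Function.iterate_succ_apply', ← tuples]
    simp only [List.mem_flatMap, List.mem_map, List.mem_range]
    constructor
    · rintro ⟨l, hl, v, hv, rfl⟩
      obtain ⟨h1, h2⟩ := ih.1 hl
      simpa [h1, hv] using h2
    · rintro ⟨h1, h2⟩
      cases l with
      | nil => simp at h1
      | cons v l =>
        refine ⟨l, ih.2 ⟨by simpa using h1, fun v hv => h2 v (by simp [hv])⟩, v, h2 v (by simp), rfl⟩

@[fun_prop] theorem primrec_tuples {α : Type*} [Primcodable α] {f g : α → ℕ} (hf : Primrec f)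
    (hg : Primrec g) : Primrec fun x => tuples (f x) (g x) := by
  unfold tuples
  fun_prop

/-! ### Order patterns -/

section Pattern

variable {U V W : Type*}

/-- The numbers `p` describe the order type of the values `ν`, where `0` stands for an undefined
value. -/
def Pattern (e : U → ℚ) (ν : V → Option U) (p : V → ℕ) : Prop :=
  (∀ v, ν v = none ↔ p v = 0) ∧
    ∀ v w a b, ν v = some a → ν w = some b → (e a < e b ↔ p v < p w)

/-- The number assigned to a value is one more than the number of smaller values, which leaves `0`
for undefined ones. -/
theorem exists_pattern [Fintype V] (e : U → ℚ) (ν : V → Option U) :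
    ∃ p, Pattern e ν p ∧ ∀ v, p v ≤ Fintype.card V := by
  classical
  -- The default may add a spurious value, but comparisons of ranks are unaffected and the bound by
  -- the number of variables already counts it.
  let f : V → ℚ := fun v => (ν v).elim 0 e
  let vals : Finset ℚ := Finset.univ.image f
  have hmem : ∀ v a, ν v = some a → e a ∈ vals := fun v a h =>
    Finset.mem_image.2 ⟨v, Finset.mem_univ _, by simp [f, h]⟩
  have hlt : ∀ v a, ν v = some a → (vals.filter (· < e a)).card < vals.card := fun v a h =>
    Finset.card_lt_card (Finset.filter_ssubset.2 ⟨_, hmem v a h, lt_irrefl _⟩)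
  refine ⟨fun v => (ν v).elim 0 fun a => (vals.filter (· < e a)).card + 1, ⟨fun v => ?_, ?_⟩,
    fun v => ?_⟩
  · cases h : ν v <;> simp [h]
  · intro v w a b hv hw
    simp only [hv, hw, Option.elim_some, Nat.add_lt_add_iff_right]
    constructor
    · intro hab
      refine Finset.card_lt_card ⟨?_, ?_⟩
      · intro x hx
        simp only [Finset.mem_filter] at hx ⊢
        exact ⟨hx.1, hx.2.trans hab⟩
      · intro hsub
        have := hsub (Finset.mem_filter.2 ⟨hmem v a hv, hab⟩)
        simp at this
    · intro h
      by_contra hba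
      refine absurd h (not_lt.2 (Finset.card_le_card fun x hx => ?_))
      simp only [Finset.mem_filter] at hx ⊢
      exact ⟨hx.1, hx.2.trans_le (not_lt.1 hba)⟩
  · cases h : ν v with
    | none => simp [h]
    | some a =>
      have := hlt v a h
      have h' : vals.card ≤ Fintype.card V := Finset.card_image_le
      simp only [h, Option.elim_some]
      omega

/-- Points are added one at a time; `ℚ` is dense without endpoints, so there is always a value
between those of the smaller and those of the larger points. -/
theorem exists_strictMonoOn_extension (A B : Finset ℕ) (g : ℕ → ℚ) (hg : StrictMonoOn g A) :
    ∃ g' : ℕ → ℚ, StrictMonoOn g' (A ∪ B : Finset ℕ) ∧ ∀ n ∈ A, g' n = g n := by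
  classical
  induction B using Finset.induction_on with
  | empty => exact ⟨g, by simpa using hg, fun _ _ => rfl⟩
  | insert n B _ ih =>
    obtain ⟨g', h1, h2⟩ := ih
    by_cases hn : n ∈ A ∪ B
    · refine ⟨g', ?_, h2⟩
      rwa [Finset.union_insert, Finset.insert_eq_of_mem hn]
    · obtain ⟨q, hq1, hq2⟩ := Order.exists_between_finsets
        (((A ∪ B).filter (· < n)).image g') (((A ∪ B).filter (n < ·)).image g') (by
          intro x hx y hy
          simp only [Finset.mem_image, Finset.mem_filter] at hx hy
          obtain ⟨a, ⟨ha, han⟩, rfl⟩ := hx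
          obtain ⟨b, ⟨hb, hbn⟩, rfl⟩ := hy
          exact h1 ha hb (han.trans hbn))
      have hne : ∀ a ∈ A ∪ B, a ≠ n := fun a ha h => hn (h ▸ ha)
      refine ⟨Function.update g' n q, ?_, fun a ha => ?_⟩
      · rw [Finset.union_insert]
        intro a ha b hb hab
        rcases Finset.mem_insert.1 ha with rfl | ha'
        · rcases Finset.mem_insert.1 hb with rfl | hb'
          · exact absurd hab (lt_irrefl _)
          · rw [Function.update_self, Function.update_of_ne (hne b hb')]
            exact hq2 _ (Finset.mem_image_of_mem _ (Finset.mem_filter.2 ⟨hb', hab⟩))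
        · rcases Finset.mem_insert.1 hb with rfl | hb'
          · rw [Function.update_self, Function.update_of_ne (hne a ha')]
            exact hq1 _ (Finset.mem_image_of_mem _ (Finset.mem_filter.2 ⟨ha', hab⟩))
          · rw [Function.update_of_ne (hne a ha'), Function.update_of_ne (hne b hb')]
            exact h1 ha' hb' hab
      · rw [Function.update_of_ne (hne a (Finset.mem_union_left _ ha)), h2 a ha]

/-- Values with a given order pattern on some indices extend to all indices. -/
theorem Pattern.exists_extension [Fintype V] [Fintype W] (e : U ≃ ℚ) {ν : W → Option U} {i : W → V}
    {p : V → ℕ} (h : Pattern e ν fun w => p (i w)) :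
    ∃ ν' : V → Option U, (∀ w, ν' (i w) = ν w) ∧ Pattern e ν' p := by
  classical
  obtain ⟨h0, h1⟩ := h
  have heq : ∀ v w a b, ν v = some a → ν w = some b → p (i v) = p (i w) → a = b := by
    intro v w a b hv hw hp
    have h2 := h1 v w a b hv hw
    have h3 := h1 w v b a hw hv
    dsimp only at h2 h3
    refine e.injective (le_antisymm (not_lt.1 fun h => ?_) (not_lt.1 fun h => ?_))
    · have := h3.1 h
      omega
    · have := h2.1 h
      omega
  -- The partial map from ranks to values given by `ν`; by `heq` the choices do not matter. It is
  -- strictly increasing on the nonzero ranks in use, and its extension to all ranks of `p` defines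
  -- the new values.
  let g : ℕ → ℚ := fun n => if h : ∃ w a, p (i w) = n ∧ ν w = some a then e h.choose_spec.choose
    else 0
  have hg : ∀ w a, ν w = some a → g (p (i w)) = e a := by
    intro w a hw
    have h : ∃ w' a, p (i w') = p (i w) ∧ ν w' = some a := ⟨w, a, rfl, hw⟩
    simp only [g, dif_pos h]
    obtain ⟨h2, h3⟩ := h.choose_spec.choose_spec
    rw [heq _ _ _ _ h3 hw h2]
  let A : Finset ℕ := (Finset.univ.image fun w => p (i w)).filter (· ≠ 0)
  have hA : ∀ n ∈ A, ∃ w a, p (i w) = n ∧ ν w = some a := by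
    intro n hn
    obtain ⟨hn, hn0⟩ := Finset.mem_filter.1 hn
    obtain ⟨w, -, rfl⟩ := Finset.mem_image.1 hn
    obtain ⟨a, ha⟩ := Option.ne_none_iff_exists'.1 (mt (h0 w).1 hn0)
    exact ⟨w, a, rfl, ha⟩
  have hmono : StrictMonoOn g A := by
    intro m hm n hn hmn
    obtain ⟨w, a, rfl, ha⟩ := hA m hm
    obtain ⟨w', a', rfl, ha'⟩ := hA n hn
    rw [hg w a ha, hg w' a' ha']
    exact (h1 w w' a a' ha ha').2 hmn
  obtain ⟨g', h2, h3⟩ := exists_strictMonoOn_extension A (Finset.univ.image p) g hmono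
  have hp : ∀ v, p v ∈ A ∪ Finset.univ.image p := fun v =>
    Finset.mem_union_right _ (Finset.mem_image_of_mem _ (Finset.mem_univ _))
  refine ⟨fun v => if p v = 0 then none else some (e.symm (g' (p v))), fun w => ?_, fun v => ?_, ?_⟩
  · by_cases hw : p (i w) = 0
    · simp only [if_pos hw, (h0 w).2 hw]
    · obtain ⟨a, ha⟩ := Option.ne_none_iff_exists'.1 (mt (h0 w).1 hw)
      have hwA : p (i w) ∈ A :=
        Finset.mem_filter.2 ⟨Finset.mem_image_of_mem _ (Finset.mem_univ _), hw⟩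
      simp only [if_neg hw, h3 _ hwA, hg w a ha, ha, Equiv.symm_apply_apply]
  · by_cases hv : p v = 0 <;> simp [hv]
  · intro v w a b hv hw
    by_cases hv0 : p v = 0
    · simp [hv0] at hv
    by_cases hw0 : p w = 0
    · simp [hw0] at hw
    simp only [if_neg hv0, if_neg hw0, Option.some_inj] at hv hw
    rw [← hv, ← hw, Equiv.apply_symm_apply, Equiv.apply_symm_apply]
    exact h2.lt_iff_lt (hp v) (hp w)

end Pattern
end DataWords

/-! ### Constraints over atoms determined by order types -/

namespace DataWords

variable {S : Type} {𝔸 : Atoms.{u}}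

/-- The relations of `𝔸` only depend on the order type of the images of their arguments under `e`,
and they are computed by `relN` for arguments given by numbers. -/
def Atoms.OrderDetermined (𝔸 : Atoms.{u}) (e : 𝔸.U → ℚ) (relN : ℕ × List ℕ → Bool) : Prop :=
  ∀ (R : Fin 𝔸.numRel) (d : Fin (𝔸.arity R) → 𝔸.U) (p : Fin (𝔸.arity R) → ℕ),
    (∀ i j, e (d i) < e (d j) ↔ p i < p j) → (𝔸.rel R d ↔ relN (R, List.ofFn p) = true)

/-- Truth of a constraint for values with order pattern `p`. -/
def Constraint.evalRank {V : Type} (relN : ℕ × List ℕ → Bool) (p : V → ℕ) : Constraint 𝔸 V → Bool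
  | .top => true
  | .neg Φ => !Φ.evalRank relN p
  | .and Φ Ψ => Φ.evalRank relN p && Ψ.evalRank relN p
  | .rel R x => ((List.ofFn fun j => p (x j)).all fun v => !(v == 0)) &&
      relN (R, List.ofFn fun j => p (x j))
  | .isNil x => p x == 0

theorem Pattern.holds_iff {V : Type} {e : 𝔸.U → ℚ} {relN : ℕ × List ℕ → Bool}
    (h𝔸 : 𝔸.OrderDetermined e relN) {ν : V → Option 𝔸.U} {p : V → ℕ} (h : Pattern e ν p)
    (Φ : Constraint 𝔸 V) : Φ.Holds ν ↔ Φ.evalRank relN p = true := by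
  induction Φ with
  | top => simp [Constraint.Holds, Constraint.evalRank]
  | neg Φ ih => simp [Constraint.Holds, Constraint.evalRank, ih]
  | and Φ Ψ ih1 ih2 => simp [Constraint.Holds, Constraint.evalRank, ih1, ih2]
  | rel R x =>
    have key : ∀ d : Fin (𝔸.arity R) → 𝔸.U, (∀ j, ν (x j) = some (d j)) →
        (𝔸.rel R d ↔ relN (R, List.ofFn fun j => p (x j)) = true) := fun d hd =>
      h𝔸 R d _ fun i j => h.2 _ _ _ _ (hd i) (hd j)
    simp only [Constraint.Holds, Constraint.evalRank, Bool.and_eq_true, List.all_eq_true,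
      List.mem_ofFn, forall_exists_index, forall_apply_eq_imp_iff, Bool.not_eq_true',
      beq_eq_false_iff_ne, ne_eq, ← h.1]
    constructor
    · rintro ⟨d, hd, hr⟩
      exact ⟨fun j => by simp [hd], (key d hd).1 hr⟩
    · rintro ⟨h1, h2⟩
      choose d hd using fun j => Option.ne_none_iff_exists'.1 (h1 j)
      exact ⟨d, hd, (key d hd).2 h2⟩
  | isNil x => simp [Constraint.Holds, Constraint.evalRank, h.1]

/-- The order pattern of the values involved in a transition. -/
def rankVal {k : ℕ} (P P' : List ℕ) (c : ℕ) : RegVar k → ℕ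
  | .pre r => P.getD r 0
  | .post r => P'.getD r 0
  | .cur => c

/-- The order pattern of the values involved in a transition, for codes of variables. -/
def rankCode (P P' : List ℕ) (c v : ℕ) : ℕ :=
  if v.unpair.1 = 0 then P.getD v.unpair.2 0
  else if v.unpair.1 = 1 then P'.getD v.unpair.2 0 else c

@[fun_prop] theorem primrec_rankCode {α : Type*} [Primcodable α] {P P' : α → List ℕ} {c v : α → ℕ}
    (hP : Primrec P) (hP' : Primrec P') (hc : Primrec c) (hv : Primrec v) :
    Primrec fun x => rankCode (P x) (P' x) (c x) (v x) := by
  unfold rankCode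
  fun_prop

theorem rankCode_code {k : ℕ} (P P' : List ℕ) (c : ℕ) (v : RegVar k) :
    rankCode P P' c v.code = rankVal P P' c v := by
  cases v <;> simp [rankCode, rankVal, RegVar.code]

theorem exists_primrec_evalRank {relN : ℕ × List ℕ → Bool} (hr : Primrec relN) :
    ∃ f : ℕ × List ℕ × List ℕ × ℕ → Bool, Primrec f ∧
      ∀ (k : ℕ) (Φ : Constraint 𝔸 (RegVar k)) P P' c,
        f (Φ.code, P, P', c) = Φ.evalRank relN (rankVal P P' c) := by
  obtain ⟨f, hf, h⟩ := exists_primrec_rec (m := fun b : ℕ × List ℕ × List ℕ × ℕ => b.1)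
    (l := fun b => if b.1.unpair.1 = 1 then [(b.1.unpair.2, b.2)] else
      if b.1.unpair.1 = 2 then
        [(b.1.unpair.2.unpair.1, b.2), (b.1.unpair.2.unpair.2, b.2)] else [])
    (g := fun b (r : List Bool) => if b.1.unpair.1 = 0 then true
      else if b.1.unpair.1 = 1 then !(r.getD 0 false)
      else if b.1.unpair.1 = 2 then (r.getD 0 false) && (r.getD 1 false)
      else if b.1.unpair.1 = 3 then
        ((decodeList b.1.unpair.2.unpair.2).all fun v => !(rankCode b.2.1 b.2.2.1 b.2.2.2 v == 0)) &&
          relN (b.1.unpair.2.unpair.1, (decodeList b.1.unpair.2.unpair.2).map fun v =>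
            rankCode b.2.1 b.2.2.1 b.2.2.2 v)
      else rankCode b.2.1 b.2.2.1 b.2.2.2 b.1.unpair.2 == 0)
    (by fun_prop) (by fun_prop) (by fun_prop)
  refine ⟨f, hf, fun k Φ P P' c => ?_⟩
  induction Φ with
  | top =>
    rw [h]
    · simp [Constraint.code, Constraint.evalRank]
    · clear h
      simp [Constraint.code]
  | neg Φ ih =>
    have := lt_natPair_succ 0 Φ.code
    rw [h]
    · simp [Constraint.code, Constraint.evalRank, ih]
    · clear h
      simp_all [Constraint.code]
  | and Φ Ψ ih1 ih2 =>
    have h1 : Φ.code < Nat.pair 2 (Nat.pair Φ.code Ψ.code) :=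
      (Nat.left_le_pair _ _).trans_lt (lt_natPair_succ 1 _)
    have h2 : Ψ.code < Nat.pair 2 (Nat.pair Φ.code Ψ.code) :=
      (Nat.right_le_pair _ _).trans_lt (lt_natPair_succ 1 _)
    rw [h]
    · simp [Constraint.code, Constraint.evalRank, ih1, ih2]
    · clear h
      simp_all [Constraint.code]
  | rel R x =>
    have hx : decodeList (Encodable.encode (List.ofFn fun j => (x j).code)) =
        List.ofFn fun j => (x j).code := decodeList_encodeList _
    have hx' : (List.ofFn fun j => (x j).code).map (rankCode P P' c) =
        List.ofFn fun j => rankVal P P' c (x j) := by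
      simp [List.map_ofFn, Function.comp_def, rankCode_code]
    rw [h]
    · simp only [Constraint.code, Constraint.evalRank, Nat.unpair_pair, hx, ← hx', List.all_map]
      simp [Function.comp_def]
    · clear h
      simp [Constraint.code]
  | isNil x =>
    rw [h]
    · simp [Constraint.code, Constraint.evalRank, rankCode_code]
    · clear h
      simp [Constraint.code]

/-- The first `k` entries of two lists have the same order pattern. -/
def samePattern (k : ℕ) (P P' : List ℕ) : Bool :=
  (List.range k).all fun i => ((P.getD i 0 == 0) == (P'.getD i 0 == 0)) &&
    (List.range k).all fun j =>
      (decide (P.getD i 0 < P.getD j 0) == decide (P'.getD i 0 < P'.getD j 0))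

theorem samePattern_iff (k : ℕ) (P P' : List ℕ) : samePattern k P P' = true ↔
    ∀ i : Fin k, (P.getD i 0 = 0 ↔ P'.getD i 0 = 0) ∧
      ∀ j : Fin k, P.getD i 0 < P.getD j 0 ↔ P'.getD i 0 < P'.getD j 0 := by
  have h : ∀ a b : ℕ, ((a == 0) == (b == 0)) = true ↔ (a = 0 ↔ b = 0) := fun a b => by
    by_cases ha : a = 0 <;> by_cases hb : b = 0 <;> simp [ha, hb]
  simp only [samePattern, List.all_eq_true, List.mem_range, Bool.and_eq_true, h]
  simp only [beq_iff_eq, decide_eq_decide]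
  constructor
  · exact fun h i => ⟨(h i i.2).1, fun j => (h i i.2).2 j j.2⟩
  · exact fun h i hi => ⟨(h ⟨i, hi⟩).1, fun j hj => (h ⟨i, hi⟩).2 ⟨j, hj⟩⟩

/-- Rank lists of the same contents need not be equal, since ranks may leave gaps; this says when
two lists describe the same contents. -/
theorem Pattern.samePattern_iff {U : Type*} {e : U → ℚ} {k : ℕ} {μ : Fin k → Option U}
    {P P' : List ℕ} (h : Pattern e μ fun r => P.getD r 0) :
    (Pattern e μ fun r => P'.getD r 0) ↔ samePattern k P P' = true := by
  rw [DataWords.samePattern_iff]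
  constructor
  · intro h' i
    refine ⟨(h.1 i).symm.trans (h'.1 i), fun j => ?_⟩
    have h0 := h.1 i
    have h0' := h'.1 i
    have h1 := h.1 j
    have h1' := h'.1 j
    dsimp only at h0 h0' h1 h1'
    cases hi : μ i with
    -- A pattern constrains order only between defined values; here rank `0` lies below the ranks of
    -- all of them.
    | none =>
      rw [h0.1 hi, h0'.1 hi]
      cases hj : μ j with
      | none => rw [h1.1 hj, h1'.1 hj]
      | some b =>
        have := mt h1.2 (by simp [hj])
        have := mt h1'.2 (by simp [hj])
        omega
    | some a =>
      cases hj : μ j with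
      | none => rw [h1.1 hj, h1'.1 hj]; simp
      | some b => exact (h.2 i j a b hi hj).symm.trans (h'.2 i j a b hi hj)
  · intro h'
    exact ⟨fun i => (h.1 i).trans (h' i).1, fun i j a b hi hj =>
      (h.2 i j a b hi hj).trans ((h' i).2 j)⟩

/-- Register variables as a sum type. -/
def regVarEquiv (k : ℕ) : RegVar k ≃ Fin k ⊕ Fin k ⊕ Unit where
  toFun
    | .pre r => .inl r
    | .post r => .inr (.inl r)
    | .cur => .inr (.inr ())
  invFun
    | .inl r => .pre r
    | .inr (.inl r) => .post r
    | .inr (.inr _) => .cur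
  left_inv v := by cases v <;> rfl
  right_inv v := by rcases v with r | r | r <;> rfl

instance (k : ℕ) : Fintype (RegVar k) := Fintype.ofEquiv _ (regVarEquiv k).symm

theorem card_regVar (k : ℕ) : Fintype.card (RegVar k) = 2 * k + 1 := by
  rw [Fintype.card_congr (regVarEquiv k)]
  simp
  omega

/-! ### The graph of abstract configurations -/

/-- Data of an automaton: numbers of states and registers, initial and accepting states, codes of
rules. -/
abbrev NRAData : Type := ℕ × ℕ × List ℕ × List ℕ × List ℕ

/-- Abstract configurations. -/
def graphNodes (b : NRAData) : List (ℕ × List ℕ) :=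
  (List.range b.1).flatMap fun q => (tuples (2 * b.2.1 + 2) b.2.1).map fun P => (q, P)

/-- Initial abstract configurations. -/
def graphInit (b : NRAData) (x : ℕ × List ℕ) : Bool :=
  b.2.2.1.contains x.1 && x.2.all fun v => v == 0

/-- Steps between abstract configurations. -/
def graphEdge (f : ℕ × List ℕ × List ℕ × ℕ → Bool) (b : NRAData) (x y : ℕ × List ℕ) : Bool :=
  b.2.2.2.2.any fun t => (t.unpair.1 == x.1) && ((t.unpair.2.unpair.2.unpair.2 == y.1) &&
    ((List.range (2 * b.2.1 + 2)).any fun c => !(c == 0) &&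
      ((tuples (2 * b.2.1 + 2) b.2.1).any fun P' => samePattern b.2.1 P' y.2 &&
        f (t.unpair.2.unpair.2.unpair.1, x.2, P', c))))

/-- Some accepting abstract configuration is reachable. -/
def graphAccepts (f : ℕ × List ℕ × List ℕ × ℕ → Bool) (b : NRAData) : Bool :=
  (reachable (graphNodes b) (graphInit b) (graphEdge f b)).any fun x => b.2.2.2.1.contains x.1

theorem primrec_graphAccepts {f : ℕ × List ℕ × List ℕ × ℕ → Bool} (hf : Primrec f) :
    Primrec (graphAccepts f) := by
  have h1 : Primrec graphNodes := by
    unfold graphNodes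
    fun_prop
  have h2 : Primrec fun p : NRAData × ℕ × List ℕ => graphInit p.1 p.2 := by
    unfold graphInit
    fun_prop
  have h3 : Primrec fun p : ℕ × List ℕ × List ℕ => samePattern p.1 p.2.1 p.2.2 := by
    unfold samePattern
    fun_prop
  have h4 : Primrec fun p : NRAData × (ℕ × List ℕ) × ℕ × List ℕ => graphEdge f p.1 p.2.1 p.2.2 := by
    unfold graphEdge
    have h5 : Primrec fun p : (((NRAData × (ℕ × List ℕ) × ℕ × List ℕ) × ℕ) × ℕ) × List ℕ =>
        samePattern p.1.1.1.1.2.1 p.2 p.1.1.1.2.2.2 :=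
      h3.comp (g := fun p : (((NRAData × (ℕ × List ℕ) × ℕ × List ℕ) × ℕ) × ℕ) × List ℕ =>
        (p.1.1.1.1.2.1, p.2, p.1.1.1.2.2.2)) (by fun_prop)
    fun_prop
  unfold graphAccepts
  fun_prop

namespace NRA

/-- The data of an automaton. -/
def data [Encodable S] (A : NRA S 𝔸) : NRAData :=
  (A.numStates, A.numRegs, A.init.map Fin.val, A.final.map Fin.val, A.rules.map Rule.code)

theorem graphEdge_iff [Encodable S] (A : NRA S 𝔸) {relN : ℕ × List ℕ → Bool}
    {f : ℕ × List ℕ × List ℕ × ℕ → Bool}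
    (hf : ∀ (k : ℕ) (Φ : Constraint 𝔸 (RegVar k)) P P' c,
        f (Φ.code, P, P', c) = Φ.evalRank relN (rankVal P P' c)) (x y : ℕ × List ℕ) :
    graphEdge f A.data x y = true ↔ ∃ t ∈ A.rules, t.source = x.1 ∧ t.target = y.1 ∧
      ∃ c < 2 * A.numRegs + 2, c ≠ 0 ∧ ∃ P' ∈ tuples (2 * A.numRegs + 2) A.numRegs,
        samePattern A.numRegs P' y.2 = true ∧
          t.guard.evalRank relN (rankVal x.2 P' c) = true := by
  simp only [graphEdge, data, List.any_eq_true, List.mem_map, exists_exists_and_eq_and, Rule.code,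
    Nat.unpair_pair, Bool.and_eq_true, beq_iff_eq, List.mem_range, Bool.not_eq_true',
    beq_eq_false_iff_ne, hf]

/-- A concrete step projects to an edge by ranking its values jointly. An edge lifts to a step from
any contents of the right pattern, by extension of patterns. A step involves `2 * A.numRegs + 1`
variables, so ranks below `2 * A.numRegs + 2` suffice. -/
theorem language_nonempty_iff_graphAccepts [Encodable S] (A : NRA S 𝔸) (e : 𝔸.U ≃ ℚ)
    {relN : ℕ × List ℕ → Bool} (h𝔸 : 𝔸.OrderDetermined e relN)
    {f : ℕ × List ℕ × List ℕ × ℕ → Bool}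
    (hf : ∀ (k : ℕ) (Φ : Constraint 𝔸 (RegVar k)) P P' c,
        f (Φ.code, P, P', c) = Φ.evalRank relN (rankVal P P' c)) :
    A.language.Nonempty ↔ graphAccepts f A.data = true := by
  have hnodes : ∀ x : ℕ × List ℕ, x ∈ graphNodes A.data ↔
      x.1 < A.numStates ∧ x.2 ∈ tuples (2 * A.numRegs + 2) A.numRegs := by
    rintro ⟨q, P⟩
    simp [graphNodes, data]
  have hinit : ∀ x : ℕ × List ℕ, graphInit A.data x = true ↔
      (∃ q ∈ A.init, (q : ℕ) = x.1) ∧ ∀ v ∈ x.2, v = 0 := by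
    rintro ⟨q, P⟩
    simp [graphInit, data]
  have hfinal : ∀ x : ℕ × List ℕ, A.data.2.2.2.1.contains x.1 = true ↔
      ∃ q ∈ A.final, (q : ℕ) = x.1 := by
    rintro ⟨q, P⟩
    simp [data]
  rw [language_nonempty_iff, graphAccepts, List.any_eq_true]
  simp only [mem_reachable, hfinal]
  constructor
  · rintro ⟨q₀, hq₀, c, hc, hreach⟩
    -- All rank lists of the configuration are covered, because the next step determines which one
    -- it needs: the restriction of its joint ranking.
    have key : ∀ P ∈ tuples (2 * A.numRegs + 2) A.numRegs, (Pattern e c.2 fun r => P.getD r 0) →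
        ∃ x ∈ graphNodes A.data, graphInit A.data x = true ∧
          Relation.ReflTransGen (fun a b => b ∈ graphNodes A.data ∧ graphEdge f A.data a b = true)
            x ((c.1 : ℕ), P) := by
      clear hc
      induction hreach with
      | refl =>
        intro P hP hpat
        refine ⟨((q₀ : ℕ), P), (hnodes _).2 ⟨q₀.2, hP⟩, (hinit _).2 ⟨⟨q₀, hq₀, rfl⟩, ?_⟩,
          Relation.ReflTransGen.refl⟩
        intro v hv
        obtain ⟨i, hi, rfl⟩ := List.mem_iff_getElem.1 hv
        have hi' : i < A.numRegs := by
          have h := (mem_tuples.1 hP).1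
          dsimp only at hi
          omega
        have := (hpat.1 ⟨i, hi'⟩).1 rfl
        simpa [hi] using this
      | @tail c c' _ hstep ih =>
        intro P hP hpat
        obtain ⟨l, t, ht, ht1, ht2, ht3, ht4⟩ := hstep
        obtain ⟨p, hp, hple⟩ := exists_pattern e (combine c.2 l.2 c'.2)
        rw [card_regVar] at hple
        let P₁ : List ℕ := List.ofFn fun r => p (.pre r)
        let P₂ : List ℕ := List.ofFn fun r => p (.post r)
        have hP₁ : P₁ ∈ tuples (2 * A.numRegs + 2) A.numRegs := by
          refine mem_tuples.2 ⟨by simp [P₁], fun v hv => ?_⟩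
          obtain ⟨r, rfl⟩ := List.mem_ofFn.1 hv
          exact Nat.lt_succ_of_le (hple _)
        have hP₂ : P₂ ∈ tuples (2 * A.numRegs + 2) A.numRegs := by
          refine mem_tuples.2 ⟨by simp [P₂], fun v hv => ?_⟩
          obtain ⟨r, rfl⟩ := List.mem_ofFn.1 hv
          exact Nat.lt_succ_of_le (hple _)
        have e₁ : ∀ r : Fin A.numRegs, P₁.getD r 0 = p (.pre r) := fun r => by simp [P₁]
        have e₂ : ∀ r : Fin A.numRegs, P₂.getD r 0 = p (.post r) := fun r => by simp [P₂]
        have hpre : Pattern e c.2 fun r => P₁.getD r 0 := by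
          simp only [e₁]
          exact ⟨fun r => hp.1 (.pre r), fun r s => hp.2 (.pre r) (.pre s)⟩
        have hpost : Pattern e c'.2 fun r => P₂.getD r 0 := by
          simp only [e₂]
          exact ⟨fun r => hp.1 (.post r), fun r s => hp.2 (.post r) (.post s)⟩
        have hrank : rankVal P₁ P₂ (p .cur) = p := by
          funext v
          rcases v with r | r | _
          · exact e₁ r
          · exact e₂ r
          · rfl
        obtain ⟨x, hx, hix, hxy⟩ := ih P₁ hP₁ hpre
        refine ⟨x, hx, hix, hxy.tail ⟨(hnodes _).2 ⟨c'.1.2, hP⟩, (A.graphEdge_iff hf _ _).2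
          ⟨t, ht, congrArg _ ht1, congrArg _ ht3, p .cur, Nat.lt_succ_of_le (hple _), ?_, P₂, hP₂,
            hpost.samePattern_iff.1 hpat, ?_⟩⟩⟩
        · exact fun h => Option.some_ne_none _ ((hp.1 .cur).2 h)
        · dsimp only
          rw [hrank]
          exact (hp.holds_iff h𝔸 _).1 ht4
    obtain ⟨p, hp, hple⟩ := exists_pattern e c.2
    rw [Fintype.card_fin] at hple
    have hP : List.ofFn p ∈ tuples (2 * A.numRegs + 2) A.numRegs := by
      refine mem_tuples.2 ⟨by simp, fun v hv => ?_⟩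
      obtain ⟨r, rfl⟩ := List.mem_ofFn.1 hv
      have := hple r
      omega
    exact ⟨_, key _ hP (by simpa using hp), c.1, hc, rfl⟩
  · rintro ⟨y, ⟨x, hx, hix, hreach⟩, qf, hqf, hqy⟩
    obtain ⟨⟨q₀, hq₀, hqx⟩, hx0⟩ := (hinit x).1 hix
    -- Each reachable node is realised by some reachable configuration; the contents `μ` of the
    -- predecessor stay fixed while the input value and the new contents are found by extension.
    have key : ∃ q : Fin A.numStates, (q : ℕ) = y.1 ∧ ∃ μ : Fin A.numRegs → Option 𝔸.U,
        A.Reach (q₀, fun _ => none) (q, μ) ∧ Pattern e μ fun r => y.2.getD r 0 := by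
      clear hqy hqf
      induction hreach with
      | refl =>
        refine ⟨q₀, hqx, _, Relation.ReflTransGen.refl, fun r => ?_, by simp⟩
        have hr : (r : ℕ) < x.2.length := by
          rw [(mem_tuples.1 ((hnodes x).1 hx).2).1]
          exact r.2
        simp [hr, hx0 _ (List.getElem_mem hr)]
      | @tail y z _ hstep ih =>
        obtain ⟨q, hq, μ, hμ, hpat⟩ := ih
        obtain ⟨t, ht, ht1, ht2, c, hc, hc0, P', hP', hsame, hev⟩ :=
          (A.graphEdge_iff hf y z).1 hstep.2
        obtain ⟨ν, hν, hpatν⟩ := Pattern.exists_extension (i := RegVar.pre) (p := rankVal y.2 P' c)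
          e hpat
        obtain ⟨u, hu⟩ := Option.ne_none_iff_exists'.1 (mt (hpatν.1 .cur).1 hc0)
        refine ⟨t.target, ht2, fun r => ν (.post r), hμ.tail ⟨(t.letter, u), t, ht, ?_, rfl, rfl, ?_⟩,
          ?_⟩
        · exact Fin.ext (ht1.trans hq.symm)
        · have hcomb : combine μ u (fun r => ν (.post r)) = ν := by
            funext v
            rcases v with r | r | _
            · exact (hν r).symm
            · rfl
            · exact hu.symm
          change t.guard.Holds (combine μ u fun r => ν (.post r))
          rw [hcomb]
          exact (hpatν.holds_iff h𝔸 _).2 hev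
        · have hpost : Pattern e (fun r => ν (.post r)) fun r : Fin A.numRegs => P'.getD r 0 :=
            ⟨fun r => hpatν.1 (.post r), fun r s => hpatν.2 (.post r) (.post s)⟩
          exact hpost.samePattern_iff.2 hsame
    obtain ⟨q, hq, μ, hμ, -⟩ := key
    obtain rfl : q = qf := Fin.ext (hq.trans hqy.symm)
    exact ⟨q₀, hq₀, _, hqf, hμ⟩

end NRA

/-- The bijection enters only the correctness proof; the procedure itself evaluates guards with
`relN`. -/
theorem emptinessDecidable_of_orderDetermined [Encodable S] (e : 𝔸.U ≃ ℚ)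
    {relN : ℕ × List ℕ → Bool} (hr : Primrec relN) (h𝔸 : 𝔸.OrderDetermined e relN) :
    EmptinessDecidable S 𝔸 := by
  obtain ⟨f, hf, hf'⟩ := exists_primrec_evalRank (𝔸 := 𝔸) hr
  have hg := primrec_graphAccepts hf
  refine ⟨fun c => !graphAccepts f (c.unpair.1, c.unpair.2.unpair.1,
    decodeList c.unpair.2.unpair.2.unpair.1, decodeList c.unpair.2.unpair.2.unpair.2.unpair.1,
    decodeList c.unpair.2.unpair.2.unpair.2.unpair.2), Primrec.to_comp (by fun_prop), fun A => ?_⟩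
  have h := A.language_nonempty_iff_graphAccepts e h𝔸 hf'
  simp only [NRA.code_eq, Nat.unpair_pair, decodeList_encodeList]
  rw [← Set.not_nonempty_iff_eq_empty, h]
  simp [NRA.data]

end DataWords

/-! ### The equivalence and the two concrete structures -/

namespace DataWords

theorem satisfiabilityDecidable_iff_emptinessDecidable (𝔸 : Atoms.{u}) (S : Type) [Finite S]
    [Encodable S] : SatisfiabilityDecidable S 𝔸 ↔ EmptinessDecidable S 𝔸 :=
  ⟨emptinessDecidable_of_satisfiabilityDecidable, satisfiabilityDecidable_of_emptinessDecidable⟩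

theorem emptinessDecidable_equalityAtoms (S : Type) [Encodable S] :
    EmptinessDecidable S equalityAtoms := by
  -- Any bijection will do: equality is the absence of strict inequality in both directions.
  obtain ⟨e⟩ : Nonempty (ℕ ≃ ℚ) := inferInstance
  refine emptinessDecidable_of_orderDetermined (𝔸 := equalityAtoms) e
    (relN := fun b => b.2.getD 0 0 == b.2.getD 1 0) (by fun_prop) ?_
  intro R d p h
  change Fin 2 → ℕ at d
  change Fin 2 → ℕ at p
  have h' : ∀ i j : Fin 2, e (d i) < e (d j) ↔ p i < p j := h
  have h01 := h' 0 1
  have h10 := h' 1 0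
  change d 0 = d 1 ↔ _
  have : (p 0 = p 1) ↔ d 0 = d 1 := by
    rw [← e.injective.eq_iff (a := d 0), le_antisymm_iff, le_antisymm_iff, ← not_lt, ← not_lt,
      ← not_lt, ← not_lt, h01, h10]
  rw [← this]
  change _ ↔ ((List.ofFn p).getD 0 0 == (List.ofFn p).getD 1 0) = true
  simp

theorem emptinessDecidable_denseOrderAtoms (S : Type) [Encodable S] :
    EmptinessDecidable S denseOrderAtoms := by
  refine emptinessDecidable_of_orderDetermined (𝔸 := denseOrderAtoms) (Equiv.refl ℚ)
    (relN := fun b => bif b.1 == 0 then decide (b.2.getD 0 0 < b.2.getD 1 0)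
      else b.2.getD 0 0 == b.2.getD 1 0) (by fun_prop) ?_
  intro R d p h
  change Fin 2 at R
  change Fin 2 → ℚ at d
  change Fin 2 → ℕ at p
  have h' : ∀ i j : Fin 2, d i < d j ↔ p i < p j := h
  have h01 := h' 0 1
  have h10 := h' 1 0
  have : (p 0 = p 1) ↔ d 0 = d 1 := by
    rw [le_antisymm_iff, le_antisymm_iff, ← not_lt, ← not_lt, ← not_lt, ← not_lt, h01, h10]
  change (if R = 0 then d 0 < d 1 else d 0 = d 1) ↔
    (bif (R : ℕ) == 0 then decide ((List.ofFn p).getD 0 0 < (List.ofFn p).getD 1 0)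
      else (List.ofFn p).getD 0 0 == (List.ofFn p).getD 1 0) = true
  rw [← this, h01]
  fin_cases R <;> simp

end DataWords

theorem corollary3p3 :
    (∀ 𝔸 : DataWords.Atoms.{u}, 𝔸.ElimStrongGuessing →
      ∀ (S : Type) [Finite S] [Encodable S],
        DataWords.SatisfiabilityDecidable S 𝔸 ↔ DataWords.EmptinessDecidable S 𝔸) ∧
    (∀ (S : Type) [Finite S] [Encodable S],
      DataWords.SatisfiabilityDecidable S DataWords.equalityAtoms) ∧
    (∀ (S : Type) [Finite S] [Encodable S],
      DataWords.SatisfiabilityDecidable S DataWords.denseOrderAtoms) :=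
  ⟨fun 𝔸 _ S _ _ => DataWords.satisfiabilityDecidable_iff_emptinessDecidable 𝔸 S,
    fun S _ _ => DataWords.satisfiabilityDecidable_of_emptinessDecidable
      (DataWords.emptinessDecidable_equalityAtoms S),
    fun S _ _ => DataWords.satisfiabilityDecidable_of_emptinessDecidable
      (DataWords.emptinessDecidable_denseOrderAtoms S)⟩
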